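/- Let $q>0$, $q\neq 1$, $R>0$ be real and $N\ge 1$, $M\ge 1$ integers. Put $[x]_q=\frac{q^{x/2}-q^{-x/2}}{q^{1/2}-q^{-1/2}}$, $C_N=\frac{[N]_q[N+2]_q}{[2]_q^2}$ and $\Lambda_N=R\,\frac{[2]_{q^{N+1}}}{\sqrt{[N]_q[N+2]_q}}$. Let $U_q so(3)$ be the Hopf $*$-algebra generated by $E^\pm$ and $K^{\pm1}=q^{\pm H/2}$ with $KE^\pm K^{-1}=q^{\pm1}E^\pm$, $q^{1/2}E^+E^--q^{-1/2}E^-E^+=\frac{K^2-1}{q^{1/2}-q^{-1/2}}$, $\Delta E^\pm=E^\pm\otimes K+1\otimes E^\pm$, $\Delta K=K\otimes K$, $(E^+)^*=q^{-1/2}E^-$, $K^*=K$, and with universal $R$-matrix $\mathcal R=q^{H\otimes H/4}\sum_{n\ge0}\frac{(q^{1/2}-q^{-1/2})^n q^{n(n-1)/4}}{[n]_q!}(E^+)^n\otimes F^n$, where $F=q^{1/2}E^-K^{-1}$. Let $\hat S^2_{q,N}$ be the $q$-deformed fuzzy sphere: the $*$-algebra $\mathrm{Mat}_{N+1}(\mathbb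 C)$ with $x_1=R\,(q^{-1}[2]_qC_N)^{-1/2}\pi(E^+)$, $x_{-1}=-R\,(q[2]_qC_N)^{-1/2}\pi(E^-)$, $x_0=\frac{\Lambda_N}{q^{1/2}-q^{-1/2}}\bigl(1-\frac{[2]_q}{[2]_{q^{N+1}}}\pi(K)\bigr)$, where $\pi$ is the irreducible $*$-representation of $U_q so(3)$ of dimension $N+1$ in which $K$ has the eigenvalues $q^{(N-2i)/2}$, $0\le i\le N$, with the left action $g\triangleright a=\pi(g_{(1)})\,a\,\pi(Sg_{(2)})$. Then: (a) The $x_i$ generate $\hat S^2_{q,N}$ and satisfy $\varepsilon^{ij}_k x_ix_j=\Lambda_N x_k$, $g^{ij}x_ix_j=R^2$, $x_i^*=g^{ij}x_j$. Here the nonzero coefficients are $\varepsilon^{10}_1=\varepsilon^{0,-1}_{-1}=q^{1/2}$, $\varepsilon^{01}_1=\varepsilon^{-1,0}_{-1}=-q^{-1/2}$, $\varepsilon^{00}_0=q^{1/2}-q^{-1/2}$, $\varepsilon^{1,-1}_0=1=-\varepsilon^{-1,1}_0$ and $g^{1,-1}=-q^{1/2}$, $g^{00}=1$, $g^{-1,1}=-q^{-1/2}$.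 Moreover $\hat S^2_{q,N}$ is a left $U_q so(3)$-module algebra, and $(x_1,x_0,x_{-1})$ carries the vector representation. (b) There is exactly one algebra homomorphism $\hat\varphi$ from the cross product of $U_q so(3)$ and $\hat S^2_{q,N}$ (in which $g\,a=(g_{(1)}\triangleright a)\,g_{(2)}$) to $\hat S^2_{q,N}$ that is the identity on $\hat S^2_{q,N}$ and has $\hat\varphi(E^+)=\frac1R\sqrt{q^{-1}[2]_qC_N}\,x_1$, $\hat\varphi(E^-)=-\frac1R\sqrt{q[2]_qC_N}\,x_{-1}$, $\hat\varphi(q^{H/2})=\frac{[2]_{q^{N+1}}}{[2]_q}\bigl(1-\frac{q^{1/2}-q^{-1/2}}{\Lambda_N}x_0\bigr)$. It is a $*$-homomorphism. (c) The universal $R$-matrix with its first leg acting on $\hat S^2_{q,N}$ is an invertible element of $\mathrm{End}(\hat S^2_{q,N})\otimes U_q so(3)$. Let $\mathcal A_1,\dots,\mathcal A_M$ be copies of $\hat S^2_{q,N}$ and let $\mathcal A^{\pm}=\mathcal A_1\underline\otimes^{\pm}\cdots\underline\otimes^{\pm}\mathcal A_M$ be their iterated braided tensor product, that is, the algebra generated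 by the algebras $\mathcal A_\alpha$ with the cross relations, for $a\in\mathcal A_\alpha$, $b\in\mathcal A_\beta$, $\alpha<\beta$, $b\,a=(\mathcal R^{-1(1)}\triangleright a)(\mathcal R^{-1(2)}\triangleright b)$ for $\mathcal A^+$ and $b\,a=(\mathcal R^{(2)}\triangleright a)(\mathcal R^{(1)}\triangleright b)$ for $\mathcal A^-$. For each sign, $a_1\otimes\cdots\otimes a_M\mapsto a_1\cdots a_M$ is a linear bijection from the tensor product of the vector spaces $\mathcal A_\alpha$ onto $\mathcal A^\pm$, and $$\mathcal A^{\pm}=\mathcal A_1\otimes\tilde{\mathcal A}_2^{\pm}\otimes\cdots\otimes\tilde{\mathcal A}_M^{\pm},$$ that is, the $\tilde{\mathcal A}^\pm_\alpha$ (with $\tilde{\mathcal A}_1^\pm=\mathcal A_1$) are subalgebras of $\mathcal A^\pm$, each isomorphic to $\mathcal A_1$, and their inclusions induce an algebra isomorphism from their ordinary tensor product algebra onto $\mathcal A^\pm$. They are obtained by iterated unbraiding: $y^{(0)}_\alpha:\hat S^2_{q,N}\to\mathcal A^\pm$ is the embedding of the $\alpha$-th copy; for $k\ge1$, $y^{(k)}_\alpha(a)=y^{(k-1)}_\alpha(\mathcal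 R^{(2)}\triangleright a)\,y^{(k-1)}_k(\hat\varphi(\mathcal R^{(1)}))$ for $\mathcal A^+$, respectively $y^{(k)}_\alpha(a)=y^{(k-1)}_\alpha(\mathcal R^{-1(1)}\triangleright a)\,y^{(k-1)}_k(\hat\varphi(\mathcal R^{-1(2)}))$ for $\mathcal A^-$, if $\alpha>k$, and $y^{(k)}_\alpha=y^{(k-1)}_\alpha$ if $\alpha\le k$; $y^{(\alpha-1)}_\alpha$ is an injective algebra homomorphism, and $\tilde{\mathcal A}_\alpha^\pm$ is its image. -/

import Mathlib

open scoped TensorProduct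

namespace QFuzzy

noncomputable section

/-! ### q-numbers -/

/-- `q ^ (1/2)`, as a complex number. -/
def qhalf (q : ℝ) : ℂ := ((q ^ (1 / 2 : ℝ) : ℝ) : ℂ)

/-- The q-number `[x]_q = (q^(x/2) - q^(-x/2)) / (q^(1/2) - q^(-1/2))`. -/
def qnum (q x : ℝ) : ℝ :=
  (q ^ (x / 2) - q ^ (-x / 2)) / (q ^ (1 / 2 : ℝ) - q ^ (-1 / 2 : ℝ))

/-- `C_N = [N]_q [N+2]_q / [2]_q ^ 2`. -/
def cN (q : ℝ) (N : ℕ) : ℝ := qnum q N * qnum q (N + 2) / qnum q 2 ^ 2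

/-- `Λ_N = r [2]_{q^(N+1)} / √([N]_q [N+2]_q)`, where `r` is the radius. -/
def lambdaN (q r : ℝ) (N : ℕ) : ℝ :=
  r * (qnum (q ^ (N + 1)) 2 / √(qnum q N * qnum q (N + 2)))

/-- The q-factorial `[n]_q! = [1]_q ⋯ [n]_q`. -/
def qfact (q : ℝ) (n : ℕ) : ℝ := ∏ k ∈ Finset.range n, qnum q (k + 1)

/-! ### The Hopf algebra `U_q so(3)` -/

/-- The generators `E⁺`, `E⁻`, `K = q^(H/2)`, `K⁻¹ = q^(-H/2)`. -/
inductive Gen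
  | ep | em | k | ki

/-- The relations `K K⁻¹ = K⁻¹ K = 1`, `K E^± K⁻¹ = q^(±1) E^±` and
`q^(1/2) E⁺ E⁻ - q^(-1/2) E⁻ E⁺ = (K² - 1) / (q^(1/2) - q^(-1/2))`. In terms of
`X^± = E^± q^(-H/4)` the last one is `[X⁺, X⁻] = (q^(H/2) - q^(-H/2)) / (q^(1/2) - q^(-1/2))`. -/
inductive URel (q : ℝ) : FreeAlgebra ℂ Gen → FreeAlgebra ℂ Gen → Prop
  | k_ki : URel q (FreeAlgebra.ι ℂ .k * FreeAlgebra.ι ℂ .ki) 1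
  | ki_k : URel q (FreeAlgebra.ι ℂ .ki * FreeAlgebra.ι ℂ .k) 1
  | k_ep : URel q (FreeAlgebra.ι ℂ .k * FreeAlgebra.ι ℂ .ep)
      (qhalf q ^ 2 • (FreeAlgebra.ι ℂ .ep * FreeAlgebra.ι ℂ .k))
  | em_k : URel q (FreeAlgebra.ι ℂ .em * FreeAlgebra.ι ℂ .k)
      (qhalf q ^ 2 • (FreeAlgebra.ι ℂ .k * FreeAlgebra.ι ℂ .em))
  | ep_em : URel q
      (qhalf q • (FreeAlgebra.ι ℂ .ep * FreeAlgebra.ι ℂ .em)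
        - (qhalf q)⁻¹ • (FreeAlgebra.ι ℂ .em * FreeAlgebra.ι ℂ .ep))
      ((qhalf q - (qhalf q)⁻¹)⁻¹ • (FreeAlgebra.ι ℂ .k * FreeAlgebra.ι ℂ .k - 1))

/-- The algebra `U_q so(3)`. -/
def Uq (q : ℝ) : Type := RingQuot (URel q)

instance (q : ℝ) : Ring (Uq q) := inferInstanceAs (Ring (RingQuot (URel q)))
instance (q : ℝ) : Algebra ℂ (Uq q) := inferInstanceAs (Algebra ℂ (RingQuot (URel q)))

namespace Uq

variable {q : ℝ}

/-- The quotient map. -/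
def mk (q : ℝ) : FreeAlgebra ℂ Gen →ₐ[ℂ] Uq q := RingQuot.mkAlgHom ℂ (URel q)

/-- The generator `E⁺`. -/
def Ep (q : ℝ) : Uq q := mk q (FreeAlgebra.ι ℂ .ep)
/-- The generator `E⁻`. -/
def Em (q : ℝ) : Uq q := mk q (FreeAlgebra.ι ℂ .em)
/-- The generator `K = q^(H/2)`. -/
def K (q : ℝ) : Uq q := mk q (FreeAlgebra.ι ℂ .k)
/-- The generator `K⁻¹ = q^(-H/2)`. -/
def Ki (q : ℝ) : Uq q := mk q (FreeAlgebra.ι ℂ .ki)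

lemma mk_rel {x y : FreeAlgebra ℂ Gen} (h : URel q x y) : mk q x = mk q y :=
  RingQuot.mkAlgHom_rel ℂ h

lemma K_Ki : K q * Ki q = 1 := by
  simpa [K, Ki] using mk_rel (URel.k_ki (q := q))
lemma Ki_K : Ki q * K q = 1 := by
  simpa [K, Ki] using mk_rel (URel.ki_k (q := q))
lemma K_Ep : K q * Ep q = qhalf q ^ 2 • (Ep q * K q) := by
  simpa [K, Ep, Em] using mk_rel (URel.k_ep (q := q))
lemma Em_K : Em q * K q = qhalf q ^ 2 • (K q * Em q) := by
  simpa [K, Ep, Em] using mk_rel (URel.em_k (q := q))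
lemma Ep_Em : qhalf q • (Ep q * Em q) - (qhalf q)⁻¹ • (Em q * Ep q)
    = (qhalf q - (qhalf q)⁻¹)⁻¹ • (K q * K q - 1) := by
  simpa [K, Ep, Em] using mk_rel (URel.ep_em (q := q))

/-- The universal property of `U_q so(3)`. -/
def lift {B : Type*} [Ring B] [Algebra ℂ B] (e f k k' : B)
    (h1 : k * k' = 1) (h2 : k' * k = 1) (h3 : k * e = qhalf q ^ 2 • (e * k))
    (h4 : f * k = qhalf q ^ 2 • (k * f))
    (h5 : qhalf q • (e * f) - (qhalf q)⁻¹ • (f * e) = (qhalf q - (qhalf q)⁻¹)⁻¹ • (k * k - 1)) :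
    Uq q →ₐ[ℂ] B :=
  RingQuot.liftAlgHom ℂ ⟨FreeAlgebra.lift ℂ (fun | .ep => e | .em => f | .k => k | .ki => k'), by
    intro x y h
    cases h <;> simp_all⟩

section lift
variable {B : Type*} [Ring B] [Algebra ℂ B] {e f k k' : B}
    (h1 : k * k' = 1) (h2 : k' * k = 1) (h3 : k * e = qhalf q ^ 2 • (e * k))
    (h4 : f * k = qhalf q ^ 2 • (k * f))
    (h5 : qhalf q • (e * f) - (qhalf q)⁻¹ • (f * e) = (qhalf q - (qhalf q)⁻¹)⁻¹ • (k * k - 1))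
@[simp] lemma lift_Ep : lift e f k k' h1 h2 h3 h4 h5 (Ep q) = e := by
  exact (RingQuot.liftAlgHom_mkAlgHom_apply ℂ _ _ _).trans (by simp)
@[simp] lemma lift_Em : lift e f k k' h1 h2 h3 h4 h5 (Em q) = f := by
  exact (RingQuot.liftAlgHom_mkAlgHom_apply ℂ _ _ _).trans (by simp)
@[simp] lemma lift_K : lift e f k k' h1 h2 h3 h4 h5 (K q) = k := by
  exact (RingQuot.liftAlgHom_mkAlgHom_apply ℂ _ _ _).trans (by simp)
@[simp] lemma lift_Ki : lift e f k k' h1 h2 h3 h4 h5 (Ki q) = k' := by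
  exact (RingQuot.liftAlgHom_mkAlgHom_apply ℂ _ _ _).trans (by simp)
end lift

lemma hom_ext {B : Type*} [Semiring B] [Algebra ℂ B] {f g : Uq q →ₐ[ℂ] B}
    (h1 : f (Ep q) = g (Ep q)) (h2 : f (Em q) = g (Em q))
    (h3 : f (K q) = g (K q)) (h4 : f (Ki q) = g (Ki q)) : f = g := by
  apply RingQuot.ringQuot_ext'
  apply FreeAlgebra.hom_ext
  funext x
  cases x
  · exact h1
  · exact h2
  · exact h3
  · exact h4

lemma induction {P : Uq q → Prop} (hs : ∀ c : ℂ, P (algebraMap ℂ _ c))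
    (h1 : P (Ep q)) (h2 : P (Em q)) (h3 : P (K q)) (h4 : P (Ki q))
    (ha : ∀ a b, P a → P b → P (a + b)) (hm : ∀ a b, P a → P b → P (a * b)) (a : Uq q) : P a := by
  obtain ⟨y, rfl⟩ : ∃ y, mk q y = a := RingQuot.mkAlgHom_surjective ℂ (URel q) a
  induction y using FreeAlgebra.induction with
  | grade0 c => simpa using hs c
  | grade1 x =>
    cases x
    · exact h1
    · exact h2
    · exact h3
    · exact h4
  | mul a b ha hb => rw [map_mul]; exact hm _ _ ha hb
  | add a b ha' hb => rw [map_add]; exact ha _ _ ha' hb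

lemma coeff1 : (qhalf q)⁻¹ * qhalf q ^ 2 = qhalf q := by
  by_cases h : qhalf q = 0
  · simp [h]
  · field_simp

/-- The coproduct: `Δ E^± = E^± ⊗ K + 1 ⊗ E^±`, `Δ K = K ⊗ K`. -/
def comul (q : ℝ) : Uq q →ₐ[ℂ] Uq q ⊗[ℂ] Uq q :=
  lift (Ep q ⊗ₜ K q + 1 ⊗ₜ Ep q) (Em q ⊗ₜ K q + 1 ⊗ₜ Em q) (K q ⊗ₜ K q) (Ki q ⊗ₜ Ki q)
    (by simp [K_Ki, Algebra.TensorProduct.one_def]) (by simp [Ki_K, Algebra.TensorProduct.one_def])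
    (by
      simp only [mul_add, add_mul, Algebra.TensorProduct.tmul_mul_tmul, K_Ep, mul_one, one_mul,
        smul_add, TensorProduct.smul_tmul', TensorProduct.tmul_smul])
    (by
      simp only [mul_add, add_mul, Algebra.TensorProduct.tmul_mul_tmul, Em_K, mul_one, one_mul,
        smul_add, TensorProduct.smul_tmul', TensorProduct.tmul_smul])
    (by
      have e : qhalf q • (Ep q * Em q) = (qhalf q)⁻¹ • (Em q * Ep q)
          + (qhalf q - (qhalf q)⁻¹)⁻¹ • (K q * K q - 1) := by rw [← Ep_Em]; abel
      simp only [mul_add, add_mul, Algebra.TensorProduct.tmul_mul_tmul, K_Ep, Em_K, mul_one,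
        one_mul, smul_add, TensorProduct.tmul_smul, smul_smul, coeff1]
      rw [TensorProduct.smul_tmul', e, ← TensorProduct.tmul_smul (qhalf q) (1 : Uq q) (Ep q * Em q), e,
        TensorProduct.add_tmul, TensorProduct.tmul_add]
      simp only [smul_sub, TensorProduct.tmul_smul, TensorProduct.smul_tmul',
        TensorProduct.tmul_sub, TensorProduct.sub_tmul, Algebra.TensorProduct.one_def]
      abel)

/-- The counit: `ε E^± = 0`, `ε K = 1`. -/
def counit (q : ℝ) : Uq q →ₐ[ℂ] ℂ :=
  lift 0 0 1 1 (by simp) (by simp) (by simp) (by simp) (by simp)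

instance : Bialgebra ℂ (Uq q) :=
  Bialgebra.ofAlgHom (comul q) (counit q)
    (by apply hom_ext <;>
        simp [comul, TensorProduct.add_tmul, TensorProduct.tmul_add, add_assoc,
          Algebra.TensorProduct.one_def])
    (by apply hom_ext <;> simp [comul, counit])
    (by apply hom_ext <;> simp [comul, counit])

lemma Ep_Ki : Ep q * Ki q = qhalf q ^ 2 • (Ki q * Ep q) := by
  calc Ep q * Ki q = Ki q * (K q * Ep q) * Ki q := by rw [← mul_assoc, Ki_K, one_mul]
    _ = qhalf q ^ 2 • (Ki q * Ep q * (K q * Ki q)) := by rw [K_Ep]; simp [mul_assoc]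
    _ = _ := by rw [K_Ki, mul_one]

lemma Ki_Em : Ki q * Em q = qhalf q ^ 2 • (Em q * Ki q) := by
  calc Ki q * Em q = Ki q * (Em q * K q) * Ki q := by rw [mul_assoc, mul_assoc, K_Ki, mul_one]
    _ = qhalf q ^ 2 • ((Ki q * K q) * Em q * Ki q) := by rw [Em_K]; simp [mul_assoc]
    _ = _ := by rw [Ki_K, one_mul]

open MulOpposite in
/-- The antipode as an algebra homomorphism to the opposite algebra:
`S E^± = - E^± K⁻¹`, `S K = K⁻¹`. -/
def antipodeOp (q : ℝ) : Uq q →ₐ[ℂ] (Uq q)ᵐᵒᵖ :=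
  lift (op (-(Ep q * Ki q))) (op (-(Em q * Ki q))) (op (Ki q)) (op (K q))
    (by rw [← op_mul, K_Ki, op_one]) (by rw [← op_mul, Ki_K, op_one])
    (by
      rw [← op_mul, ← op_mul, ← op_smul]
      congr 1
      rw [neg_mul, Ep_Ki]; simp [mul_assoc, Ep_Ki])
    (by
      rw [← op_mul, ← op_mul, ← op_smul]
      congr 1
      rw [mul_neg, ← mul_assoc, Ki_Em]; simp)
    (by
      rw [← op_mul, ← op_mul, ← op_mul, ← op_smul, ← op_smul, ← op_one, ← op_sub, ← op_sub,
        ← op_smul]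
      congr 1
      have e1 : qhalf q • (Em q * Ki q * (Ep q * Ki q)) =
          (qhalf q)⁻¹ • (Ki q * (Em q * Ep q) * Ki q) := by
        rw [← mul_assoc (Ki q), Ki_Em]
        simp only [smul_mul_assoc, smul_smul, coeff1, mul_assoc]
      have e2 : (qhalf q)⁻¹ • (Ep q * Ki q * (Em q * Ki q)) =
          qhalf q • (Ki q * (Ep q * Em q) * Ki q) := by
        rw [Ep_Ki]
        simp only [smul_mul_assoc, smul_smul, coeff1, mul_assoc]
      rw [neg_mul_neg, neg_mul_neg, e1, e2]
      have : (qhalf q)⁻¹ • (Ki q * (Em q * Ep q) * Ki q) - qhalf q • (Ki q * (Ep q * Em q) * Ki q)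
          = -(Ki q * (qhalf q • (Ep q * Em q) - (qhalf q)⁻¹ • (Em q * Ep q)) * Ki q) := by
        simp [mul_sub, sub_mul]
      rw [this, Ep_Em]
      have h : Ki q * (K q * K q - 1) * Ki q = 1 - Ki q * Ki q := by
        rw [mul_sub, ← mul_assoc, Ki_K, one_mul, sub_mul, K_Ki, mul_one]
      rw [mul_smul_comm, smul_mul_assoc, h, ← smul_neg, neg_sub])

/-- The antipode. -/
def antipode (q : ℝ) : Uq q →ₗ[ℂ] Uq q :=
  (MulOpposite.opLinearEquiv ℂ).symm.toLinearMap ∘ₗ (antipodeOp q).toLinearMap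

lemma antipode_mul (a b : Uq q) : antipode q (a * b) = antipode q b * antipode q a := by
  simp [antipode]

lemma antipode_algebraMap (c : ℂ) :
    antipode q (algebraMap ℂ (Uq q) c) = algebraMap ℂ (Uq q) c := by
  simp [antipode]

lemma left_aux (t u : Uq q ⊗[ℂ] Uq q) (c : ℂ)
    (h : LinearMap.mul' ℂ _ ((antipode q).rTensor _ t) = algebraMap ℂ (Uq q) c) :
    LinearMap.mul' ℂ _ ((antipode q).rTensor _ (t * u))
      = c • LinearMap.mul' ℂ _ ((antipode q).rTensor _ u) := by
  induction u with
  | zero => simp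
  | add u v hu hv => rw [mul_add, map_add, map_add, hu, hv, map_add, map_add, smul_add]
  | tmul a b =>
    have key : ∀ t : Uq q ⊗[ℂ] Uq q, LinearMap.mul' ℂ _ ((antipode q).rTensor _ (t * a ⊗ₜ b))
        = antipode q a * LinearMap.mul' ℂ _ ((antipode q).rTensor _ t) * b := by
      intro t
      induction t with
      | zero => simp
      | add u v hu hv =>
        rw [add_mul, map_add, map_add, hu, hv, map_add, map_add, mul_add, add_mul]
      | tmul x y => simp [antipode_mul, mul_assoc]
    rw [key, h]
    simp [Algebra.algebraMap_eq_smul_one]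

lemma right_aux (t u : Uq q ⊗[ℂ] Uq q) (c : ℂ)
    (h : LinearMap.mul' ℂ _ ((antipode q).lTensor _ u) = algebraMap ℂ (Uq q) c) :
    LinearMap.mul' ℂ _ ((antipode q).lTensor _ (t * u))
      = c • LinearMap.mul' ℂ _ ((antipode q).lTensor _ t) := by
  induction t with
  | zero => simp
  | add u v hu hv => rw [add_mul, map_add, map_add, hu, hv, map_add, map_add, smul_add]
  | tmul a b =>
    have key : ∀ t : Uq q ⊗[ℂ] Uq q, LinearMap.mul' ℂ _ ((antipode q).lTensor _ (a ⊗ₜ b * t))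
        = a * LinearMap.mul' ℂ _ ((antipode q).lTensor _ t) * antipode q b := by
      intro t
      induction t with
      | zero => simp
      | add u v hu hv =>
        rw [mul_add, map_add, map_add, hu, hv, map_add, map_add, mul_add, add_mul]
      | tmul x y => simp [antipode_mul, mul_assoc]
    rw [key, h]
    simp [Algebra.algebraMap_eq_smul_one]

instance : HopfAlgebra ℂ (Uq q) where
  antipode := antipode q
  mul_antipode_rTensor_comul := by
    ext a
    change LinearMap.mul' ℂ _ ((antipode q).rTensor _ (comul q a))
      = algebraMap ℂ (Uq q) (counit q a)
    induction a using Uq.induction with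
    | hs c => simp [Algebra.TensorProduct.algebraMap_apply, antipode_algebraMap]
    | h1 => simp [comul, counit, antipode, antipodeOp, mul_assoc, Ki_K]
    | h2 => simp [comul, counit, antipode, antipodeOp, mul_assoc, Ki_K]
    | h3 => simp [comul, counit, antipode, antipodeOp, Ki_K]
    | h4 => simp [comul, counit, antipode, antipodeOp, K_Ki]
    | ha a b h h' => simp only [map_add, h, h']
    | hm a b h h' =>
      rw [map_mul, left_aux _ _ _ h, h', map_mul, map_mul, Algebra.smul_def]
  mul_antipode_lTensor_comul := by
    ext a
    change LinearMap.mul' ℂ _ ((antipode q).lTensor _ (comul q a))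
      = algebraMap ℂ (Uq q) (counit q a)
    induction a using Uq.induction with
    | hs c =>
      have h1 : antipode q 1 = 1 := by simpa using antipode_algebraMap (q := q) 1
      simp [Algebra.TensorProduct.algebraMap_apply, h1]
    | h1 => simp [comul, counit, antipode, antipodeOp]
    | h2 => simp [comul, counit, antipode, antipodeOp]
    | h3 => simp [comul, counit, antipode, antipodeOp, K_Ki]
    | h4 => simp [comul, counit, antipode, antipodeOp, Ki_K]
    | ha a b h h' => simp only [map_add, h, h']
    | hm a b h h' =>
      rw [map_mul, right_aux _ _ _ h', h, map_mul, map_mul, Algebra.smul_def,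
        Algebra.commutes]

/-! The `*`-structure (compact real form): conjugate-linear, antimultiplicative, with
`(E⁺)^* = q^(-1/2) E⁻`, `(E⁻)^* = q^(1/2) E⁺`, `K^* = K`, that is, `(X^±)^* = X^∓`, `H^* = H`. -/

/-- The opposite algebra with complex-conjugated scalars. -/
def ConjOp (q : ℝ) : Type := (Uq q)ᵐᵒᵖ

instance : Ring (ConjOp q) := inferInstanceAs (Ring (Uq q)ᵐᵒᵖ)
instance : Algebra ℂ (ConjOp q) :=
  Algebra.compHom (R := ℂ) (S := ℂ) (Uq q)ᵐᵒᵖ (starRingEnd ℂ)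

/-- An element of `U_q so(3)` in the conjugate opposite algebra. -/
def toConjOp : Uq q ≃+ ConjOp q := MulOpposite.opAddEquiv

lemma toConjOp_mul (a b : Uq q) : toConjOp (a * b) = toConjOp b * toConjOp a := rfl
lemma toConjOp_one : toConjOp (1 : Uq q) = 1 := rfl
lemma smul_toConjOp (c : ℂ) (a : Uq q) :
    c • toConjOp a = toConjOp ((starRingEnd ℂ c) • a) := rfl

lemma conj_qhalf : (starRingEnd ℂ) (qhalf q) = qhalf q := Complex.conj_ofReal _

/-- The `*`-structure as an algebra homomorphism to the conjugate opposite algebra. -/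
def starHom (q : ℝ) : Uq q →ₐ[ℂ] ConjOp q :=
  lift (toConjOp ((qhalf q)⁻¹ • Em q)) (toConjOp (qhalf q • Ep q)) (toConjOp (K q)) (toConjOp (Ki q))
    (by rw [← toConjOp_mul, Ki_K, toConjOp_one]) 
    (by rw [← toConjOp_mul, K_Ki, toConjOp_one]) 
    (by
      rw [← toConjOp_mul, ← toConjOp_mul, smul_toConjOp, map_pow, conj_qhalf, smul_mul_assoc, Em_K,
        mul_smul_comm, smul_comm])
    (by
      rw [← toConjOp_mul, ← toConjOp_mul, smul_toConjOp, map_pow, conj_qhalf, mul_smul_comm, K_Ep,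
        smul_mul_assoc, smul_comm])
    (by
      have h1 : qhalf q * (qhalf q * (qhalf q)⁻¹) = qhalf q := by
        by_cases h : qhalf q = 0
        · simp [h]
        · field_simp
      have h2 : (qhalf q)⁻¹ * ((qhalf q)⁻¹ * qhalf q) = (qhalf q)⁻¹ := by
        by_cases h : qhalf q = 0
        · simp [h]
        · field_simp
      rw [← toConjOp_mul, ← toConjOp_mul, ← toConjOp_mul, ← toConjOp_one, ← map_sub,
        smul_toConjOp, smul_toConjOp, smul_toConjOp, ← map_sub]
      congr 1
      simp only [map_inv₀, map_sub, conj_qhalf, smul_mul_smul_comm, smul_smul, h1, h2]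
      exact Ep_Em)

/-- The involution `g ↦ g^*` of `U_q so(3)`. -/
def conj (g : Uq q) : Uq q := toConjOp.symm (starHom q g)

end Uq

/-! ### The q-deformed fuzzy sphere -/

/-- The algebra underlying the fuzzy sphere `Ŝ²_{q,N}`, with its `*`-structure the conjugate
transpose. The index `i = 0, …, N` labels the basis vector of weight `H = N - 2 i` of the
irreducible representation of dimension `N + 1`. -/
abbrev Fuzzy (N : ℕ) : Type := Matrix (Fin (N + 1)) (Fin (N + 1)) ℂ

/-- `K = q^(H/2)` in the irreducible representation of dimension `N + 1`. -/
def spinK (q : ℝ) (N : ℕ) : Fuzzy N :=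
  Matrix.diagonal fun i => ((q ^ (((N : ℝ) - 2 * (i : ℕ)) / 2) : ℝ) : ℂ)

/-- `K⁻¹ = q^(-H/2)` in the irreducible representation of dimension `N + 1`. -/
def spinKi (q : ℝ) (N : ℕ) : Fuzzy N :=
  Matrix.diagonal fun i => ((q ^ (-(((N : ℝ) - 2 * (i : ℕ)) / 2)) : ℝ) : ℂ)

/-- `E⁺ = X⁺ q^(H/4)` in the irreducible representation of dimension `N + 1`, where `X⁺` maps the
`j`-th basis vector to `√([j]_q [N+1-j]_q)` times the one before it. -/
def spinEp (q : ℝ) (N : ℕ) : Fuzzy N := Matrix.of fun i j =>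
  if (j : ℕ) = i + 1 then
    ((√(qnum q (j : ℕ) * qnum q (N + 1 - (j : ℕ))) * q ^ (((N : ℝ) - 2 * (j : ℕ)) / 4) : ℝ) : ℂ)
  else 0

/-- `E⁻ = X⁻ q^(H/4)` in the irreducible representation of dimension `N + 1`, where `X⁻` is the
transpose of `X⁺`. -/
def spinEm (q : ℝ) (N : ℕ) : Fuzzy N := Matrix.of fun i j =>
  if (i : ℕ) = j + 1 then
    ((√(qnum q (i : ℕ) * qnum q (N + 1 - (i : ℕ))) * q ^ (((N : ℝ) - 2 * (j : ℕ)) / 4) : ℝ) : ℂ)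
  else 0

section rep

variable {q : ℝ} (hq : 0 < q) (N : ℕ)

lemma qhalf_sq (hq : 0 < q) : qhalf q ^ 2 = (q : ℂ) := by
  rw [qhalf, ← Complex.ofReal_pow, ← Real.rpow_natCast, ← Real.rpow_mul hq.le]
  norm_num

lemma qnum_nonneg (hq : 0 < q) {x : ℝ} (hx : 0 ≤ x) : 0 ≤ qnum q x := by
  unfold qnum
  rcases le_total 1 q with h | h
  · apply div_nonneg <;> rw [sub_nonneg] <;> apply Real.rpow_le_rpow_of_exponent_le h <;> linarith
  · apply div_nonneg_of_nonpos <;> rw [sub_nonpos] <;>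
      apply Real.rpow_le_rpow_of_exponent_ge hq h <;> linarith

lemma spinEp_mul_spinEm (hq : 0 < q) : spinEp q N * spinEm q N = Matrix.diagonal fun i : Fin (N + 1) =>
    ((qnum q ((i : ℕ) + 1) * qnum q (N - (i : ℕ)) * q ^ (((N : ℝ) - 2 * (i : ℕ) - 1) / 2) : ℝ) : ℂ)
    := by
  ext i l
  rw [Matrix.mul_apply]
  by_cases hil : i = l
  · subst hil
    rw [Matrix.diagonal_apply_eq]
    by_cases hi : (i : ℕ) + 1 < N + 1
    · rw [Finset.sum_eq_single (⟨i + 1, hi⟩ : Fin (N + 1))]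
      · have hi' : ((i : ℕ) : ℝ) + 1 ≤ N := by exact_mod_cast Nat.lt_succ_iff.mp hi
        simp only [spinEp, spinEm, Matrix.of_apply, if_true]
        rw [← Complex.ofReal_mul]
        congr 1
        push_cast
        have e : (N : ℝ) + 1 - (((i : ℕ) : ℝ) + 1) = N - (i : ℕ) := by ring
        have e2 : q ^ (((N : ℝ) - 2 * (((i : ℕ) : ℝ) + 1)) / 4) * q ^ (((N : ℝ) - 2 * (i : ℕ)) / 4)
            = q ^ (((N : ℝ) - 2 * (i : ℕ) - 1) / 2) := by
          rw [← Real.rpow_add hq]; congr 1; ring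
        have h0 : 0 ≤ qnum q ((i : ℕ) + 1) * qnum q (N - (i : ℕ)) :=
          mul_nonneg (qnum_nonneg hq (by positivity)) (qnum_nonneg hq (by linarith))
        rw [e, mul_mul_mul_comm, Real.mul_self_sqrt h0, e2]
      · intro j _ hj
        have : (j : ℕ) ≠ i + 1 := fun h => hj (Fin.ext h)
        simp [spinEp, this]
      · simp
    · have hi' : (i : ℕ) = N := by omega
      rw [Finset.sum_eq_zero]
      · simp [hi', qnum]
      · intro j _
        have : (j : ℕ) ≠ i + 1 := by omega
        simp [spinEp, this]
  · rw [Matrix.diagonal_apply_ne _ hil, Finset.sum_eq_zero]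
    intro j _
    by_cases h : (j : ℕ) = i + 1
    · have : (j : ℕ) ≠ l + 1 := fun h' => hil (Fin.ext (by omega))
      simp [spinEm, this]
    · simp [spinEp, h]

lemma spinEm_mul_spinEp (hq : 0 < q) : spinEm q N * spinEp q N = Matrix.diagonal fun i : Fin (N + 1) =>
    ((qnum q (i : ℕ) * qnum q (N + 1 - (i : ℕ)) * q ^ (((N : ℝ) - 2 * (i : ℕ) + 1) / 2) : ℝ) : ℂ)
    := by
  ext i l
  rw [Matrix.mul_apply]
  by_cases hil : i = l
  · subst hil
    rw [Matrix.diagonal_apply_eq]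
    by_cases hi : (i : ℕ) = 0
    · rw [Finset.sum_eq_zero]
      · simp [hi, qnum]
      · intro j _
        have : (i : ℕ) ≠ j + 1 := by omega
        simp [spinEm, this]
    · obtain ⟨k, hk⟩ := Nat.exists_eq_succ_of_ne_zero hi
      have hkN : k < N + 1 := by omega
      rw [Finset.sum_eq_single (⟨k, hkN⟩ : Fin (N + 1))]
      · have hi' : ((i : ℕ) : ℝ) ≤ N := by exact_mod_cast Nat.lt_succ_iff.mp i.2
        have hk' : ((i : ℕ) : ℝ) = k + 1 := by exact_mod_cast hk
        simp only [spinEp, spinEm, Matrix.of_apply, hk, Nat.succ_eq_add_one, if_true]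
        rw [← Complex.ofReal_mul]
        congr 1
        push_cast
        have e2 : q ^ (((N : ℝ) - 2 * (k : ℝ)) / 4) * q ^ (((N : ℝ) - 2 * ((k : ℝ) + 1)) / 4)
            = q ^ (((N : ℝ) - 2 * ((k : ℝ) + 1) + 1) / 2) := by
          rw [← Real.rpow_add hq]; congr 1; ring
        have h0 : 0 ≤ qnum q ((k : ℝ) + 1) * qnum q ((N : ℝ) + 1 - ((k : ℝ) + 1)) :=
          mul_nonneg (qnum_nonneg hq (by positivity)) (qnum_nonneg hq (by linarith))
        rw [mul_mul_mul_comm, Real.mul_self_sqrt h0, e2]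
      · intro j _ hj
        have : (i : ℕ) ≠ j + 1 := fun h => hj (Fin.ext (by simp; omega))
        simp [spinEm, this]
      · simp
  · rw [Matrix.diagonal_apply_ne _ hil, Finset.sum_eq_zero]
    intro j _
    by_cases h : (i : ℕ) = j + 1
    · have : (l : ℕ) ≠ j + 1 := fun h' => hil (Fin.ext (by omega))
      simp [spinEp, this]
    · simp [spinEm, h]

lemma spinK_mul_spinKi (hq : 0 < q) : spinK q N * spinKi q N = 1 := by
  rw [spinK, spinKi, Matrix.diagonal_mul_diagonal, ← Matrix.diagonal_one]
  congr 1
  funext i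
  rw [← Complex.ofReal_mul, ← Real.rpow_add hq]
  simp

lemma spinKi_mul_spinK (hq : 0 < q) : spinKi q N * spinK q N = 1 := by
  rw [spinK, spinKi, Matrix.diagonal_mul_diagonal, ← Matrix.diagonal_one]
  congr 1
  funext i
  rw [← Complex.ofReal_mul, ← Real.rpow_add hq]
  simp

lemma spinK_mul_spinEp (hq : 0 < q) :
    spinK q N * spinEp q N = qhalf q ^ 2 • (spinEp q N * spinK q N) := by
  ext i j
  rw [spinK, Matrix.diagonal_mul, Matrix.smul_apply, Matrix.mul_diagonal, qhalf_sq hq, smul_eq_mul]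
  by_cases h : (j : ℕ) = i + 1
  · have e : q ^ (((N : ℝ) - 2 * (i : ℕ)) / 2) = q * q ^ (((N : ℝ) - 2 * (j : ℕ)) / 2) := by
      nth_rewrite 2 [← Real.rpow_one q]
      rw [← Real.rpow_add hq, h]; congr 1; push_cast; ring
    rw [e, Complex.ofReal_mul]
    ring
  · simp [spinEp, h]

lemma spinEm_mul_spinK (hq : 0 < q) :
    spinEm q N * spinK q N = qhalf q ^ 2 • (spinK q N * spinEm q N) := by
  ext i j
  rw [spinK, Matrix.mul_diagonal, Matrix.smul_apply, Matrix.diagonal_mul, qhalf_sq hq, smul_eq_mul]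
  by_cases h : (i : ℕ) = j + 1
  · have e : q ^ (((N : ℝ) - 2 * (j : ℕ)) / 2) = q * q ^ (((N : ℝ) - 2 * (i : ℕ)) / 2) := by
      nth_rewrite 2 [← Real.rpow_one q]
      rw [← Real.rpow_add hq, h]; congr 1; push_cast; ring
    rw [e, Complex.ofReal_mul]
    ring
  · simp [spinEm, h]

/-- The scalar identity behind the last relation of `U_q so(3)`. -/
lemma spin_scalar (hq : 0 < q) (x n : ℝ) :
    q ^ (1 / 2 : ℝ) * (qnum q (x + 1) * qnum q (n - x) * q ^ ((n - 2 * x - 1) / 2))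
      - (q ^ (1 / 2 : ℝ))⁻¹ * (qnum q x * qnum q (n + 1 - x) * q ^ ((n - 2 * x + 1) / 2))
      = (q ^ (1 / 2 : ℝ) - (q ^ (1 / 2 : ℝ))⁻¹)⁻¹ *
        (q ^ ((n - 2 * x) / 2) * q ^ ((n - 2 * x) / 2) - 1) := by
  have hneg : ∀ y : ℝ, q ^ (-y / 2) = (q ^ (y / 2))⁻¹ := fun y => by
    rw [neg_div, Real.rpow_neg hq.le]
  unfold qnum
  simp only [hneg]
  have e1 : q ^ ((x + 1) / 2) = q ^ (x / 2) * q ^ (1 / 2 : ℝ) := by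
    rw [← Real.rpow_add hq]; congr 1; ring
  have e2 : q ^ ((n - x) / 2) = q ^ (n / 2) * (q ^ (x / 2))⁻¹ := by
    rw [← Real.rpow_neg hq.le, ← Real.rpow_add hq]; congr 1; ring
  have e3 : q ^ ((n + 1 - x) / 2) = q ^ (n / 2) * (q ^ (x / 2))⁻¹ * q ^ (1 / 2 : ℝ) := by
    rw [← Real.rpow_neg hq.le, ← Real.rpow_add hq, ← Real.rpow_add hq]; congr 1; ring
  have e4 : q ^ ((n - 2 * x) / 2) = q ^ (n / 2) * (q ^ (x / 2))⁻¹ * (q ^ (x / 2))⁻¹ := by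
    rw [← Real.rpow_neg hq.le, ← Real.rpow_add hq, ← Real.rpow_add hq]; congr 1; ring
  have e5 : q ^ ((n - 2 * x - 1) / 2)
      = q ^ (n / 2) * (q ^ (x / 2))⁻¹ * (q ^ (x / 2))⁻¹ * (q ^ (1 / 2 : ℝ))⁻¹ := by
    rw [← e4, ← Real.rpow_neg hq.le, ← Real.rpow_add hq]; congr 1; ring
  have e6 : q ^ ((n - 2 * x + 1) / 2)
      = q ^ (n / 2) * (q ^ (x / 2))⁻¹ * (q ^ (x / 2))⁻¹ * q ^ (1 / 2 : ℝ) := by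
    rw [← e4, ← Real.rpow_add hq]; congr 1; ring
  rw [e5, e6, e1, e2, e3, e4]
  have hp : 0 < q ^ (1 / 2 : ℝ) := Real.rpow_pos_of_pos hq _
  have ha : 0 < q ^ (x / 2) := Real.rpow_pos_of_pos hq _
  have hb : 0 < q ^ (n / 2) := Real.rpow_pos_of_pos hq _
  generalize q ^ (1 / 2 : ℝ) = p at *
  generalize q ^ (x / 2) = a at *
  generalize q ^ (n / 2) = b at *
  by_cases h : p - p⁻¹ = 0
  · simp [h]
  · have h' : p ^ 2 - 1 ≠ 0 := by
      intro h0
      apply h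
      field_simp
      linarith
    field_simp
    ring

lemma spin_rel (hq : 0 < q) :
    qhalf q • (spinEp q N * spinEm q N) - (qhalf q)⁻¹ • (spinEm q N * spinEp q N)
      = (qhalf q - (qhalf q)⁻¹)⁻¹ • (spinK q N * spinK q N - 1) := by
  rw [spinEp_mul_spinEm N hq, spinEm_mul_spinEp N hq, spinK, Matrix.diagonal_mul_diagonal]
  ext i j
  by_cases hij : i = j
  · subst hij
    have := congrArg (fun z : ℝ => (z : ℂ)) (spin_scalar hq (i : ℕ) N)
    simp only [Matrix.sub_apply, Matrix.smul_apply, Matrix.diagonal_apply_eq, Matrix.one_apply_eq,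
      smul_eq_mul, qhalf]
    push_cast at this ⊢
    exact this
  · simp [hij]

/-- The irreducible representation of `U_q so(3)` of dimension `N + 1`. -/
def spinRep : Uq q →ₐ[ℂ] Fuzzy N :=
  Uq.lift (spinEp q N) (spinEm q N) (spinK q N) (spinKi q N) (spinK_mul_spinKi N hq)
    (spinKi_mul_spinK N hq) (spinK_mul_spinEp N hq) (spinEm_mul_spinK N hq) (spin_rel N hq)

/-- The fundamental vector representation `ρ` of `U_q so(3)`; the vector index `1, 0, -1`
corresponds to the matrix index `0, 1, 2`. -/
def vecRep : Uq q →ₐ[ℂ] Matrix (Fin 3) (Fin 3) ℂ := spinRep hq 2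

/-- The left action `g ▹ a = ∑ π(g₍₁₎) a π(S g₍₂₎)` of `U_q so(3)` on the fuzzy sphere, where `π`
is the irreducible representation of dimension `N + 1`. -/
def act : Uq q →ₐ[ℂ] Module.End ℂ (Fuzzy N) :=
  (AlgHom.mulLeftRight ℂ (Fuzzy N)).comp <|
    (Algebra.TensorProduct.map (spinRep hq N)
      ((spinRep hq N).op.comp (Uq.antipodeOp q))).comp (Uq.comul q)

end rep

/-- The generators of the fuzzy sphere of radius `r`; the vector index `1, 0, -1` corresponds to
`0, 1, 2`, so that `x₁ = gen 0`, `x₀ = gen 1`, `x₋₁ = gen 2`. -/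
def gen (q r : ℝ) (N : ℕ) : Fin 3 → Fuzzy N
  | 0 => ((r / √(q⁻¹ * qnum q 2 * cN q N) : ℝ) : ℂ) • spinEp q N
  | 1 => ((lambdaN q r N / (q ^ (1 / 2 : ℝ) - q ^ (-1 / 2 : ℝ)) : ℝ) : ℂ) •
      (1 - ((qnum q 2 / qnum (q ^ (N + 1)) 2 : ℝ) : ℂ) • spinK q N)
  | 2 => -(((r / √(q * qnum q 2 * cN q N) : ℝ) : ℂ) • spinEm q N)

/-- The spin 1 Clebsch-Gordan coefficients `ε^{ij}_k`, as `eps q k i j`, with vector indices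
`1, 0, -1` written as `0, 1, 2`. -/
def eps (q : ℝ) : Fin 3 → Fin 3 → Fin 3 → ℂ
  | 0, 0, 1 => qhalf q
  | 0, 1, 0 => -(qhalf q)⁻¹
  | 1, 1, 1 => qhalf q - (qhalf q)⁻¹
  | 1, 0, 2 => 1
  | 1, 2, 0 => -1
  | 2, 1, 2 => qhalf q
  | 2, 2, 1 => -(qhalf q)⁻¹
  | _, _, _ => 0

/-- The invariant metric `g^{ij}` that belongs to `eps`: `g^{1,-1} = -q^(1/2)`, `g^{00} = 1`,
`g^{-1,1} = -q^(-1/2)`. -/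
def metric (q : ℝ) : Fin 3 → Fin 3 → ℂ
  | 0, 2 => -qhalf q
  | 1, 1 => 1
  | 2, 0 => -(qhalf q)⁻¹
  | _, _ => 0

/-! ### The cross product and the realization `φ̂` -/

section cross

variable {q : ℝ} (hq : 0 < q) (N : ℕ)

/-- The map `g ⊗ b ↦ ∑ (g₍₁₎ ▹ b) ⊗ g₍₂₎`. -/
def crossSwap : Uq q ⊗[ℂ] Fuzzy N →ₗ[ℂ] Fuzzy N ⊗[ℂ] Uq q :=
  TensorProduct.lift <| LinearMap.flip
    { toFun := fun b => TensorProduct.map (LinearMap.applyₗ b ∘ₗ (act hq N).toLinearMap)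
          LinearMap.id ∘ₗ (Uq.comul q).toLinearMap
      map_add' := fun a b => by
        rw [map_add, LinearMap.add_comp, TensorProduct.map_add_left, LinearMap.add_comp]
      map_smul' := fun c a => by
        rw [map_smul, LinearMap.smul_comp, TensorProduct.map_smul_left, LinearMap.smul_comp]
        rfl }

/-- The product of the cross product algebra of the fuzzy sphere and `U_q so(3)`, realized on
their tensor product: `(a ⊗ g) (b ⊗ h) = ∑ a (g₍₁₎ ▹ b) ⊗ g₍₂₎ h`. -/
def crossMul : (Fuzzy N ⊗[ℂ] Uq q) ⊗[ℂ] (Fuzzy N ⊗[ℂ] Uq q) →ₗ[ℂ] Fuzzy N ⊗[ℂ] Uq q :=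
  TensorProduct.map (LinearMap.mul' ℂ (Fuzzy N)) (LinearMap.mul' ℂ (Uq q))
    ∘ₗ (TensorProduct.assoc ℂ _ _ _).symm.toLinearMap
    ∘ₗ TensorProduct.map LinearMap.id ((TensorProduct.assoc ℂ _ _ _).toLinearMap)
    ∘ₗ TensorProduct.map LinearMap.id (TensorProduct.map (crossSwap hq N) LinearMap.id)
    ∘ₗ TensorProduct.map LinearMap.id ((TensorProduct.assoc ℂ _ _ _).symm.toLinearMap)
    ∘ₗ (TensorProduct.assoc ℂ _ _ _).toLinearMap

/-- The homomorphism `φ̂(a ⊗ g) = a π(g)` from the cross product to the fuzzy sphere, where `π` is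
the irreducible representation of dimension `N + 1`. -/
def phiHat : Fuzzy N ⊗[ℂ] Uq q →ₗ[ℂ] Fuzzy N :=
  LinearMap.mul' ℂ (Fuzzy N) ∘ₗ TensorProduct.map LinearMap.id (spinRep hq N).toLinearMap

/-- The restriction of `φ̂` to `U_q so(3)`. -/
def phiU : Uq q →ₗ[ℂ] Fuzzy N := phiHat hq N ∘ₗ TensorProduct.mk ℂ (Fuzzy N) (Uq q) 1

/-- `Ψ` is an algebra homomorphism from the cross product of the fuzzy sphere of radius `r` and
`U_q so(3)` to the fuzzy sphere that is the identity on the fuzzy sphere and has the explicit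
values on `E⁺`, `E⁻` and `q^(H/2)`. -/
structure IsRealization (r : ℝ) (Ψ : Fuzzy N ⊗[ℂ] Uq q →ₗ[ℂ] Fuzzy N) : Prop where
  map_one : Ψ (1 ⊗ₜ 1) = 1
  map_mul : ∀ ξ η, Ψ (crossMul hq N (ξ ⊗ₜ η)) = Ψ ξ * Ψ η
  map_fuzzy : ∀ a, Ψ (a ⊗ₜ 1) = a
  map_Ep : Ψ (1 ⊗ₜ Uq.Ep q) = ((1 / r * √(q⁻¹ * qnum q 2 * cN q N) : ℝ) : ℂ) • gen q r N 0
  map_Em : Ψ (1 ⊗ₜ Uq.Em q) = -(((1 / r * √(q * qnum q 2 * cN q N) : ℝ) : ℂ) • gen q r N 2)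
  map_K : Ψ (1 ⊗ₜ Uq.K q) = ((qnum (q ^ (N + 1)) 2 / qnum q 2 : ℝ) : ℂ) •
    (1 - (((q ^ (1 / 2 : ℝ) - q ^ (-1 / 2 : ℝ)) / lambdaN q r N : ℝ) : ℂ) • gen q r N 1)

end cross

/-! ### The universal R-matrix

In terms of `K = q^(H/2)` and `F = q^(1/2) E⁻ K⁻¹` the universal R-matrix is
`q^(H ⊗ H / 4) ∑ₙ cₙ Eⁿ ⊗ Fⁿ`, with `E = E⁺` and
`cₙ = (q^(1/2) - q^(-1/2))ⁿ q^(n(n-1)/4) / [n]_q!`. When one leg is represented on the fuzzy sphere,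
whose elements have integer weights from `-N` to `N`, only the terms with `n ≤ 2 N` survive, and
`q^(H ⊗ H / 4)` is `∑ₘ Pₘ ⊗ Kᵐ`, with `Pₘ` the projection to `{a | K ▹ a = qᵐ a}`. -/

section Rmatrix

variable {q : ℝ} (hq : 0 < q) (N : ℕ)

/-- The projection of the fuzzy sphere to the subspace of weight `m`, that is, of the `a` with
`K ▹ a = qᵐ a`: the `m`-th diagonal of the matrix. -/
def weightProj (m : ℤ) : Module.End ℂ (Fuzzy N) where
  toFun a := Matrix.of fun i j => if ((j : ℕ) : ℤ) - (i : ℕ) = m then a i j else 0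
  map_add' a b := by ext i j; simp only [Matrix.of_apply, Matrix.add_apply]; split <;> simp
  map_smul' c a := by ext i j; simp

lemma act_K (a : Fuzzy N) : act hq N (Uq.K q) a = spinK q N * a * spinKi q N := by
  simp [act, Uq.comul, Uq.antipodeOp, spinRep]

/-- The image of `weightProj` consists of elements of weight `m`. -/
lemma act_K_weightProj (m : ℤ) (a : Fuzzy N) :
    act hq N (Uq.K q) (weightProj N m a) = ((q ^ m : ℝ) : ℂ) • weightProj N m a := by
  rw [act_K]
  ext i j
  rw [spinKi, Matrix.mul_diagonal, spinK, Matrix.diagonal_mul, Matrix.smul_apply, smul_eq_mul]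
  by_cases h : ((j : ℕ) : ℤ) - (i : ℕ) = m
  · have e : q ^ m = q ^ (((N : ℝ) - 2 * (i : ℕ)) / 2) * q ^ (-(((N : ℝ) - 2 * (j : ℕ)) / 2)) := by
      rw [← Real.rpow_add hq, ← Real.rpow_intCast, ← h]
      congr 1
      push_cast
      ring
    rw [e, Complex.ofReal_mul]
    ring
  · simp [weightProj, h]

/-- Every element is the sum of its components of weights from `-N` to `N`. -/
lemma sum_weightProj (a : Fuzzy N) :
    ∑ m ∈ Finset.Icc (-(N : ℤ)) N, weightProj N m a = a := by
  ext i j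
  rw [Matrix.sum_apply, Finset.sum_eq_single (((j : ℕ) : ℤ) - (i : ℕ))]
  · simp [weightProj]
  · intro m _ hm
    simp [weightProj, hm.symm]
  · intro h
    exact absurd (Finset.mem_Icc.mpr ⟨by omega, by omega⟩) h

/-- The powers `Kᵐ`, for `m` an integer. -/
def Kpow (q : ℝ) (m : ℤ) : Uq q := Uq.K q ^ m.toNat * Uq.Ki q ^ (-m).toNat

/-- `F = q^(1/2) E⁻ K⁻¹ = q^(-H/4) X⁻`. -/
def F (q : ℝ) : Uq q := qhalf q • (Uq.Em q * Uq.Ki q)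

/-- The coefficients of the universal R-matrix. -/
def rCoeff (q : ℝ) (n : ℕ) : ℂ :=
  (qhalf q - (qhalf q)⁻¹) ^ n * qhalf q ^ (n * (n - 1) / 2) / (qfact q n : ℂ)

/-- The universal R-matrix with its first leg acting on the fuzzy sphere. -/
def Rleft : Module.End ℂ (Fuzzy N) ⊗[ℂ] Uq q :=
  ∑ m ∈ Finset.Icc (-(N : ℤ)) N, ∑ n ∈ Finset.range (2 * N + 1),
    rCoeff q n • ((weightProj N m * act hq N (Uq.Ep q ^ n)) ⊗ₜ[ℂ] (Kpow q m * F q ^ n))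

/-- The universal R-matrix with its second leg acting on the fuzzy sphere. -/
def Rright : Uq q ⊗[ℂ] Module.End ℂ (Fuzzy N) :=
  ∑ m ∈ Finset.Icc (-(N : ℤ)) N, ∑ n ∈ Finset.range (2 * N + 1),
    rCoeff q n • ((Kpow q m * Uq.Ep q ^ n) ⊗ₜ[ℂ] (weightProj N m * act hq N (F q ^ n)))

/-- The action on two copies of the fuzzy sphere of an element with one leg already acting. -/
def onPair : Module.End ℂ (Fuzzy N) ⊗[ℂ] Uq q →ₐ[ℂ] Module.End ℂ (Fuzzy N ⊗[ℂ] Fuzzy N) :=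
  Module.endTensorEndAlgHom.comp
    (Algebra.TensorProduct.map (AlgHom.id ℂ (Module.End ℂ (Fuzzy N))) (act hq N))

end Rmatrix

/-! ### Braided tensor products and their unbraiding -/

/-- The two prescriptions for the braided tensor product. -/
inductive Sign
  | plus | minus

section braided

variable {q : ℝ} (hq : 0 < q) (N M : ℕ)

/-- For `plus` the map `a ⊗ b ↦ (R^{-1(1)} ▹ a) ⊗ (R^{-1(2)} ▹ b)`, for `minus` the map
`a ⊗ b ↦ (R^{(2)} ▹ a) ⊗ (R^{(1)} ▹ b)`. -/
def braid : Sign → Module.End ℂ (Fuzzy N ⊗[ℂ] Fuzzy N)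
  | .plus => onPair hq N (Ring.inverse (Rleft hq N))
  | .minus => (TensorProduct.comm ℂ _ _).toLinearMap ∘ₗ onPair hq N (Rleft hq N)
      ∘ₗ (TensorProduct.comm ℂ _ _).toLinearMap

/-- The element `a` of the `α`-th copy in the tensor algebra. -/
def copy (α : Fin M) : Fuzzy N →ₗ[ℂ] TensorAlgebra ℂ (Fin M → Fuzzy N) :=
  TensorAlgebra.ι ℂ ∘ₗ LinearMap.single ℂ (fun _ : Fin M => Fuzzy N) α

/-- The relations of the `M`-fold braided tensor product: each copy is a copy of the fuzzy sphere,
and for `α < β` the elements `a` of copy `α` and `b` of copy `β` satisfy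
`b a = (R^{-1(1)} ▹ a) (R^{-1(2)} ▹ b)` (`plus`) or `b a = (R^{(2)} ▹ a) (R^{(1)} ▹ b)` (`minus`). -/
inductive BraidRel (s : Sign) :
    TensorAlgebra ℂ (Fin M → Fuzzy N) → TensorAlgebra ℂ (Fin M → Fuzzy N) → Prop
  | one (α : Fin M) : BraidRel s (copy N M α 1) 1
  | mul (α : Fin M) (a b : Fuzzy N) :
      BraidRel s (copy N M α a * copy N M α b) (copy N M α (a * b))
  | cross (α β : Fin M) (h : α < β) (a b : Fuzzy N) :
      BraidRel s (copy N M β b * copy N M α a)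
        (LinearMap.mul' ℂ _
          (TensorProduct.map (copy N M α) (copy N M β) (braid hq N s (a ⊗ₜ b))))

/-- The braided tensor product of `M` copies of the fuzzy sphere. -/
def Braided (s : Sign) : Type := RingQuot (BraidRel hq N M s)

instance (s : Sign) : Ring (Braided hq N M s) :=
  inferInstanceAs (Ring (RingQuot (BraidRel hq N M s)))
instance (s : Sign) : Algebra ℂ (Braided hq N M s) :=
  inferInstanceAs (Algebra ℂ (RingQuot (BraidRel hq N M s)))

/-- The quotient map. -/
def Braided.mk (s : Sign) : TensorAlgebra ℂ (Fin M → Fuzzy N) →ₐ[ℂ] Braided hq N M s :=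
  RingQuot.mkAlgHom ℂ (BraidRel hq N M s)

/-- The embedding of the `α`-th copy of the fuzzy sphere. -/
def emb (s : Sign) (α : Fin M) : Fuzzy N →ₐ[ℂ] Braided hq N M s :=
  AlgHom.ofLinearMap ((Braided.mk hq N M s).toLinearMap ∘ₗ copy N M α)
    ((RingQuot.mkAlgHom_rel ℂ (BraidRel.one (hq := hq) (s := s) α)).trans
      (map_one (Braided.mk hq N M s)))
    (fun a b => ((map_mul (Braided.mk hq N M s) _ _).symm.trans
      (RingQuot.mkAlgHom_rel ℂ (BraidRel.mul (hq := hq) (s := s) α a b))).symm)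

/-- The linear map `a₁ ⊗ ⋯ ⊗ a_M ↦ a₁ ⋯ a_M` to the braided tensor product. -/
def orderedMul (s : Sign) :
    PiTensorProduct ℂ (fun _ : Fin M => Fuzzy N) →ₗ[ℂ] Braided hq N M s :=
  PiTensorProduct.lift <|
    (MultilinearMap.mkPiAlgebraFin ℂ M (Braided hq N M s)).compLinearMap
      fun α => (emb hq N M s α).toLinearMap

/-- The tensor `∑ b ⊗ c` such that the unbraiding map of copy `β` with respect to an earlier copy
`α` is `a ↦ ∑ b_β c_α`: it is `(R^{(2)} ▹ a) ⊗ φ̂(R^{(1)})` for `plus` and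
`(R^{-1(1)} ▹ a) ⊗ φ̂(R^{-1(2)})` for `minus`. -/
def unbraid : Sign → (Fuzzy N →ₗ[ℂ] Fuzzy N ⊗[ℂ] Fuzzy N)
  | .plus =>
    { toFun := fun a => TensorProduct.comm ℂ _ _
        (TensorProduct.map (phiU hq N) (LinearMap.applyₗ a) (Rright hq N))
      map_add' := fun a b => by simp [TensorProduct.map_add_right]
      map_smul' := fun c a => by simp [TensorProduct.map_smul_right] }
  | .minus =>
    { toFun := fun a =>
        TensorProduct.map (LinearMap.applyₗ a) (phiU hq N) (Ring.inverse (Rleft hq N))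
      map_add' := fun a b => by simp [TensorProduct.map_add_left]
      map_smul' := fun c a => by simp [TensorProduct.map_smul_left] }

/-- The iterated unbraiding. At stage `0` the copies are the given ones; at stage `k + 1` the copies
after the `k`-th (counted from `0`) are unbraided with respect to the `k`-th copy of stage `k`, and
the others are kept. -/
def stage (s : Sign) : ℕ → Fin M → (Fuzzy N →ₗ[ℂ] Braided hq N M s)
  | 0, α => (emb hq N M s α).toLinearMap
  | k + 1, α =>
    if h : k < (α : ℕ) then
      LinearMap.mul' ℂ _ ∘ₗ
        TensorProduct.map (stage s k α) (stage s k ⟨k, h.trans α.isLt⟩) ∘ₗ unbraid hq N s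
    else stage s k α

/-- The unbraided copies: the `α`-th one arises after unbraiding with respect to all copies before
it. -/
def unbraided (s : Sign) (α : Fin M) : Fuzzy N →ₗ[ℂ] Braided hq N M s := stage hq N M s α α

end braided

end

end QFuzzy

open QFuzzy

/-!
The algebraic core is about an arbitrary bialgebra `U`, an algebra `A` with an action `ρ` of `U`,
and an invertible `W = ∑ w ⊗ u` in `End A ⊗ U` with inverse `W'` that behaves like a universal
R-matrix with its first leg represented (`IsHalfR`): it intertwines the coproduct with its opposite,
the coproduct of its second leg factorizes, and `a ↦ ∑ w a ⊗ u` is multiplicative. If the action is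
inner, `π(g) a = ∑ (g₍₁₎ ▹ a) π(g₍₂₎)`, and `x`, `y` are two copies of `A` with the cross relations
of `W`, then `b ↦ ∑ y (w' b) x (π u')` is an algebra homomorphism whose values commute with those of
`x` (`IsHalfR.unbraidMap_commute`, `IsHalfR.unbraidMap_mul`), and two copies unbraided with respect
to the same `x` keep their cross relations, by the Yang-Baxter equation
(`IsHalfR.unbraidMap_cross`). Hence the unbraiding can be iterated until all copies commute
(`stage_spec`).

The braided tensor product is spanned by the ordered products (`orderedMul_surjective`). It is not
zero, as any number of copies of `A` can be braided in a nontrivial algebra, built inductively from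
`A ⊗ B` by the same formula read backwards (`IsHalfR.exists_family`). The commuting copies define a
homomorphism from a tensor power of a matrix algebra to it, which is injective since such a tensor
power is simple (`injective_of_tensor_matrix`); comparing dimensions, both maps are bijective
(`braided_decomposition`).

For `U_q so(3)` the coefficients of the R-matrix are those of a q-exponential function. Its addition
theorem (`IsQExp.add`) gives the coproduct formula and the multiplicativity, and the commutator of
`E⁺` with the powers of `F` (`IsQExp.commutator`) the intertwining property; the diagonal part of
the R-matrix is handled through the projections to the weight spaces (`IsWeights`). The sign `minus`
uses the R-matrix with its first leg acting (`isHalfR_Rleft`), the sign `plus` the inverse of the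
one with its second leg acting (`isHalfR_inverse_flipR`); the automorphism `E⁺ ↔ F`, `K ↔ K⁻¹`,
which reverses the coproduct, reduces the latter to the former.

The relations of the generators come down to the commutator and the Casimir element in the spin
representations (`spin_commutator`, `spin_casimir`). The generators generate the matrix algebra
because the weights are distinct and `E⁺`, `E⁻` have no zero between neighbouring weights
(`subalgebra_eq_top`), and `φ̂(a ⊗ g) = a π(g)` is multiplicative because the action is inner.
-/

namespace QFuzzy

noncomputable section

/-! ### Half-represented R-matrices -/

section formal

variable {U A : Type*} [Ring U] [Bialgebra ℂ U] [Ring A] [Algebra ℂ A]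

-- shortcuts for instances whose synthesis in nested tensor products is slow
instance instRingEndTensor : Ring (Module.End ℂ A ⊗[ℂ] U) := inferInstance
instance instAlgebraEndTensor : Algebra ℂ (Module.End ℂ A ⊗[ℂ] U) := inferInstance

/-- Apply the first leg of `W` to the vector `a`. -/
def evalLeg (a : A) : Module.End ℂ A ⊗[ℂ] U →ₗ[ℂ] A ⊗[ℂ] U :=
  TensorProduct.map (LinearMap.applyₗ a) LinearMap.id

@[simp] lemma evalLeg_tmul (a : A) (w : Module.End ℂ A) (u : U) :
    evalLeg a (w ⊗ₜ u) = w a ⊗ₜ[ℂ] u := rfl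

@[simp] lemma evalLeg_one (a : A) :
    evalLeg a (1 : Module.End ℂ A ⊗[ℂ] U) = a ⊗ₜ[ℂ] (1 : U) := rfl

/-- `legAct W` is `a ⊗ u ↦ ∑ w a ⊗ v u`, where `W = ∑ w ⊗ v`. -/
def legAct : Module.End ℂ A ⊗[ℂ] U →ₐ[ℂ] Module.End ℂ (A ⊗[ℂ] U) :=
  Module.endTensorEndAlgHom.comp
    (Algebra.TensorProduct.map (AlgHom.id ℂ (Module.End ℂ A)) (Algebra.lmul ℂ U))

@[simp] lemma legAct_tmul (w : Module.End ℂ A) (v : U) (a : A) (u : U) :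
    legAct (w ⊗ₜ v) (a ⊗ₜ[ℂ] u) = w a ⊗ₜ[ℂ] (v * u) := rfl

lemma legAct_tmul_one (W : Module.End ℂ A ⊗[ℂ] U) (a : A) :
    legAct W (a ⊗ₜ[ℂ] (1 : U)) = evalLeg a W := by
  induction W with
  | zero => simp
  | add x y hx hy => simp [hx, hy]
  | tmul w v => simp

lemma legAct_apply_tmul (W : Module.End ℂ A ⊗[ℂ] U) (a : A) (u : U) :
    legAct W (a ⊗ₜ[ℂ] u) = evalLeg a W * (1 ⊗ₜ u) := by
  induction W with
  | zero => simp
  | add x y hx hy => simp only [map_add, LinearMap.add_apply, hx, hy, add_mul]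
  | tmul w v => simp

lemma legAct_evalLeg (W X : Module.End ℂ A ⊗[ℂ] U) (a : A) :
    legAct W (evalLeg a X) = evalLeg a (W * X) := by
  rw [← legAct_tmul_one, ← legAct_tmul_one, map_mul]
  rfl

/-- If `a ↦ ∑ w a ⊗ u` is multiplicative for a bilinear product `μ` on `A`, then the corresponding
map for the inverse of `∑ w ⊗ u` is multiplicative for `μ` and the opposite product of `U`. -/
lemma evalLeg_inv_mul (μ : A →ₗ[ℂ] A →ₗ[ℂ] A) {W W' : Module.End ℂ A ⊗[ℂ] U}
    (h : W * W' = 1) (h' : W' * W = 1)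
    (H : ∀ a b, evalLeg (μ a b) W
      = TensorProduct.map₂ μ (LinearMap.mul ℂ U) (evalLeg a W) (evalLeg b W)) (a b : A) :
    evalLeg (μ a b) W'
      = TensorProduct.map₂ μ (LinearMap.mul ℂ U).flip (evalLeg a W') (evalLeg b W') := by
  have inj : Function.Injective (legAct W) := by
    apply Function.LeftInverse.injective (g := legAct W')
    intro x
    have : legAct W' * legAct W = 1 := by rw [← map_mul, h']; exact legAct.map_one
    exact LinearMap.congr_fun this x
  have step : ∀ (c : A) (v : U) (Y : A ⊗[ℂ] U),
      legAct W (TensorProduct.map₂ μ (LinearMap.mul ℂ U).flip (c ⊗ₜ v) Y)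
        = TensorProduct.map₂ μ (LinearMap.mul ℂ U) (evalLeg c W) (legAct W Y) * (1 ⊗ₜ v) := by
    intro c v Y
    induction Y with
    | zero => simp
    | add x y hx hy => simp only [map_add, hx, hy, add_mul]
    | tmul d u =>
      have e2 : ∀ X Y : A ⊗[ℂ] U, TensorProduct.map₂ μ (LinearMap.mul ℂ U) X (Y * (1 ⊗ₜ u))
          = TensorProduct.map₂ μ (LinearMap.mul ℂ U) X Y * (1 ⊗ₜ u) := by
        intro X Y
        induction X with
        | zero => simp
        | add x y hx hy => simp only [map_add, LinearMap.add_apply, hx, hy, add_mul]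
        | tmul c v =>
          induction Y with
          | zero => simp
          | add x y hx hy => simp only [map_add, hx, hy, add_mul]
          | tmul d w => simp [mul_assoc]
      rw [TensorProduct.map₂_apply_tmul, TensorProduct.map_tmul, legAct_apply_tmul,
        legAct_apply_tmul, H, e2, mul_assoc]
      simp
  have step' : ∀ X : A ⊗[ℂ] U,
      legAct W (TensorProduct.map₂ μ (LinearMap.mul ℂ U).flip X (evalLeg b W'))
        = TensorProduct.map₂ μ (LinearMap.mul ℂ U) (legAct W X) (b ⊗ₜ 1) := by
    intro X
    induction X with
    | zero => simp
    | add x y hx hy => simp only [map_add, LinearMap.add_apply, hx, hy]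
    | tmul c v =>
      have e : ∀ X : A ⊗[ℂ] U, TensorProduct.map₂ μ (LinearMap.mul ℂ U) X (b ⊗ₜ 1) * (1 ⊗ₜ v)
          = TensorProduct.map₂ μ (LinearMap.mul ℂ U) (X * (1 ⊗ₜ v)) (b ⊗ₜ 1) := by
        intro X
        induction X with
        | zero => simp
        | add x y hx hy => simp only [map_add, LinearMap.add_apply, hx, hy, add_mul]
        | tmul c v => simp
      rw [step, legAct_evalLeg, h, evalLeg_one, legAct_apply_tmul, e]
  apply inj
  rw [step', legAct_evalLeg, legAct_evalLeg, h]
  simp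

/-- If an algebra homomorphism splits an invertible element into a product, it splits the inverse
into the product in the opposite order. -/
lemma map_inverse_eq_mul {C D : Type*} [Semiring C] [Algebra ℂ C] [Semiring D] [Algebra ℂ D]
    {V V' : C}
    (h : V * V' = 1) (h' : V' * V = 1) (f g k : C →ₐ[ℂ] D) (H : f V = g V * k V) :
    f V' = k V' * g V' := by
  refine left_inv_eq_right_inv (a := f V) (by rw [← map_mul, h', map_one]) ?_
  rw [H, mul_assoc, ← mul_assoc (k V), ← map_mul k, h, map_one, one_mul, ← map_mul, h, map_one]

/-- An invertible element `W` of `End A ⊗ U`, with inverse `W'`, that has the properties of a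
universal R-matrix of `U` with its first leg represented by `ρ` on the algebra `A`. The fields
`map_one` and `map_mul` say that `a ↦ ∑ w a ⊗ u`, where `W = ∑ w ⊗ u`, is an algebra homomorphism to
`A ⊗ U`; the corresponding map for `W'` is one to `A ⊗ Uᵒᵖ`. The coproduct formula and the
intertwining property make `A` a Yetter-Drinfeld module algebra. -/
structure IsHalfR (ρ : U →ₐ[ℂ] Module.End ℂ A) (W W' : Module.End ℂ A ⊗[ℂ] U) : Prop where
  mul_inv : W * W' = 1
  inv_mul : W' * W = 1
  intertwine : ∀ g : U,
    W * Algebra.TensorProduct.map ρ (AlgHom.id ℂ U) (Bialgebra.comulAlgHom ℂ U g)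
      = Algebra.TensorProduct.map ρ (AlgHom.id ℂ U)
          (Algebra.TensorProduct.comm ℂ U U (Bialgebra.comulAlgHom ℂ U g)) * W
  coaction : Algebra.TensorProduct.map (AlgHom.id ℂ (Module.End ℂ A)) (Bialgebra.comulAlgHom ℂ U) W
      = Algebra.TensorProduct.map (AlgHom.id ℂ (Module.End ℂ A))
          (Algebra.TensorProduct.includeRight : U →ₐ[ℂ] U ⊗[ℂ] U) W
        * Algebra.TensorProduct.map (AlgHom.id ℂ (Module.End ℂ A))
          (Algebra.TensorProduct.includeLeft : U →ₐ[ℂ] U ⊗[ℂ] U) W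
  map_one : evalLeg 1 W = 1 ⊗ₜ 1
  map_mul : ∀ a b, evalLeg (a * b) W = evalLeg a W * evalLeg b W
  map_mul_inv : ∀ a b, evalLeg (a * b) W' = TensorProduct.map₂ (LinearMap.mul ℂ A)
    (LinearMap.mul ℂ U).flip (evalLeg a W') (evalLeg b W')

namespace IsHalfR

variable {ρ : U →ₐ[ℂ] Module.End ℂ A} {W W' : Module.End ℂ A ⊗[ℂ] U}

lemma inv_map_one (h : IsHalfR ρ W W') : evalLeg 1 W' = 1 ⊗ₜ 1 := by
  have := legAct_evalLeg W' W (1 : A)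
  rwa [h.map_one, legAct_tmul_one, h.inv_mul] at this

/-- The coproduct formula for the inverse. -/
lemma inv_coaction (h : IsHalfR ρ W W') :
    Algebra.TensorProduct.map (AlgHom.id ℂ (Module.End ℂ A)) (Bialgebra.comulAlgHom ℂ U) W'
      = Algebra.TensorProduct.map (AlgHom.id ℂ (Module.End ℂ A))
          (Algebra.TensorProduct.includeLeft : U →ₐ[ℂ] U ⊗[ℂ] U) W'
        * Algebra.TensorProduct.map (AlgHom.id ℂ (Module.End ℂ A))
          (Algebra.TensorProduct.includeRight : U →ₐ[ℂ] U ⊗[ℂ] U) W' :=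
  map_inverse_eq_mul h.mul_inv h.inv_mul _ _ _ h.coaction

/-- Embedding of `W` acting on the first of two copies of `A`. -/
def legFst : Module.End ℂ A ⊗[ℂ] U →ₐ[ℂ] Module.End ℂ A ⊗[ℂ] (Module.End ℂ A ⊗[ℂ] U) :=
  Algebra.TensorProduct.map (AlgHom.id ℂ _) Algebra.TensorProduct.includeRight

/-- Embedding of `W` acting on the second of two copies of `A`. -/
def legSnd : Module.End ℂ A ⊗[ℂ] U →ₐ[ℂ] Module.End ℂ A ⊗[ℂ] (Module.End ℂ A ⊗[ℂ] U) :=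
  Algebra.TensorProduct.includeRight

/-- The element `∑ ρ u ⊗ w ⊗ 1`, where `W = ∑ w ⊗ u`. -/
def legBoth (ρ : U →ₐ[ℂ] Module.End ℂ A) :
    Module.End ℂ A ⊗[ℂ] U →ₐ[ℂ] Module.End ℂ A ⊗[ℂ] (Module.End ℂ A ⊗[ℂ] U) :=
  (Algebra.TensorProduct.map (AlgHom.id ℂ _) Algebra.TensorProduct.includeLeft).comp
    ((Algebra.TensorProduct.map ρ (AlgHom.id ℂ _)).comp
      (Algebra.TensorProduct.comm ℂ (Module.End ℂ A) U).toAlgHom)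

@[simp] lemma legFst_tmul (w : Module.End ℂ A) (u : U) :
    legFst (w ⊗ₜ u) = w ⊗ₜ[ℂ] ((1 : Module.End ℂ A) ⊗ₜ[ℂ] u) := rfl
@[simp] lemma legSnd_tmul (w : Module.End ℂ A) (u : U) :
    legSnd (w ⊗ₜ u) = (1 : Module.End ℂ A) ⊗ₜ[ℂ] (w ⊗ₜ[ℂ] u) := rfl
@[simp] lemma legBoth_tmul (w : Module.End ℂ A) (u : U) :
    legBoth ρ (w ⊗ₜ u) = ρ u ⊗ₜ[ℂ] (w ⊗ₜ[ℂ] (1 : U)) := rfl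

/-- The Yang-Baxter equation, for `W` in both represented forms: it is the intertwining property of
`W`, applied to the second leg of another copy of `W` and rewritten with the coproduct formula. -/
lemma yangBaxter (h : IsHalfR ρ W W') :
    legFst W * (legSnd W * legBoth ρ W) = legBoth ρ W * legSnd W * legFst W := by
  -- the map `w ⊗ (u ⊗ v) ↦ ρ u ⊗ (w ⊗ v)`
  let L : Module.End ℂ A ⊗[ℂ] (U ⊗[ℂ] U) →ₐ[ℂ] Module.End ℂ A ⊗[ℂ] (Module.End ℂ A ⊗[ℂ] U) :=
    (Algebra.TensorProduct.leftComm ℂ (Module.End ℂ A) (Module.End ℂ A) U).toAlgHom.comp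
      (Algebra.TensorProduct.map (AlgHom.id ℂ _)
        (Algebra.TensorProduct.map ρ (AlgHom.id ℂ U)))
  have hL : ∀ w u v, L (w ⊗ₜ (u ⊗ₜ v)) = ρ u ⊗ₜ (w ⊗ₜ v) := fun w u v => rfl
  have e1 : ∀ X : Module.End ℂ A ⊗[ℂ] U, legFst W * L (Algebra.TensorProduct.map
      (AlgHom.id ℂ (Module.End ℂ A)) (Bialgebra.comulAlgHom ℂ U) X)
      = L (Algebra.TensorProduct.map (AlgHom.id ℂ (Module.End ℂ A))
        ((Algebra.TensorProduct.comm ℂ U U).toAlgHom.comp (Bialgebra.comulAlgHom ℂ U)) X)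
        * legFst W := by
    intro X
    induction X with
    | zero => simp
    | add x y hx hy => simp only [_root_.map_add, mul_add, add_mul, hx, hy]
    | tmul w g =>
      let I : Module.End ℂ A ⊗[ℂ] U →ₗ[ℂ] Module.End ℂ A ⊗[ℂ] (Module.End ℂ A ⊗[ℂ] U) :=
        (TensorProduct.leftComm ℂ (Module.End ℂ A) (Module.End ℂ A) U).toLinearMap ∘ₗ
          TensorProduct.mk ℂ (Module.End ℂ A) (Module.End ℂ A ⊗[ℂ] U) w
      have hI1 : ∀ Z Y, legFst Z * I Y = I (Z * Y) := by
        intro Z Y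
        induction Z with
        | zero => simp
        | add x y hx hy => simp only [_root_.map_add, add_mul, hx, hy]
        | tmul w' u' =>
          induction Y with
          | zero => simp
          | add x y hx hy => simp only [_root_.map_add, mul_add, hx, hy]
          | tmul w'' u'' => simp [I]
      have hI2 : ∀ Z Y, I Y * legFst Z = I (Y * Z) := by
        intro Z Y
        induction Z with
        | zero => simp
        | add x y hx hy => simp only [_root_.map_add, mul_add, hx, hy]
        | tmul w' u' =>
          induction Y with
          | zero => simp
          | add x y hx hy => simp only [_root_.map_add, add_mul, hx, hy]
          | tmul w'' u'' => simp [I]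
      have hLI : ∀ t : U ⊗[ℂ] U, L (w ⊗ₜ t) = I (Algebra.TensorProduct.map ρ (AlgHom.id ℂ U) t) :=
        fun t => rfl
      rw [Algebra.TensorProduct.map_tmul, Algebra.TensorProduct.map_tmul, AlgHom.id_apply, hLI,
        hLI, hI1, hI2]
      congr 1
      exact h.intertwine g
  have e2 := e1 W
  have e3 : Algebra.TensorProduct.map (AlgHom.id ℂ (Module.End ℂ A))
      ((Algebra.TensorProduct.comm ℂ U U).toAlgHom.comp (Bialgebra.comulAlgHom ℂ U)) W
      = Algebra.TensorProduct.map (AlgHom.id ℂ (Module.End ℂ A))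
          (Algebra.TensorProduct.includeLeft : U →ₐ[ℂ] U ⊗[ℂ] U) W
        * Algebra.TensorProduct.map (AlgHom.id ℂ (Module.End ℂ A))
          (Algebra.TensorProduct.includeRight : U →ₐ[ℂ] U ⊗[ℂ] U) W := by
    have := congrArg (Algebra.TensorProduct.map (AlgHom.id ℂ (Module.End ℂ A))
      (Algebra.TensorProduct.comm ℂ U U).toAlgHom) h.coaction
    rw [_root_.map_mul, ← AlgHom.comp_apply, ← AlgHom.comp_apply, ← AlgHom.comp_apply,
      ← Algebra.TensorProduct.map_comp, ← Algebra.TensorProduct.map_comp,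
      ← Algebra.TensorProduct.map_comp] at this
    refine this.trans ?_
    congr 2
  have e4 : ∀ X : Module.End ℂ A ⊗[ℂ] U, L (Algebra.TensorProduct.map
      (AlgHom.id ℂ (Module.End ℂ A)) (Algebra.TensorProduct.includeRight : U →ₐ[ℂ] U ⊗[ℂ] U) X)
      = legSnd X := by
    intro X
    induction X with
    | zero => simp
    | add x y hx hy => simp only [_root_.map_add, hx, hy]
    | tmul w u => simp [hL]
  have e5 : ∀ X : Module.End ℂ A ⊗[ℂ] U, L (Algebra.TensorProduct.map
      (AlgHom.id ℂ (Module.End ℂ A)) (Algebra.TensorProduct.includeLeft : U →ₐ[ℂ] U ⊗[ℂ] U) X)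
      = legBoth ρ X := by
    intro X
    induction X with
    | zero => simp
    | add x y hx hy => simp only [_root_.map_add, hx, hy]
    | tmul w u => simp [hL]
  rw [h.coaction, e3, _root_.map_mul, _root_.map_mul, e4, e5] at e2
  exact e2

end IsHalfR

end formal

/-! ### Unbraiding -/

section unbraiding

variable {U A B : Type*} [Ring U] [Bialgebra ℂ U] [Ring A] [Algebra ℂ A] [Ring B] [Algebra ℂ B]

/-- The map `a ↦ ∑ w a ⊗ u`, where `W = ∑ w ⊗ u`. -/
def legMap (W : Module.End ℂ A ⊗[ℂ] U) : A →ₗ[ℂ] A ⊗[ℂ] U where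
  toFun a := evalLeg a W
  map_add' a b := by simp [evalLeg, TensorProduct.map_add_left]
  map_smul' c a := by simp [evalLeg, TensorProduct.map_smul_left]

/-- The map `∑ w ⊗ u ↦ ∑ x (ρ u a) y (w b)`. -/
def crossForm (ρ : U →ₐ[ℂ] Module.End ℂ A) (x y : A →ₗ[ℂ] B) (a b : A) :
    Module.End ℂ A ⊗[ℂ] U →ₗ[ℂ] B :=
  LinearMap.mul' ℂ B ∘ₗ TensorProduct.map (x ∘ₗ LinearMap.applyₗ a ∘ₗ ρ.toLinearMap)
    (y ∘ₗ LinearMap.applyₗ b) ∘ₗ (TensorProduct.comm ℂ _ _).toLinearMap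

@[simp] lemma crossForm_tmul (ρ : U →ₐ[ℂ] Module.End ℂ A) (x y : A →ₗ[ℂ] B) (a b : A)
    (w : Module.End ℂ A) (u : U) : crossForm ρ x y a b (w ⊗ₜ u) = x (ρ u a) * y (w b) := rfl

/-- The cross relation `y b * x a = ∑ x (ρ u a) y (w b)`, where `W = ∑ w ⊗ u`. -/
def IsCross (ρ : U →ₐ[ℂ] Module.End ℂ A) (W : Module.End ℂ A ⊗[ℂ] U) (x y : A →ₗ[ℂ] B) : Prop :=
  ∀ a b, y b * x a = crossForm ρ x y a b W

/-- The map `b ↦ ∑ y (w b) x (π u)`, where `W' = ∑ w ⊗ u`. -/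
def unbraidMap (π : U →ₐ[ℂ] A) (W' : Module.End ℂ A ⊗[ℂ] U) (x y : A →ₗ[ℂ] B) : A →ₗ[ℂ] B :=
  LinearMap.mul' ℂ B ∘ₗ TensorProduct.map y (x ∘ₗ π.toLinearMap) ∘ₗ legMap W'

lemma unbraidMap_sum (π : U →ₐ[ℂ] A) (x y : A →ₗ[ℂ] B) {n : ℕ} (w : Fin n → Module.End ℂ A)
    (u : Fin n → U) (b : A) :
    unbraidMap π (∑ i, w i ⊗ₜ u i) x y b = ∑ i, y (w i b) * x (π (u i)) := by
  simp [unbraidMap, legMap]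

variable {ρ : U →ₐ[ℂ] Module.End ℂ A} {π : U →ₐ[ℂ] A} {W W' : Module.End ℂ A ⊗[ℂ] U}

/-- The action `ρ` is implemented by `π`: `π(g) a = ∑ (g₍₁₎ ▹ a) π(g₍₂₎)`. -/
def Implements (π : U →ₐ[ℂ] A) (ρ : U →ₐ[ℂ] Module.End ℂ A) : Prop :=
  ∀ g a, π g * a = LinearMap.mul' ℂ A (TensorProduct.map (LinearMap.applyₗ a ∘ₗ ρ.toLinearMap)
    π.toLinearMap (Bialgebra.comulAlgHom ℂ U g))

namespace IsHalfR

/-- A copy that is unbraided with respect to `x` commutes with `x`. -/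
lemma unbraidMap_commute (h : IsHalfR ρ W W') (hπ : Implements π ρ) (x : A →ₐ[ℂ] B)
    (y : A →ₗ[ℂ] B) (hxy : IsCross ρ W x.toLinearMap y) (a b : A) :
    unbraidMap π W' x.toLinearMap y b * x a = x a * unbraidMap π W' x.toLinearMap y b := by
  obtain ⟨k, w, u, hW⟩ := TensorProduct.exists_sum_tmul_eq W
  obtain ⟨k', w', u', hW'⟩ := TensorProduct.exists_sum_tmul_eq W'
  -- `e1` and `e2` below are the images of the coproduct formula for `W'` and of `W * W' = 1` under
  -- linear maps to `B`
  let Φ : U ⊗[ℂ] U →ₗ[ℂ] B := x.toLinearMap ∘ₗ LinearMap.mul' ℂ A ∘ₗ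
    TensorProduct.map (LinearMap.applyₗ a ∘ₗ ρ.toLinearMap) π.toLinearMap
  let L : Module.End ℂ A ⊗[ℂ] (U ⊗[ℂ] U) →ₗ[ℂ] B :=
    LinearMap.mul' ℂ B ∘ₗ TensorProduct.map (y ∘ₗ LinearMap.applyₗ b) Φ
  have hL : ∀ v t, L (v ⊗ₜ t) = y (v b) * Φ t := fun v t => rfl
  have hΦ : ∀ v t, Φ (v ⊗ₜ t) = x (ρ v a) * x (π t) := fun v t => by simp [Φ]
  have hΦΔ : ∀ g, Φ (Bialgebra.comulAlgHom ℂ U g) = x (π g) * x a := fun g => by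
    rw [← _root_.map_mul, hπ g a]; rfl
  have e1 := congrArg L h.inv_coaction
  have e2 : ∀ c : A, ∑ i, ∑ j, x (ρ (u i * u' j) a) * y ((w i * w' j) c) = x a * y c := by
    intro c
    have := congrArg (crossForm ρ x.toLinearMap y a c) h.mul_inv
    rw [hW, hW', Finset.sum_mul_sum, Algebra.TensorProduct.one_def] at this
    simpa using this
  have e3 : ∀ c d : A, y d * x c = ∑ i, x (ρ (u i) c) * y (w i d) := by
    intro c d
    have := hxy c d
    rw [hW] at this
    simpa using this
  rw [hW'] at e1 ⊢
  rw [unbraidMap_sum, Finset.sum_mul, Finset.mul_sum]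
  simp only [map_sum, Algebra.TensorProduct.map_tmul, hL, hΦΔ, Finset.sum_mul_sum,
    Algebra.TensorProduct.tmul_mul_tmul, Algebra.TensorProduct.includeLeft_apply,
    Algebra.TensorProduct.includeRight_apply, one_mul, mul_one, hΦ, AlgHom.id_apply] at e1
  simp only [AlgHom.toLinearMap_apply, mul_assoc]
  rw [e1, Finset.sum_comm]
  refine Finset.sum_congr rfl fun j _ => ?_
  rw [← mul_assoc, ← e2, Finset.sum_comm, Finset.sum_mul]
  refine Finset.sum_congr rfl fun i _ => ?_
  rw [← mul_assoc, Module.End.mul_apply, e3, Finset.sum_mul, Finset.sum_mul]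
  simp

lemma unbraidMap_one (h : IsHalfR ρ W W') (x y : A →ₐ[ℂ] B) :
    unbraidMap π W' x.toLinearMap y.toLinearMap 1 = 1 := by
  have : legMap W' 1 = 1 ⊗ₜ 1 := h.inv_map_one
  simp [unbraidMap, this]

/-- The map for `W'` is multiplicative for the opposite product of `U`; the order of the factors is
restored by moving the values of `x` past the unbraided copy. -/
lemma unbraidMap_mul (h : IsHalfR ρ W W') (hπ : Implements π ρ) (x y : A →ₐ[ℂ] B)
    (hxy : IsCross ρ W x.toLinearMap y.toLinearMap) (a b : A) :
    unbraidMap π W' x.toLinearMap y.toLinearMap (a * b)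
      = unbraidMap π W' x.toLinearMap y.toLinearMap a
        * unbraidMap π W' x.toLinearMap y.toLinearMap b := by
  have key := h.unbraidMap_commute hπ x y.toLinearMap hxy
  obtain ⟨k', w', u', hW'⟩ := TensorProduct.exists_sum_tmul_eq W'
  have e : unbraidMap π W' x.toLinearMap y.toLinearMap (a * b)
      = ∑ i, ∑ j, y (w' i a) * y (w' j b) * (x (π (u' j)) * x (π (u' i))) := by
    have := congrArg (LinearMap.mul' ℂ B ∘ₗ TensorProduct.map y.toLinearMap
      (x.toLinearMap ∘ₗ π.toLinearMap)) (h.map_mul_inv a b)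
    refine this.trans ?_
    rw [hW', Finset.sum_comm]
    simp
  have e' : ∀ c, unbraidMap π W' x.toLinearMap y.toLinearMap c
      = ∑ i, y (w' i c) * x (π (u' i)) := by
    intro c
    rw [hW', unbraidMap_sum]
    rfl
  rw [e, e' a, Finset.sum_mul]
  refine Finset.sum_congr rfl fun i _ => ?_
  rw [mul_assoc, ← key, e' b, Finset.sum_mul, Finset.mul_sum]
  simp only [mul_assoc]

/-- Unbraiding with respect to `x` as an algebra homomorphism. -/
def unbraidHom (h : IsHalfR ρ W W') (hπ : Implements π ρ) (x y : A →ₐ[ℂ] B)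
    (hxy : IsCross ρ W x.toLinearMap y.toLinearMap) : A →ₐ[ℂ] B :=
  AlgHom.ofLinearMap (unbraidMap π W' x.toLinearMap y.toLinearMap) (h.unbraidMap_one x y)
    (h.unbraidMap_mul hπ x y hxy)

/-- The Yang-Baxter equation with two of its three factors inverted. -/
lemma yangBaxter_inv (h : IsHalfR ρ W W') :
    legBoth ρ W * legFst W' * legSnd W' = legSnd W' * legFst W' * legBoth ρ W := by
  have h1 : legFst W * legFst W' = 1 := by rw [← _root_.map_mul, h.mul_inv]; exact legFst.map_one
  have h2 : legSnd W * legSnd W' = 1 := by rw [← _root_.map_mul, h.mul_inv]; exact legSnd.map_one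
  have h3 : legFst W' * legFst W = 1 := by rw [← _root_.map_mul, h.inv_mul]; exact legFst.map_one
  have h4 : legSnd W' * legSnd W = 1 := by rw [← _root_.map_mul, h.inv_mul]; exact legSnd.map_one
  have key := h.yangBaxter
  generalize legFst W = F at *
  generalize legFst W' = F' at *
  generalize legSnd W = S at *
  generalize legSnd W' = S' at *
  generalize legBoth ρ W = P at *
  calc P * F' * S' = S' * (F' * F) * S * P * F' * S' := by simp [h3, h4]
    _ = S' * F' * (F * (S * P)) * F' * S' := by simp only [mul_assoc]
    _ = S' * F' * P * (S * (F * F') * S') := by rw [key]; simp only [mul_assoc]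
    _ = S' * F' * P := by simp [h1, h2]

/-- Two copies that are unbraided with respect to the same `x` still satisfy the original cross
relations, by the Yang-Baxter equation. -/
lemma unbraidMap_cross (h : IsHalfR ρ W W') (hπ : Implements π ρ) (x y z : A →ₐ[ℂ] B)
    (hxy : IsCross ρ W x.toLinearMap y.toLinearMap) (hxz : IsCross ρ W x.toLinearMap z.toLinearMap)
    (hyz : IsCross ρ W y.toLinearMap z.toLinearMap) :
    IsCross ρ W (unbraidMap π W' x.toLinearMap y.toLinearMap)
      (unbraidMap π W' x.toLinearMap z.toLinearMap) := by
  intro a b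
  have keyy := h.unbraidMap_commute hπ x y.toLinearMap hxy
  have keyz := h.unbraidMap_commute hπ x z.toLinearMap hxz
  obtain ⟨k, w, u, hW⟩ := TensorProduct.exists_sum_tmul_eq W
  obtain ⟨k', w', u', hW'⟩ := TensorProduct.exists_sum_tmul_eq W'
  let L : Module.End ℂ A ⊗[ℂ] (Module.End ℂ A ⊗[ℂ] U) →ₗ[ℂ] B :=
    LinearMap.mul' ℂ B ∘ₗ TensorProduct.map (y.toLinearMap ∘ₗ LinearMap.applyₗ a)
      (LinearMap.mul' ℂ B ∘ₗ TensorProduct.map (z.toLinearMap ∘ₗ LinearMap.applyₗ b)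
        (x.toLinearMap ∘ₗ π.toLinearMap))
  have hL : ∀ v v' t, L (v ⊗ₜ (v' ⊗ₜ t)) = y (v a) * (z (v' b) * x (π t)) := fun v v' t => rfl
  have ybe := congrArg L h.yangBaxter_inv
  have e3 : ∀ c d : A, z d * y c = ∑ i, y (ρ (u i) c) * z (w i d) := by
    intro c d
    have := hyz c d
    rw [hW] at this
    simpa using this
  have ey : ∀ c, unbraidMap π W' x.toLinearMap y.toLinearMap c
      = ∑ i, y (w' i c) * x (π (u' i)) := by
    intro c
    rw [hW', unbraidMap_sum]
    rfl
  have ez : ∀ c, unbraidMap π W' x.toLinearMap z.toLinearMap c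
      = ∑ i, z (w' i c) * x (π (u' i)) := by
    intro c
    rw [hW', unbraidMap_sum]
    rfl
  rw [hW, hW'] at ybe
  simp only [map_sum, legBoth_tmul, legFst_tmul, legSnd_tmul, Finset.sum_mul,
    Finset.mul_sum, Algebra.TensorProduct.tmul_mul_tmul, one_mul, mul_one, hL] at ybe
  rw [hW]
  simp only [map_sum, crossForm_tmul]
  have lhs : unbraidMap π W' x.toLinearMap z.toLinearMap b
      * unbraidMap π W' x.toLinearMap y.toLinearMap a
      = ∑ j, ∑ i, ∑ k, y (ρ (u k) (w' i a)) * (z (w k (w' j b)) * x (π (u' i * u' j))) := by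
    rw [ez, Finset.sum_mul]
    refine Finset.sum_congr rfl fun j _ => ?_
    rw [mul_assoc, ← keyy, ey, Finset.sum_mul, Finset.mul_sum]
    refine Finset.sum_congr rfl fun i _ => ?_
    rw [mul_assoc, ← mul_assoc, e3, Finset.sum_mul]
    simp only [mul_assoc, _root_.map_mul]
  have rhs : ∀ k, unbraidMap π W' x.toLinearMap y.toLinearMap (ρ (u k) a)
      * unbraidMap π W' x.toLinearMap z.toLinearMap (w k b)
      = ∑ i, ∑ j, y (w' i (ρ (u k) a)) * (z (w' j (w k b)) * x (π (u' j * u' i))) := by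
    intro k
    rw [ey, Finset.sum_mul]
    refine Finset.sum_congr rfl fun i _ => ?_
    rw [mul_assoc, ← keyz, ez, Finset.sum_mul, Finset.mul_sum]
    simp only [mul_assoc, _root_.map_mul]
  rw [lhs]
  simp only [rhs]
  simp only [Module.End.mul_apply] at ybe
  exact ybe

/-- The coaction `a ↦ ∑ w a ⊗ u` as an algebra homomorphism. -/
def legHom (h : IsHalfR ρ W W') : A →ₐ[ℂ] A ⊗[ℂ] U :=
  AlgHom.ofLinearMap (legMap W) h.map_one h.map_mul

/-- The braiding of a copy `y` of `A` with a further copy of `A`: the map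
`b ↦ ∑ π(u) ⊗ y (w b)`, where `W = ∑ w ⊗ u`. -/
def braidHom (h : IsHalfR ρ W W') (π : U →ₐ[ℂ] A) (y : A →ₐ[ℂ] B) : A →ₐ[ℂ] A ⊗[ℂ] B :=
  ((Algebra.TensorProduct.map π y).comp (Algebra.TensorProduct.comm ℂ A U).toAlgHom).comp h.legHom

lemma braidHom_apply (h : IsHalfR ρ W W') (π : U →ₐ[ℂ] A) (y : A →ₐ[ℂ] B) {n : ℕ}
    (w : Fin n → Module.End ℂ A) (u : Fin n → U) (hW : W = ∑ i, w i ⊗ₜ u i) (b : A) :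
    h.braidHom π y b = ∑ i, π (u i) ⊗ₜ[ℂ] y (w i b) := by
  have : h.legHom b = ∑ i, w i b ⊗ₜ[ℂ] u i := by
    change evalLeg b W = _
    simp [hW]
  simp [braidHom, this]

/-- The braided copy satisfies the cross relations with the first tensor factor. -/
lemma braidHom_cross_left (h : IsHalfR ρ W W') (hπ : Implements π ρ) (y : A →ₐ[ℂ] B) :
    IsCross ρ W (Algebra.TensorProduct.includeLeft : A →ₐ[ℂ] A ⊗[ℂ] B).toLinearMap
      (h.braidHom π y).toLinearMap := by
  intro a b
  obtain ⟨k, w, u, hW⟩ := TensorProduct.exists_sum_tmul_eq W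
  have eY := h.braidHom_apply π y w u hW
  let Φ : U ⊗[ℂ] U →ₗ[ℂ] A := LinearMap.mul' ℂ A ∘ₗ
    TensorProduct.map (LinearMap.applyₗ a ∘ₗ ρ.toLinearMap) π.toLinearMap
  let L : Module.End ℂ A ⊗[ℂ] (U ⊗[ℂ] U) →ₗ[ℂ] A ⊗[ℂ] B :=
    (TensorProduct.comm ℂ B A).toLinearMap ∘ₗ
      TensorProduct.map (y.toLinearMap ∘ₗ LinearMap.applyₗ b) Φ
  have hL : ∀ v t, L (v ⊗ₜ t) = Φ t ⊗ₜ y (v b) := fun v t => rfl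
  have hΦ : ∀ v t, Φ (v ⊗ₜ t) = ρ v a * π t := fun v t => by simp [Φ]
  have hΦΔ : ∀ g, Φ (Bialgebra.comulAlgHom ℂ U g) = π g * a := fun g => (hπ g a).symm
  have e1 := congrArg L h.coaction
  rw [hW] at e1
  simp only [map_sum, Algebra.TensorProduct.map_tmul, hL, hΦΔ, Finset.sum_mul_sum,
    Algebra.TensorProduct.tmul_mul_tmul, Algebra.TensorProduct.includeLeft_apply,
    Algebra.TensorProduct.includeRight_apply, one_mul, mul_one, hΦ, AlgHom.id_apply] at e1
  refine Eq.trans ?_ (congrArg _ hW).symm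
  simp only [map_sum, crossForm_tmul, AlgHom.toLinearMap_apply, eY, Finset.sum_mul, Finset.mul_sum,
    Algebra.TensorProduct.includeLeft_apply, Algebra.TensorProduct.tmul_mul_tmul, mul_one, one_mul]
  rw [e1, Finset.sum_comm]
  rfl

/-- Braiding two copies with the first tensor factor preserves their cross relations. -/
lemma braidHom_cross (h : IsHalfR ρ W W') (π : U →ₐ[ℂ] A) (y z : A →ₐ[ℂ] B)
    (hyz : IsCross ρ W y.toLinearMap z.toLinearMap) :
    IsCross ρ W (h.braidHom π y).toLinearMap (h.braidHom π z).toLinearMap := by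
  intro a b
  obtain ⟨k, w, u, hW⟩ := TensorProduct.exists_sum_tmul_eq W
  have eY := h.braidHom_apply π y w u hW
  have eZ := h.braidHom_apply π z w u hW
  let L : Module.End ℂ A ⊗[ℂ] (Module.End ℂ A ⊗[ℂ] U) →ₗ[ℂ] A ⊗[ℂ] B :=
    (TensorProduct.comm ℂ B A).toLinearMap ∘ₗ
    TensorProduct.map (LinearMap.mul' ℂ B ∘ₗ TensorProduct.map (y.toLinearMap ∘ₗ LinearMap.applyₗ a)
      (z.toLinearMap ∘ₗ LinearMap.applyₗ b)) π.toLinearMap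
      ∘ₗ (TensorProduct.assoc ℂ _ _ _).symm.toLinearMap
  have hL : ∀ v v' t, L (v ⊗ₜ (v' ⊗ₜ t)) = π t ⊗ₜ (y (v a) * z (v' b)) := fun v v' t => rfl
  have ybe := congrArg L h.yangBaxter
  have e3 : ∀ c d : A, z d * y c = ∑ i, y (ρ (u i) c) * z (w i d) := by
    intro c d
    have := hyz c d
    rw [hW] at this
    simpa using this
  rw [hW] at ybe
  simp only [map_sum, legBoth_tmul, legFst_tmul, legSnd_tmul, Finset.sum_mul,
    Finset.mul_sum, Algebra.TensorProduct.tmul_mul_tmul, one_mul, mul_one, hL] at ybe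
  refine Eq.trans ?_ (congrArg _ hW).symm
  simp only [map_sum, crossForm_tmul, AlgHom.toLinearMap_apply, eY, eZ, Finset.sum_mul,
    Finset.mul_sum, Algebra.TensorProduct.tmul_mul_tmul, e3, TensorProduct.tmul_sum]
  simp only [Module.End.mul_apply, _root_.map_mul] at ybe
  exact ybe.symm

end IsHalfR

end unbraiding

/-! ### Copies of an algebra with cross relations -/

section families

/-- Every number of copies of `A` can be braided in some nontrivial algebra, built by tensoring with
one more copy of `A` on the left at a time. -/
lemma IsHalfR.exists_family {U A : Type} [Ring U] [Bialgebra ℂ U] [Ring A] [Algebra ℂ A]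
    [Nontrivial A] {ρ : U →ₐ[ℂ] Module.End ℂ A} {π : U →ₐ[ℂ] A} {W W' : Module.End ℂ A ⊗[ℂ] U}
    (h : IsHalfR ρ W W') (hπ : Implements π ρ) (M : ℕ) :
    ∃ (B : Type) (_ : Ring B) (_ : Algebra ℂ B) (_ : Nontrivial B) (y : Fin M → A →ₐ[ℂ] B),
      ∀ α β, α < β → IsCross ρ W (y α).toLinearMap (y β).toLinearMap := by
  induction M with
  | zero => exact ⟨ℂ, inferInstance, inferInstance, inferInstance, fun i => i.elim0,
      fun i => i.elim0⟩
  | succ M ih =>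
    obtain ⟨B, _, _, _, y, hy⟩ := ih
    have nt : Nontrivial (A ⊗[ℂ] B) := by
      refine (Algebra.TensorProduct.includeLeft_injective (R := ℂ) (S := ℂ) (A := A) (B := B)
        (FaithfulSMul.algebraMap_injective ℂ B)).nontrivial
    refine ⟨A ⊗[ℂ] B, inferInstance, inferInstance, nt,
      Fin.cons Algebra.TensorProduct.includeLeft fun α => h.braidHom π (y α), ?_⟩
    intro α β hαβ
    induction β using Fin.cases with
    | zero => simp at hαβ
    | succ β =>
      induction α using Fin.cases with
      | zero => exact h.braidHom_cross_left hπ (y β)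
      | succ α => exact h.braidHom_cross π (y α) (y β) (hy α β (by simpa using hαβ))

lemma unbraidMap_commute_of {U A B : Type*} [Ring U] [Bialgebra ℂ U] [Ring A] [Algebra ℂ A]
    [Ring B] [Algebra ℂ B] (π : U →ₐ[ℂ] A) (W' : Module.End ℂ A ⊗[ℂ] U) (x y : A →ₗ[ℂ] B) (c : B)
    (hx : ∀ a, Commute c (x a)) (hy : ∀ a, Commute c (y a)) (b : A) :
    Commute c (unbraidMap π W' x y b) := by
  obtain ⟨n, w, u, rfl⟩ := TensorProduct.exists_sum_tmul_eq W'
  rw [unbraidMap_sum]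
  exact Commute.sum_right _ _ _ fun i _ => (hy _).mul_right (hx _)

lemma mul_map_crossForm {U A B : Type*} [Ring U] [Bialgebra ℂ U] [Ring A] [Algebra ℂ A]
    [Ring B] [Algebra ℂ B] (ρ : U →ₐ[ℂ] Module.End ℂ A) (x y : A →ₗ[ℂ] B) (a b : A)
    (W : Module.End ℂ A ⊗[ℂ] U) :
    LinearMap.mul' ℂ B (TensorProduct.map x y (crossForm ρ
      (Algebra.TensorProduct.includeLeft : A →ₐ[ℂ] A ⊗[ℂ] A).toLinearMap
      (Algebra.TensorProduct.includeRight : A →ₐ[ℂ] A ⊗[ℂ] A).toLinearMap a b W))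
      = crossForm ρ x y a b W := by
  induction W with
  | zero => simp
  | add X Y hX hY => simp only [map_add, hX, hY]
  | tmul w u => simp

variable {q : ℝ} {hq : 0 < q} {N M : ℕ} {s : Sign}
  {W W' : Module.End ℂ (Fuzzy N) ⊗[ℂ] Uq q}

/-- The copies of the fuzzy sphere in the braided tensor product satisfy the cross relations. -/
lemma emb_cross
    (hbraid : ∀ a b, braid hq N s (a ⊗ₜ b) = crossForm (act hq N)
      (Algebra.TensorProduct.includeLeft : Fuzzy N →ₐ[ℂ] Fuzzy N ⊗[ℂ] Fuzzy N).toLinearMap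
      (Algebra.TensorProduct.includeRight : Fuzzy N →ₐ[ℂ] Fuzzy N ⊗[ℂ] Fuzzy N).toLinearMap a b W)
    (α β : Fin M) (hαβ : α < β) :
    IsCross (act hq N) W (emb hq N M s α).toLinearMap (emb hq N M s β).toLinearMap := by
  intro a b
  have := RingQuot.mkAlgHom_rel ℂ (BraidRel.cross (hq := hq) (s := s) α β hαβ a b)
  change Braided.mk hq N M s _ = Braided.mk hq N M s _ at this
  rw [hbraid, map_mul] at this
  refine this.trans (Eq.trans ?_ (mul_map_crossForm _ _ _ a b W))
  generalize crossForm (B := Fuzzy N ⊗[ℂ] Fuzzy N) (act hq N) _ _ a b W = t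
  induction t with
  | zero => simp
  | add X Y hX hY => simp only [map_add, hX, hY]
  | tmul c d =>
    simp only [TensorProduct.map_tmul, LinearMap.mul'_apply, map_mul]
    rfl

/-- The universal property of the braided tensor product. -/
lemma exists_braided_lift
    (hbraid : ∀ a b, braid hq N s (a ⊗ₜ b) = crossForm (act hq N)
      (Algebra.TensorProduct.includeLeft : Fuzzy N →ₐ[ℂ] Fuzzy N ⊗[ℂ] Fuzzy N).toLinearMap
      (Algebra.TensorProduct.includeRight : Fuzzy N →ₐ[ℂ] Fuzzy N ⊗[ℂ] Fuzzy N).toLinearMap a b W)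
    {B : Type*} [Ring B] [Algebra ℂ B] (y : Fin M → Fuzzy N →ₐ[ℂ] B)
    (hy : ∀ α β, α < β → IsCross (act hq N) W (y α).toLinearMap (y β).toLinearMap) :
    Nonempty (Braided hq N M s →ₐ[ℂ] B) := by
  refine ⟨RingQuot.liftAlgHom ℂ ⟨TensorAlgebra.lift ℂ
    (∑ α, (y α).toLinearMap ∘ₗ LinearMap.proj α), ?_⟩⟩
  have hc : ∀ α a, TensorAlgebra.lift ℂ (∑ α, (y α).toLinearMap ∘ₗ LinearMap.proj α)
      (copy N M α a) = y α a := by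
    intro α a
    simp only [copy, LinearMap.comp_apply, TensorAlgebra.lift_ι_apply, LinearMap.sum_apply,
      LinearMap.proj_apply, AlgHom.toLinearMap_apply, LinearMap.coe_single]
    rw [Finset.sum_eq_single α]
    · simp
    · intro β _ hβ
      simp [Pi.single_eq_of_ne hβ]
    · simp
  intro t t' r
  induction r with
  | one α => rw [hc, map_one, map_one]
  | mul α a b => rw [map_mul, hc, hc, hc, map_mul]
  | cross α β hαβ a b =>
    rw [map_mul, hc, hc]
    refine (hy α β hαβ a b).trans (Eq.trans (mul_map_crossForm _ _ _ a b W).symm ?_)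
    rw [hbraid]
    generalize crossForm (B := Fuzzy N ⊗[ℂ] Fuzzy N) (act hq N) _ _ a b W = t
    induction t with
    | zero => simp
    | add X Y hX hY => simp only [map_add, hX, hY]
    | tmul c d => simp [hc]

/-- The iterated unbraiding: at each stage the copies are algebra homomorphisms, the copies that
have been used commute with all later ones, and the others satisfy the original cross relations. -/
lemma stage_spec (h : IsHalfR (act hq N) W W') (hπ : Implements (spinRep hq N) (act hq N))
    (hemb : ∀ α β : Fin M, α < β →
      IsCross (act hq N) W (emb hq N M s α).toLinearMap (emb hq N M s β).toLinearMap)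
    (hun : unbraid hq N s = TensorProduct.map LinearMap.id (spinRep hq N).toLinearMap ∘ₗ legMap W')
    (k : ℕ) :
    ∃ y : Fin M → Fuzzy N →ₐ[ℂ] Braided hq N M s,
      (∀ α, (y α).toLinearMap = stage hq N M s k α) ∧
      ∀ α β : Fin M, α < β → if (α : ℕ) < k then ∀ a b, Commute (y α a) (y β b)
        else IsCross (act hq N) W (y α).toLinearMap (y β).toLinearMap := by
  induction k with
  | zero => exact ⟨emb hq N M s, fun α => rfl, fun α β hαβ => by simpa using hemb α β hαβ⟩
  | succ k ih =>
    obtain ⟨y, hy, hc⟩ := ih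
    have hcross : ∀ α β : Fin M, k ≤ α → α < β →
        IsCross (act hq N) W (y α).toLinearMap (y β).toLinearMap := fun α β hk hαβ => by
      simpa [not_lt.mpr hk] using hc α β hαβ
    have hcomm : ∀ α β : Fin M, (α : ℕ) < k → α < β → ∀ a b, Commute (y α a) (y β b) :=
      fun α β hk hαβ => by simpa [hk] using hc α β hαβ
    let z : Fin M → Fuzzy N →ₐ[ℂ] Braided hq N M s := fun α =>
      if hk : k < (α : ℕ) then
        h.unbraidHom hπ (y ⟨k, hk.trans α.isLt⟩) (y α) (hcross ⟨k, hk.trans α.isLt⟩ α le_rfl hk)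
      else y α
    have hz1 : ∀ (α : Fin M) (hk : k < (α : ℕ)), (z α).toLinearMap = unbraidMap (spinRep hq N) W'
        (y ⟨k, hk.trans α.isLt⟩).toLinearMap (y α).toLinearMap := by
      intro α hk
      simp only [z, dif_pos hk]
      rfl
    have hz2 : ∀ α : Fin M, ¬ k < (α : ℕ) → z α = y α := fun α hk => by simp only [z, dif_neg hk]
    refine ⟨z, ?_, ?_⟩
    · intro α
      by_cases hk : k < (α : ℕ)
      · rw [hz1 α hk, stage, dif_pos hk, ← hy, ← hy, unbraidMap, hun]
        have e := TensorProduct.map_comp (y α).toLinearMap (y ⟨k, hk.trans α.isLt⟩).toLinearMap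
          LinearMap.id (spinRep hq N).toLinearMap
        rw [LinearMap.comp_id] at e
        rw [e, LinearMap.comp_assoc]
      · rw [hz2 α hk, stage, dif_neg hk, hy]
    · intro α β hαβ
      split_ifs with hk
      · intro a b
        by_cases hβ : k < (β : ℕ)
        · rw [hz2 α (by omega)]
          change Commute _ ((z β).toLinearMap b)
          rw [hz1 β hβ]
          obtain hαk | hαk := (Nat.lt_succ_iff.mp hk).lt_or_eq
          · exact unbraidMap_commute_of _ _ _ _ _ (fun c => hcomm α _ hαk hαk a c)
              (fun c => hcomm α β hαk hαβ a c) b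
          · have : α = ⟨k, hβ.trans β.isLt⟩ := Fin.ext hαk
            rw [this]
            exact (h.unbraidMap_commute hπ _ _ (hcross ⟨k, hβ.trans β.isLt⟩ β le_rfl hβ) a b).symm
        · rw [hz2 α (by omega), hz2 β hβ]
          exact hcomm α β (by have : (α : ℕ) < β := hαβ; omega) hαβ a b
      · have hα : k < (α : ℕ) := by omega
        have hβ : k < (β : ℕ) := hα.trans hαβ
        rw [hz1 α hα, hz1 β hβ]
        exact h.unbraidMap_cross hπ _ _ _ (hcross _ _ le_rfl hα) (hcross _ _ le_rfl hβ)
          (hcross _ _ hα.le hαβ)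

end families

/-! ### Ordered products and tensor powers of matrix algebras -/

section ordered

/-- If the submodules `S i` of an algebra are closed under products and can be sorted, then their
sorted product is stable under left multiplication by each of them. -/
lemma mul_list_prod_le {ι B : Type*} [Preorder ι] [Ring B] [Algebra ℂ B] (S : ι → Submodule ℂ B)
    (hm : ∀ i, S i * S i ≤ S i) (hc : ∀ i j, i < j → S j * S i ≤ S i * S j) (l : List ι)
    (hl : l.Pairwise (· < ·)) (j : ι) (hj : j ∈ l) : S j * (l.map S).prod ≤ (l.map S).prod := by
  induction l with
  | nil => simp at hj
  | cons i l ih =>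
    rw [List.map_cons, List.prod_cons, ← mul_assoc]
    rw [List.pairwise_cons] at hl
    rcases List.mem_cons.mp hj with rfl | hj
    · exact mul_le_mul' (hm j) le_rfl
    · refine (mul_le_mul' (hc i j (hl.1 j hj)) le_rfl).trans ?_
      rw [mul_assoc]
      exact mul_le_mul' le_rfl (ih hl.2 hj)

/-- The product of the ranges of linear maps `f i` is spanned by the ordered products. -/
lemma list_prod_range_le {A B : Type*} [AddCommGroup A] [Module ℂ A] [Ring B] [Algebra ℂ B]
    (M : ℕ) (f : Fin M → A →ₗ[ℂ] B) :
    (List.ofFn fun i => LinearMap.range (f i)).prod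
      ≤ LinearMap.range (PiTensorProduct.lift
        ((MultilinearMap.mkPiAlgebraFin ℂ M B).compLinearMap f)) := by
  induction M with
  | zero =>
    rw [List.ofFn_zero, List.prod_nil, Submodule.one_le]
    exact ⟨PiTensorProduct.tprod ℂ fun i => i.elim0, by simp⟩
  | succ M ih =>
    rw [List.ofFn_succ, List.prod_cons, Submodule.mul_le]
    rintro _ ⟨a, rfl⟩ y hy
    obtain ⟨t, rfl⟩ := ih _ hy
    clear hy
    induction t using PiTensorProduct.induction_on with
    | smul_tprod c b =>
      refine ⟨c • PiTensorProduct.tprod ℂ (Fin.cons a b), ?_⟩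
      simp [List.ofFn_succ]
    | add x y hx hy =>
      obtain ⟨u, hu⟩ := hx
      obtain ⟨v, hv⟩ := hy
      exact ⟨u + v, by rw [map_add, hu, hv, map_add, mul_add]⟩

variable {q : ℝ} {hq : 0 < q} {N M : ℕ} {s : Sign}
  {W : Module.End ℂ (Fuzzy N) ⊗[ℂ] Uq q}

lemma orderedMul_surjective
    (hemb : ∀ α β : Fin M, α < β →
      IsCross (act hq N) W (emb hq N M s α).toLinearMap (emb hq N M s β).toLinearMap) :
    Function.Surjective (orderedMul hq N M s) := by
  set S : Fin M → Submodule ℂ (Braided hq N M s) :=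
    fun α => LinearMap.range (emb hq N M s α).toLinearMap with hS
  have hm : ∀ α, S α * S α ≤ S α := by
    intro α
    rw [Submodule.mul_le]
    rintro _ ⟨a, rfl⟩ _ ⟨b, rfl⟩
    exact ⟨a * b, map_mul (emb hq N M s α) a b⟩
  have hc : ∀ α β, α < β → S β * S α ≤ S α * S β := by
    intro α β hαβ
    rw [Submodule.mul_le]
    rintro _ ⟨b, rfl⟩ _ ⟨a, rfl⟩
    rw [hemb α β hαβ a b]
    clear hemb
    induction W with
    | zero => simp
    | add X Y hX hY => rw [map_add]; exact Submodule.add_mem _ hX hY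
    | tmul w u => exact Submodule.mul_mem_mul ⟨_, rfl⟩ ⟨_, rfl⟩
  set P := ((List.finRange M).map S).prod with hP
  have hstab : ∀ α, S α * P ≤ P := fun α =>
    mul_list_prod_le S hm hc _ (List.pairwise_lt_finRange M) α (List.mem_finRange α)
  have h1 : (1 : Submodule ℂ (Braided hq N M s)) ≤ P := by
    rw [hP]
    refine List.one_le_prod_of_one_le fun T hT => ?_
    obtain ⟨α, -, rfl⟩ := List.mem_map.mp hT
    rw [Submodule.one_le]
    exact ⟨1, map_one (emb hq N M s α)⟩
  have key : ∀ t, ∀ p ∈ P, Braided.mk hq N M s t * p ∈ P := by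
    intro t
    induction t using TensorAlgebra.induction with
    | algebraMap c =>
      intro p hp
      rw [AlgHom.commutes, ← Algebra.smul_def]
      exact P.smul_mem c hp
    | ι m =>
      intro p hp
      have : Braided.mk hq N M s (TensorAlgebra.ι ℂ m) = ∑ α, emb hq N M s α (m α) := by
        conv_lhs => rw [← Finset.univ_sum_single m]
        rw [map_sum, map_sum]
        rfl
      rw [this, Finset.sum_mul]
      exact P.sum_mem fun α _ => hstab α (Submodule.mul_mem_mul ⟨_, rfl⟩ hp)
    | mul x y hx hy =>
      intro p hp
      rw [map_mul, mul_assoc]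
      exact hx _ (hy _ hp)
    | add x y hx hy =>
      intro p hp
      rw [map_add, add_mul]
      exact P.add_mem (hx _ hp) (hy _ hp)
  intro x
  obtain ⟨t, rfl⟩ : ∃ t, Braided.mk hq N M s t = x :=
    RingQuot.mkAlgHom_surjective ℂ (BraidRel hq N M s) x
  have hx := key t 1 (Submodule.one_le.mp h1)
  rw [mul_one, hP, ← List.ofFn_eq_map] at hx
  exact list_prod_range_le M _ hx

end ordered

section matrices

/-- An algebra homomorphism from a tensor power of a matrix algebra to a nontrivial algebra is
injective: the matrix units recover every coefficient of `x` from the two-sided ideal that `x`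
generates. -/
lemma injective_of_tensor_matrix {ι n B : Type*} [Fintype ι] [DecidableEq ι] [Fintype n]
    [DecidableEq n] [Ring B] [Algebra ℂ B] [Nontrivial B]
    (f : PiTensorProduct ℂ (fun _ : ι => Matrix n n ℂ) →ₐ[ℂ] B) : Function.Injective f := by
  classical
  let coeff : (ι → n) → (ι → n) → PiTensorProduct ℂ (fun _ : ι => Matrix n n ℂ) →ₗ[ℂ] ℂ :=
    fun i j => PiTensorProduct.lift ((MultilinearMap.mkPiAlgebra ℂ ι ℂ).compLinearMap
      fun α => Matrix.entryLinearMap ℂ ℂ (i α) (j α))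
  have extract : ∀ (i j : ι → n) (x : PiTensorProduct ℂ (fun _ : ι => Matrix n n ℂ)),
      ∑ k : ι → n, PiTensorProduct.tprod ℂ (fun α => Matrix.single (k α) (i α) (1 : ℂ)) * x *
        PiTensorProduct.tprod ℂ (fun α => Matrix.single (j α) (k α) (1 : ℂ))
        = coeff i j x • 1 := by
    intro i j x
    have single_mul : ∀ (i j : n) (a : Matrix n n ℂ),
        ∑ k : n, Matrix.single k i (1 : ℂ) * a * Matrix.single j k (1 : ℂ) = a i j • 1 := by
      intro i j a
      simp only [Matrix.single_mul_mul_single, one_mul, mul_one]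
      rw [Matrix.sum_single_eq_diagonal, Matrix.smul_one_eq_diagonal]
    have e : ∑ k : ι → n, PiTensorProduct.mul.flip
          (PiTensorProduct.tprod ℂ fun α => Matrix.single (j α) (k α) (1 : ℂ)) ∘ₗ
        PiTensorProduct.mul (PiTensorProduct.tprod ℂ fun α => Matrix.single (k α) (i α) (1 : ℂ))
        = (coeff i j).smulRight 1 := by
      refine PiTensorProduct.ext (MultilinearMap.ext fun a => ?_)
      simp only [LinearMap.compMultilinearMap_apply, LinearMap.sum_apply, LinearMap.comp_apply,
        LinearMap.flip_apply, PiTensorProduct.mul_tprod_tprod,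
        LinearMap.smulRight_apply]
      refine (MultilinearMap.map_sum (PiTensorProduct.tprod ℂ) fun α (k : n) =>
        Matrix.single k (i α) (1 : ℂ) * a α * Matrix.single (j α) k (1 : ℂ)).symm.trans ?_
      refine (congrArg _ (funext fun α => single_mul (i α) (j α) (a α))).trans ?_
      refine (MultilinearMap.map_smul_univ _ _ _).trans ?_
      simp only [coeff, PiTensorProduct.lift.tprod, MultilinearMap.compLinearMap_apply,
        MultilinearMap.mkPiAlgebra_apply, Matrix.entryLinearMap_apply]
      rfl
    have := LinearMap.congr_fun e x
    rw [LinearMap.sum_apply] at this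
    exact this
  have faithful : ∀ x, (∀ i j, coeff i j x = 0) → x = 0 := by
    intro x hx
    let b := Basis.piTensorProduct (fun _ : ι => Matrix.stdBasis ℂ n n)
    have : ∀ p : ι → n × n, b.repr x p = coeff (fun α => (p α).1) (fun α => (p α).2) x := by
      intro p
      have e : b.coord p = coeff (fun α => (p α).1) (fun α => (p α).2) := by
        refine PiTensorProduct.ext (MultilinearMap.ext fun a => ?_)
        simp [b, coeff, Matrix.stdBasis]
      exact LinearMap.congr_fun e x
    refine b.ext_elem fun p => ?_
    rw [this, hx]
    simp
  rw [injective_iff_map_eq_zero]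
  intro x hx
  refine faithful x fun i j => ?_
  have := congrArg f (extract i j x)
  rw [map_sum, map_smul, map_one] at this
  simp only [map_mul, hx, mul_zero, zero_mul, Finset.sum_const_zero] at this
  exact (smul_eq_zero.mp this.symm).resolve_right one_ne_zero

end matrices

/-! ### Decomposition of braided tensor products -/

section commuting

/-- The product of commuting families is the product of the products. -/
lemma list_prod_ofFn_mul {B : Type*} [Monoid B] {M : ℕ} (x y : Fin M → B)
    (h : ∀ i j, i < j → Commute (y i) (x j)) :
    (List.ofFn fun i => x i * y i).prod = (List.ofFn x).prod * (List.ofFn y).prod := by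
  induction M with
  | zero => simp
  | succ M ih =>
    have hc : Commute (y 0) (List.ofFn fun i => x (Fin.succ i)).prod := by
      apply Commute.list_prod_right
      intro z hz
      obtain ⟨i, rfl⟩ := List.mem_ofFn.mp hz
      exact h 0 i.succ i.succ_pos
    rw [List.ofFn_succ, List.prod_cons, ih (fun i => x i.succ) (fun i => y i.succ)
      fun i j hij => h _ _ (Fin.succ_lt_succ_iff.mpr hij), List.ofFn_succ (f := x),
      List.ofFn_succ (f := y), List.prod_cons, List.prod_cons, mul_assoc, mul_assoc,
      ← mul_assoc (y 0),
      hc.eq, mul_assoc]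

lemma list_prod_ofFn_of_eq_one {B : Type*} [Monoid B] {M : ℕ} (x : Fin M → B) (α : Fin M)
    (h : ∀ β, β ≠ α → x β = 1) : (List.ofFn x).prod = x α := by
  induction M with
  | zero => exact α.elim0
  | succ M ih =>
    rw [List.ofFn_succ, List.prod_cons]
    induction α using Fin.cases with
    | zero =>
      rw [List.prod_eq_one, mul_one]
      intro z hz
      obtain ⟨i, rfl⟩ := List.mem_ofFn.mp hz
      exact h _ (Fin.succ_ne_zero i)
    | succ α =>
      rw [h 0 (Fin.succ_ne_zero α).symm, one_mul]
      exact ih (fun i => x i.succ) α fun β hβ => h _ (by simpa using hβ)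

variable {M : ℕ} {A : Fin M → Type*} {B : Type*} [∀ i, Ring (A i)] [∀ i, Algebra ℂ (A i)]
  [Ring B] [Algebra ℂ B]

/-- The algebra homomorphism from an ordinary tensor product that is induced by commuting algebra
homomorphisms. -/
def commutingLift (y : ∀ i, A i →ₐ[ℂ] B) (hy : ∀ i j, i < j → ∀ a b, Commute (y i a) (y j b)) :
    PiTensorProduct ℂ A →ₐ[ℂ] B :=
  PiTensorProduct.liftAlgHom
    ((MultilinearMap.mkPiAlgebraFin ℂ M B).compLinearMap fun i => (y i).toLinearMap)
    (by simp)
    (fun a b => by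
      simpa using list_prod_ofFn_mul (fun i => y i (a i)) (fun i => y i (b i))
        fun i j hij => hy i j hij _ _)

lemma commutingLift_tprod (y : ∀ i, A i →ₐ[ℂ] B)
    (hy : ∀ i j, i < j → ∀ a b, Commute (y i a) (y j b)) (a : ∀ i, A i) :
    commutingLift y hy (PiTensorProduct.tprod ℂ a) = (List.ofFn fun i => y i (a i)).prod := by
  simp [commutingLift]

lemma commutingLift_single (y : ∀ i, A i →ₐ[ℂ] B)
    (hy : ∀ i j, i < j → ∀ a b, Commute (y i a) (y j b)) (i : Fin M) (a : A i) :
    commutingLift y hy (PiTensorProduct.singleAlgHom i a) = y i a := by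
  rw [PiTensorProduct.singleAlgHom_apply, commutingLift_tprod, list_prod_ofFn_of_eq_one _ i]
  · simp
  · intro j hj
    simp [hj]

end commuting

section final

variable {q : ℝ} {hq : 0 < q} {N M : ℕ} {s : Sign} {W W' : Module.End ℂ (Fuzzy N) ⊗[ℂ] Uq q}

lemma stage_eq_unbraided (k : ℕ) (α : Fin M) (hk : (α : ℕ) ≤ k) :
    stage hq N M s k α = unbraided hq N M s α := by
  induction k with
  | zero =>
    have : (α : ℕ) = 0 := Nat.le_zero.mp hk
    rw [unbraided, this]
  | succ k ih =>
    rcases hk.lt_or_eq with h | h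
    · rw [stage, dif_neg (by omega), ih (by omega)]
    · rw [unbraided, h]

/-- The decomposition of a braided tensor product, given the R-matrix that belongs to it. -/
lemma braided_decomposition (hM : 1 ≤ M) (h : IsHalfR (act hq N) W W')
    (hπ : Implements (spinRep hq N) (act hq N))
    (hbraid : ∀ a b, braid hq N s (a ⊗ₜ b) = crossForm (act hq N)
      (Algebra.TensorProduct.includeLeft : Fuzzy N →ₐ[ℂ] Fuzzy N ⊗[ℂ] Fuzzy N).toLinearMap
      (Algebra.TensorProduct.includeRight : Fuzzy N →ₐ[ℂ] Fuzzy N ⊗[ℂ] Fuzzy N).toLinearMap a b W)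
    (hun : unbraid hq N s
      = TensorProduct.map LinearMap.id (spinRep hq N).toLinearMap ∘ₗ legMap W') :
    Function.Bijective (orderedMul hq N M s) ∧
      ∃ e : Fin M → (Fuzzy N →ₐ[ℂ] Braided hq N M s),
        (∀ α a, e α a = unbraided hq N M s α a) ∧
        e ⟨0, hM⟩ = emb hq N M s ⟨0, hM⟩ ∧
        (∀ α, Function.Injective (e α)) ∧
        ∃ Φ : PiTensorProduct ℂ (fun α : Fin M => (e α).range) ≃ₐ[ℂ] Braided hq N M s,
          ∀ (α : Fin M) (a : (e α).range),
            Φ (PiTensorProduct.singleAlgHom α a) = (a : Braided hq N M s) := by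
  have hemb := emb_cross (M := M) hbraid
  have nt : Nontrivial (Braided hq N M s) := by
    obtain ⟨B, _, _, _, y, hy⟩ := h.exists_family hπ M
    obtain ⟨f⟩ := exists_braided_lift hbraid y hy
    exact f.toRingHom.domain_nontrivial
  obtain ⟨e, he, hc⟩ := stage_spec h hπ hemb hun M
  have hcomm : ∀ α β, α < β → ∀ a b, Commute (e α a) (e β b) := fun α β hαβ => by
    simpa [α.isLt] using hc α β hαβ
  have he' : ∀ α, (e α).toLinearMap = unbraided hq N M s α := fun α => by
    rw [he, stage_eq_unbraided M α α.isLt.le]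
  have hsurj : Function.Surjective (orderedMul hq N M s) := orderedMul_surjective hemb
  have hinj : Function.Injective (commutingLift e hcomm) := injective_of_tensor_matrix _
  let F : PiTensorProduct ℂ (fun _ : Fin M => Fuzzy N) →ₗ[ℂ] Braided hq N M s :=
    PiTensorProduct.lift
      ((MultilinearMap.mkPiAlgebraFin ℂ M _).compLinearMap fun i => (e i).toLinearMap)
  have hF : ∀ x, F x = commutingLift e hcomm x := fun x => rfl
  have hFinj : Function.Injective F := hinj
  -- the ordered product is surjective and `F` is injective, so both are bijective
  have : Module.Finite ℂ (Braided hq N M s) := Module.Finite.of_surjective _ hsurj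
  have hdim : Module.finrank ℂ (PiTensorProduct ℂ (fun _ : Fin M => Fuzzy N))
      = Module.finrank ℂ (Braided hq N M s) :=
    le_antisymm (LinearMap.finrank_le_finrank_of_injective hFinj)
      (LinearMap.finrank_le_finrank_of_surjective hsurj)
  have hFbij : Function.Bijective F :=
    ⟨hFinj, (LinearMap.injective_iff_surjective_of_finrank_eq_finrank hdim).mp hFinj⟩
  have heinj : ∀ α, Function.Injective (e α) := fun α => RingHom.injective (e α).toRingHom
  refine ⟨⟨(LinearMap.injective_iff_surjective_of_finrank_eq_finrank hdim).mpr hsurj, hsurj⟩,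
    e, fun α a => LinearMap.congr_fun (he' α) a, ?_, heinj, ?_⟩
  · ext a
    exact LinearMap.congr_fun (he' ⟨0, hM⟩) a
  · let val : ∀ α, (e α).range →ₐ[ℂ] Braided hq N M s := fun α => (e α).range.val
    have hval : ∀ α β, α < β → ∀ a b, Commute (val α a) (val β b) := by
      rintro α β hαβ ⟨_, a, rfl⟩ ⟨_, b, rfl⟩
      exact hcomm α β hαβ a b
    have hΦ : Function.Bijective (commutingLift val hval) := by
      let c : PiTensorProduct ℂ (fun _ : Fin M => Fuzzy N)
          ≃ₗ[ℂ] PiTensorProduct ℂ (fun α : Fin M => (e α).range) :=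
        PiTensorProduct.congr fun α => (AlgEquiv.ofInjective (e α) (heinj α)).toLinearEquiv
      have hcF : ∀ x, commutingLift val hval (c x) = F x := by
        intro x
        have : PiTensorProduct.lift ((MultilinearMap.mkPiAlgebraFin ℂ M _).compLinearMap
            fun i => (val i).toLinearMap) ∘ₗ c.toLinearMap = F := by
          refine PiTensorProduct.ext (MultilinearMap.ext fun a => ?_)
          simp [c, F, val]
        exact LinearMap.congr_fun this x
      have : (commutingLift val hval : _ → Braided hq N M s) = F ∘ c.symm := by
        funext x
        rw [Function.comp_apply, ← hcF, LinearEquiv.apply_symm_apply]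
      rw [this]
      exact hFbij.comp c.symm.bijective
    exact ⟨AlgEquiv.ofBijective _ hΦ, fun α a => commutingLift_single val hval α a⟩

end final

/-! ### q-exponential functions and the coefficients of the R-matrix -/

section qexp

/-- The coefficients of the `p`-exponential function, `c n = κ ^ n / ((1 - p) ⋯ (1 - p ^ n))`, by
their recursion. -/
structure IsQExp (p κ : ℂ) (c : ℕ → ℂ) : Prop where
  κ_ne : κ ≠ 0
  p_ne : ∀ n : ℕ, 1 - p ^ (n + 1) ≠ 0
  zero : c 0 = 1
  succ : ∀ n, c (n + 1) * (1 - p ^ (n + 1)) = κ * c n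

variable {B : Type*} [Ring B] [Algebra ℂ B] {p κ : ℂ} {c : ℕ → ℂ}

lemma mul_pow_of_mul_eq_smul {Y Z : B} (h : Z * Y = p • (Y * Z)) (k : ℕ) :
    Z * Y ^ k = p ^ k • (Y ^ k * Z) := by
  induction k with
  | zero => simp
  | succ k ih =>
    rw [pow_succ, ← mul_assoc, ih, smul_mul_assoc, mul_assoc, h, mul_smul_comm, smul_smul,
      ← mul_assoc, pow_succ]

/-- The addition theorem of the `p`-exponential function, in each degree. -/
lemma IsQExp.add (hc : IsQExp p κ c) {Y Z : B} (h : Z * Y = p • (Y * Z)) (n : ℕ) :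
    c n • (Y + Z) ^ n
      = ∑ x ∈ Finset.HasAntidiagonal.antidiagonal n, (c x.1 * c x.2) • (Y ^ x.1 * Z ^ x.2) := by
  induction n with
  | zero => simp [hc.zero]
  | succ n ih =>
    have e1 : (1 - p ^ (n + 1)) • (c (n + 1) • (Y + Z) ^ (n + 1))
        = κ • ((Y + Z) * (c n • (Y + Z) ^ n)) := by
      rw [smul_smul, mul_comm, hc.succ, mul_smul_comm, smul_smul, pow_succ']
    have e2 : (1 - p ^ (n + 1)) • ∑ x ∈ Finset.HasAntidiagonal.antidiagonal (n + 1),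
          (c x.1 * c x.2) • (Y ^ x.1 * Z ^ x.2)
        = ∑ x ∈ Finset.HasAntidiagonal.antidiagonal (n + 1),
            (c x.1 * (1 - p ^ x.1) * c x.2) • (Y ^ x.1 * Z ^ x.2)
          + ∑ x ∈ Finset.HasAntidiagonal.antidiagonal (n + 1),
            (p ^ x.1 * c x.1 * (c x.2 * (1 - p ^ x.2))) • (Y ^ x.1 * Z ^ x.2) := by
      rw [Finset.smul_sum, ← Finset.sum_add_distrib]
      refine Finset.sum_congr rfl fun x hx => ?_
      rw [smul_smul, ← add_smul, ← Finset.HasAntidiagonal.mem_antidiagonal.mp hx, pow_add]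
      congr 1
      ring
    refine smul_right_injective B (hc.p_ne n) ?_
    change (1 - p ^ (n + 1)) • _ = (1 - p ^ (n + 1)) • _
    rw [e1, e2, ih, Finset.Nat.sum_antidiagonal_succ, Finset.Nat.sum_antidiagonal_succ']
    simp only [pow_zero, sub_self, mul_zero, zero_mul, zero_smul, zero_add, hc.succ,
      add_mul, Finset.mul_sum, Finset.sum_add_distrib, smul_add, Finset.smul_sum, mul_smul_comm,
      smul_smul]
    congr 1 <;> refine Finset.sum_congr rfl fun x _ => ?_
    · rw [← mul_assoc Y, ← pow_succ', mul_assoc κ]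
    · rw [← mul_assoc Z, mul_pow_of_mul_eq_smul h, smul_mul_assoc, smul_smul, mul_assoc (Y ^ _),
        ← pow_succ']
      congr 1
      ring

/-- The commutator of `e` with a power of `f`, for a triple of `sl(2)` type. -/
lemma IsQExp.commutator (hc : IsQExp p κ c) {e f k k' : B} {d : ℂ} (hd : κ * d = 1 - p)
    (hkf : k * f = p • (f * k)) (hfk : f * k' = p • (k' * f)) (hef : e * f - f * e = d • (k - k'))
    (n : ℕ) :
    c (n + 1) • (e * f ^ (n + 1) - f ^ (n + 1) * e) = c n • (f ^ n * k - k' * f ^ n) := by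
  have hfk' : ∀ n : ℕ, f ^ n * k' = p ^ n • (k' * f ^ n) := by
    intro n
    induction n with
    | zero => simp
    | succ n ih =>
      rw [pow_succ, mul_assoc, hfk, mul_smul_comm, ← mul_assoc, ih, smul_mul_assoc, smul_smul,
        ← pow_succ', mul_assoc]
  have key : ∀ n : ℕ, κ • (e * f ^ (n + 1) - f ^ (n + 1) * e)
      = (1 - p ^ (n + 1)) • (f ^ n * k - k' * f ^ n) := by
    intro n
    induction n with
    | zero => simp [hef, smul_smul, hd]
    | succ n ih =>
      have : e * f ^ (n + 1 + 1) - f ^ (n + 1 + 1) * e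
          = (e * f ^ (n + 1) - f ^ (n + 1) * e) * f + f ^ (n + 1) * (e * f - f * e) := by
        rw [pow_succ f (n + 1)]
        noncomm_ring
      rw [this, smul_add, ← smul_mul_assoc, ih, hef, mul_smul_comm, smul_smul, hd, mul_sub, hfk',
        smul_mul_assoc, sub_mul, mul_assoc, hkf, mul_smul_comm, ← mul_assoc, ← pow_succ, mul_assoc,
        ← pow_succ]
      simp only [smul_sub, smul_smul]
      have e1 : (1 - p ^ (n + 1 + 1)) = (1 - p ^ (n + 1)) * p + (1 - p) := by ring
      have e2 : (1 - p ^ (n + 1 + 1)) = (1 - p ^ (n + 1)) + (1 - p) * p ^ (n + 1) := by ring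
      nth_rewrite 1 [e1]
      rw [e2, add_smul, add_smul]
      abel
  refine smul_right_injective B hc.κ_ne ?_
  change κ • _ = κ • _
  rw [smul_comm, key, smul_smul, hc.succ, smul_smul]

/-- A truncated double sum, by diagonals. -/
lemma sum_range_antidiagonal {G : Type*} [AddCommMonoid G] (T : ℕ) (f : ℕ → ℕ → G)
    (hf : ∀ k l, T ≤ k + l → f k l = 0) :
    ∑ n ∈ Finset.range T, ∑ x ∈ Finset.HasAntidiagonal.antidiagonal n, f x.1 x.2
      = ∑ k ∈ Finset.range T, ∑ l ∈ Finset.range T, f k l := by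
  simp only [Finset.Nat.sum_antidiagonal_eq_sum_range_succ f]
  rw [Finset.sum_range_diag_flip]
  refine Finset.sum_congr rfl fun k _ => ?_
  refine Finset.sum_subset (Finset.range_mono (Nat.sub_le _ _)) fun l _ hl => hf k l ?_
  rw [Finset.mem_range] at hl
  omega

end qexp

section Uq

variable {q : ℝ}

lemma qhalf_ne_zero (hq : 0 < q) : qhalf q ≠ 0 := by
  rw [qhalf, Complex.ofReal_ne_zero]
  exact (Real.rpow_pos_of_pos hq _).ne'

lemma qhalf_sub_inv_ne_zero (hq : 0 < q) (hq1 : q ≠ 1) : qhalf q - (qhalf q)⁻¹ ≠ 0 := by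
  intro h
  have h1 : qhalf q * qhalf q = 1 := by
    rw [sub_eq_zero] at h
    nth_rewrite 2 [h]
    exact mul_inv_cancel₀ (qhalf_ne_zero hq)
  rw [← sq, qhalf_sq hq] at h1
  exact hq1 (by exact_mod_cast h1)

lemma pow_sub_one_ne_zero (hq : 0 < q) (hq1 : q ≠ 1) (n : ℕ) : 1 - (q : ℂ)⁻¹ ^ (n + 1) ≠ 0 := by
  intro h
  rw [sub_eq_zero, ← Complex.ofReal_inv, ← Complex.ofReal_pow] at h
  have h' : q⁻¹ ^ (n + 1) = 1 := by exact_mod_cast h.symm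
  rw [pow_eq_one_iff_of_nonneg (by positivity) (by omega)] at h'
  exact hq1 (inv_eq_one.mp h')

lemma qnum_natCast_succ (hq : 0 < q) (n : ℕ) :
    (qnum q ((n : ℝ) + 1) : ℂ)
      = (qhalf q ^ (n + 1) - (qhalf q)⁻¹ ^ (n + 1)) / (qhalf q - (qhalf q)⁻¹) := by
  have e1 : q ^ (((n : ℝ) + 1) / 2) = (q ^ (1 / 2 : ℝ)) ^ (n + 1) := by
    rw [← Real.rpow_natCast, ← Real.rpow_mul hq.le]; congr 1; push_cast; ring
  have e2 : q ^ (-((n : ℝ) + 1) / 2) = (q ^ (1 / 2 : ℝ))⁻¹ ^ (n + 1) := by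
    rw [← Real.rpow_neg hq.le, ← Real.rpow_natCast, ← Real.rpow_mul hq.le]; congr 1; push_cast; ring
  have e3 : q ^ (-1 / 2 : ℝ) = (q ^ (1 / 2 : ℝ))⁻¹ := by
    rw [← Real.rpow_neg hq.le]; congr 1; norm_num
  rw [qnum, e1, e2, e3, qhalf]
  push_cast
  ring

/-- The coefficients of the R-matrix are those of a `q⁻¹`-exponential function. -/
lemma isQExp_rCoeff (hq : 0 < q) (hq1 : q ≠ 1) :
    IsQExp (q : ℂ)⁻¹ ((qhalf q - (qhalf q)⁻¹) ^ 2 * (qhalf q)⁻¹) (rCoeff q) := by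
  have hv := qhalf_ne_zero hq
  have hv1 := qhalf_sub_inv_ne_zero hq hq1
  refine ⟨mul_ne_zero (pow_ne_zero _ hv1) (inv_ne_zero hv), pow_sub_one_ne_zero hq hq1,
    by simp [rCoeff, qfact], fun n => ?_⟩
  have hn : (n + 1) * (n + 1 - 1) / 2 = n * (n - 1) / 2 + n := by
    rw [Nat.add_sub_cancel, ← Nat.triangle_succ]
    simp [mul_comm]
  have hp := pow_sub_one_ne_zero hq hq1 n
  have hfac : (qfact q (n + 1) : ℂ) = (qfact q n : ℂ) * (qnum q ((n : ℝ) + 1) : ℂ) := by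
    rw [qfact, Finset.prod_range_succ, Complex.ofReal_mul]
    rfl
  have hqn : (qnum q ((n : ℝ) + 1) : ℂ) * (qhalf q - (qhalf q)⁻¹)
      = qhalf q ^ (n + 1) * (1 - (q : ℂ)⁻¹ ^ (n + 1)) := by
    rw [qnum_natCast_succ hq, div_mul_cancel₀ _ hv1, ← qhalf_sq hq, mul_sub, mul_one, ← mul_pow]
    congr 2
    field_simp
  have hqn0 : (qnum q ((n : ℝ) + 1) : ℂ) ≠ 0 := by
    intro h0
    rw [h0, zero_mul] at hqn
    exact mul_ne_zero (pow_ne_zero _ hv) hp hqn.symm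
  have hX : (1 - (q : ℂ)⁻¹ ^ (n + 1)) = (qnum q ((n : ℝ) + 1) : ℂ) * (qhalf q - (qhalf q)⁻¹)
      * ((qhalf q)⁻¹) ^ (n + 1) := by
    rw [hqn, mul_right_comm, ← mul_pow, mul_inv_cancel₀ hv, one_pow, one_mul]
  rw [rCoeff, rCoeff, hn, hfac, hX]
  by_cases hf : (qfact q n : ℂ) = 0
  · simp [hf]
  generalize (qhalf q - (qhalf q)⁻¹) = w at *
  generalize (qnum q ((n : ℝ) + 1) : ℂ) = x at *
  generalize (qfact q n : ℂ) = y at *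
  generalize n * (n - 1) / 2 = t at *
  generalize qhalf q = v at *
  simp only [inv_pow]
  field_simp
  ring

end Uq

/-! ### Structure of `U_q so(3)` -/

namespace Uq

variable {q : ℝ}

/-- `K` as a unit. -/
def Kunit (q : ℝ) : (Uq q)ˣ := ⟨K q, Ki q, K_Ki, Ki_K⟩

lemma Kpow_eq (m : ℤ) : Kpow q m = ((Kunit q ^ m : (Uq q)ˣ) : Uq q) := by
  rcases le_total 0 m with h | h
  · lift m to ℕ using h
    have : (-(m : ℤ)).toNat = 0 := by omega
    simp [Kpow, this, Kunit]
  · obtain ⟨n, rfl⟩ : ∃ n : ℕ, m = -(n : ℤ) := ⟨m.natAbs, by omega⟩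
    have : (-(n : ℤ)).toNat = 0 := by omega
    rw [Kpow, this, zpow_neg, zpow_natCast, ← inv_pow]
    simp [Kunit]

lemma Kpow_zero : Kpow q 0 = 1 := by simp [Kpow]
lemma Kpow_one : Kpow q 1 = K q := by simp [Kpow]
lemma Kpow_neg_one : Kpow q (-1) = Ki q := by simp [Kpow]
lemma Kpow_add (m n : ℤ) : Kpow q (m + n) = Kpow q m * Kpow q n := by
  simp [Kpow_eq, zpow_add]

lemma zpow_mul_eq_smul {B : Type*} [Ring B] [Algebra ℂ B] (u : Bˣ) {x : B} {c : ℂ} (hc : c ≠ 0)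
    (h : (u : B) * x = c • (x * u)) (m : ℤ) :
    ((u ^ m : Bˣ) : B) * x = c ^ m • (x * ((u ^ m : Bˣ) : B)) := by
  have h' : ((u⁻¹ : Bˣ) : B) * x = c⁻¹ • (x * ((u⁻¹ : Bˣ) : B)) := by
    have : x * ((u⁻¹ : Bˣ) : B) = c • (((u⁻¹ : Bˣ) : B) * x) := by
      calc x * ((u⁻¹ : Bˣ) : B) = ((u⁻¹ : Bˣ) : B) * (u * x) * ((u⁻¹ : Bˣ) : B) := by simp
        _ = _ := by rw [h]; simp [mul_assoc]
    rw [this, smul_smul, inv_mul_cancel₀ hc, one_smul]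
  induction m using Int.induction_on with
  | zero => simp
  | succ n ih =>
    rw [zpow_add_one, Units.val_mul, mul_assoc, h, mul_smul_comm, ← mul_assoc, ih, smul_mul_assoc,
      smul_smul, zpow_add_one₀ hc, mul_assoc, mul_comm c]
  | pred n ih =>
    rw [zpow_sub_one, Units.val_mul, mul_assoc, h', mul_smul_comm, ← mul_assoc, ih, smul_mul_assoc,
      smul_smul, zpow_sub_one₀ hc, mul_assoc, mul_comm c⁻¹]

lemma K_F (hq : 0 < q) : K q * F q = (q : ℂ)⁻¹ • (F q * K q) := by
  have hv := qhalf_ne_zero hq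
  have h : K q * Em q = (q : ℂ)⁻¹ • (Em q * K q) := by
    rw [Em_K, smul_smul, ← qhalf_sq hq, inv_mul_cancel₀ (pow_ne_zero 2 hv), one_smul]
  rw [F, mul_smul_comm, ← mul_assoc, h, smul_mul_assoc, smul_mul_assoc, mul_assoc, mul_assoc, K_Ki,
    Ki_K, smul_comm]

lemma F_Ki (hq : 0 < q) : F q * Ki q = (q : ℂ)⁻¹ • (Ki q * F q) := by
  calc F q * Ki q = Ki q * (K q * F q) * Ki q := by rw [← mul_assoc, Ki_K, one_mul]
    _ = _ := by rw [K_F hq]; simp [mul_assoc, K_Ki]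

lemma Ki_Ep (hq : 0 < q) : Ki q * Ep q = (q : ℂ)⁻¹ • (Ep q * Ki q) := by
  have hv := qhalf_ne_zero hq
  rw [Ep_Ki, smul_smul, ← qhalf_sq hq, inv_mul_cancel₀ (pow_ne_zero 2 hv), one_smul]

lemma Ep_K (hq : 0 < q) : Ep q * K q = (q : ℂ)⁻¹ • (K q * Ep q) := by
  have hv := qhalf_ne_zero hq
  rw [K_Ep, smul_smul, ← qhalf_sq hq, inv_mul_cancel₀ (pow_ne_zero 2 hv), one_smul]

lemma Em_eq (hq : 0 < q) : Em q = (qhalf q)⁻¹ • (F q * K q) := by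
  rw [F, smul_mul_assoc, smul_smul, inv_mul_cancel₀ (qhalf_ne_zero hq), one_smul, mul_assoc, Ki_K,
    mul_one]

lemma Ep_F (hq : 0 < q) :
    Ep q * F q - F q * Ep q = (qhalf q - (qhalf q)⁻¹)⁻¹ • (K q - Ki q) := by
  have hv := qhalf_ne_zero hq
  have h : qhalf q * (q : ℂ)⁻¹ = (qhalf q)⁻¹ := by
    rw [← qhalf_sq hq]; field_simp
  calc Ep q * F q - F q * Ep q
      = (qhalf q • (Ep q * Em q) - (qhalf q)⁻¹ • (Em q * Ep q)) * Ki q := by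
        rw [F, mul_smul_comm, smul_mul_assoc, mul_assoc (Em q), Ki_Ep hq, mul_smul_comm, smul_smul,
          h, sub_mul, smul_mul_assoc, smul_mul_assoc, mul_assoc, mul_assoc]
    _ = _ := by
        rw [Ep_Em, smul_mul_assoc, sub_mul, one_mul, mul_assoc, K_Ki, mul_one]

lemma Kpow_mul_Ep (hq : 0 < q) (m : ℤ) : Kpow q m * Ep q = (q : ℂ) ^ m • (Ep q * Kpow q m) := by
  rw [Kpow_eq]
  exact zpow_mul_eq_smul _ (by exact_mod_cast hq.ne') (by rw [← qhalf_sq hq]; exact K_Ep) m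

lemma Kpow_mul_F (hq : 0 < q) (m : ℤ) : Kpow q m * F q = (q : ℂ)⁻¹ ^ m • (F q * Kpow q m) := by
  rw [Kpow_eq]
  exact zpow_mul_eq_smul _ (inv_ne_zero (by exact_mod_cast hq.ne')) (K_F hq) m

lemma comul_Ep : Bialgebra.comulAlgHom ℂ (Uq q) (Ep q) = Ep q ⊗ₜ K q + 1 ⊗ₜ Ep q := by
  change comul q (Ep q) = _
  simp [comul]
lemma comul_Em : Bialgebra.comulAlgHom ℂ (Uq q) (Em q) = Em q ⊗ₜ K q + 1 ⊗ₜ Em q := by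
  change comul q (Em q) = _
  simp [comul]
lemma comul_K : Bialgebra.comulAlgHom ℂ (Uq q) (K q) = K q ⊗ₜ K q := by
  change comul q (K q) = _
  simp [comul]
lemma comul_Ki : Bialgebra.comulAlgHom ℂ (Uq q) (Ki q) = Ki q ⊗ₜ Ki q := by
  change comul q (Ki q) = _
  simp [comul]
lemma comul_F : Bialgebra.comulAlgHom ℂ (Uq q) (F q) = F q ⊗ₜ 1 + Ki q ⊗ₜ F q := by
  rw [F, map_smul, map_mul, comul_Em, comul_Ki, add_mul, Algebra.TensorProduct.tmul_mul_tmul,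
    Algebra.TensorProduct.tmul_mul_tmul, K_Ki, one_mul, smul_add, TensorProduct.smul_tmul',
    TensorProduct.tmul_smul]
lemma comul_Kpow (m : ℤ) :
    Bialgebra.comulAlgHom ℂ (Uq q) (Kpow q m) = Kpow q m ⊗ₜ Kpow q m := by
  rw [Kpow, map_mul, map_pow, map_pow, comul_K, comul_Ki, Algebra.TensorProduct.tmul_pow,
    Algebra.TensorProduct.tmul_pow, Algebra.TensorProduct.tmul_mul_tmul]

/-- The automorphism `E ↦ F`, `F ↦ E`, `K ↦ K⁻¹` of the algebra `U_q so(3)`. It reverses the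
coproduct. -/
def omega (hq : 0 < q) : Uq q →ₐ[ℂ] Uq q :=
  lift (F q) ((qhalf q)⁻¹ • (Ep q * Ki q)) (Ki q) (K q) Ki_K K_Ki
    (by
      have hq0 : (q : ℂ) ≠ 0 := by exact_mod_cast hq.ne'
      rw [F_Ki hq, smul_smul, qhalf_sq hq, mul_inv_cancel₀ hq0, one_smul])
    (by rw [smul_mul_assoc, mul_smul_comm, ← mul_assoc, Ep_Ki, smul_mul_assoc, smul_comm])
    (by
      have hv := qhalf_ne_zero hq
      have hq0 : (q : ℂ) ≠ 0 := by exact_mod_cast hq.ne'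
      have h1 : Ep q * Ki q * F q = (q : ℂ) • (Ep q * F q * Ki q) := by
        rw [mul_assoc (Ep q) (F q), F_Ki hq, mul_smul_comm, smul_smul, mul_inv_cancel₀ hq0,
          one_smul,
          mul_assoc]
      have h2 : (qhalf q)⁻¹ * ((qhalf q)⁻¹ * (q : ℂ)) = 1 := by
        rw [← qhalf_sq hq]; field_simp
      rw [mul_smul_comm, smul_smul, mul_inv_cancel₀ hv, one_smul, smul_mul_assoc, h1, smul_smul,
        smul_smul, mul_assoc, h2, one_smul, ← mul_assoc, ← sub_mul, ← neg_sub (Ep q * F q), Ep_F hq,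
        ← smul_neg, smul_mul_assoc, neg_sub, sub_mul, K_Ki])

@[simp] lemma omega_Ep (hq : 0 < q) : omega hq (Ep q) = F q := by simp [omega]
@[simp] lemma omega_K (hq : 0 < q) : omega hq (K q) = Ki q := by simp [omega]
@[simp] lemma omega_Ki (hq : 0 < q) : omega hq (Ki q) = K q := by simp [omega]
lemma omega_Em (hq : 0 < q) : omega hq (Em q) = (qhalf q)⁻¹ • (Ep q * Ki q) := by simp [omega]
@[simp] lemma omega_F (hq : 0 < q) : omega hq (F q) = Ep q := by
  rw [F, map_smul, map_mul, omega_Em, omega_Ki, smul_mul_assoc, smul_smul,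
    mul_inv_cancel₀ (qhalf_ne_zero hq), one_smul, mul_assoc, Ki_K, mul_one]

lemma omega_omega (hq : 0 < q) (g : Uq q) : omega hq (omega hq g) = g := by
  have : (omega hq).comp (omega hq) = AlgHom.id ℂ (Uq q) := by
    apply hom_ext
    · simp
    · rw [Em_eq hq]; simp
    · simp
    · simp
  exact DFunLike.congr_fun this g

lemma omega_Kpow (hq : 0 < q) (m : ℤ) : omega hq (Kpow q m) = Kpow q (-m) := by
  have : ∀ a b : ℕ, K q ^ a * Ki q ^ b = Ki q ^ b * K q ^ a := fun a b =>
    (Commute.pow_pow (show Commute (K q) (Ki q) from K_Ki.trans Ki_K.symm) a b)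
  rw [Kpow, Kpow, map_mul, map_pow, map_pow, omega_K, omega_Ki, neg_neg, this]

/-- The automorphism `omega` reverses the coproduct. -/
lemma comul_omega (hq : 0 < q) (g : Uq q) :
    Bialgebra.comulAlgHom ℂ (Uq q) (omega hq g)
      = Algebra.TensorProduct.map (omega hq) (omega hq)
          (Algebra.TensorProduct.comm ℂ (Uq q) (Uq q) (Bialgebra.comulAlgHom ℂ (Uq q) g)) := by
  have : (Bialgebra.comulAlgHom ℂ (Uq q)).comp (omega hq)
      = (Algebra.TensorProduct.map (omega hq) (omega hq)).comp
        ((Algebra.TensorProduct.comm ℂ (Uq q) (Uq q)).toAlgHom.comp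
          (Bialgebra.comulAlgHom ℂ (Uq q))) := by
    have h1 : Bialgebra.comulAlgHom ℂ (Uq q) (omega hq (Ep q))
        = Algebra.TensorProduct.map (omega hq) (omega hq)
          (Algebra.TensorProduct.comm ℂ (Uq q) (Uq q)
            (Bialgebra.comulAlgHom ℂ (Uq q) (Ep q))) := by
      rw [omega_Ep, comul_F, comul_Ep]; simp [add_comm]
    have h3 : Bialgebra.comulAlgHom ℂ (Uq q) (omega hq (K q))
        = Algebra.TensorProduct.map (omega hq) (omega hq)
          (Algebra.TensorProduct.comm ℂ (Uq q) (Uq q)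
            (Bialgebra.comulAlgHom ℂ (Uq q) (K q))) := by
      rw [omega_K, comul_Ki, comul_K]; simp
    have h4 : Bialgebra.comulAlgHom ℂ (Uq q) (omega hq (Ki q))
        = Algebra.TensorProduct.map (omega hq) (omega hq)
          (Algebra.TensorProduct.comm ℂ (Uq q) (Uq q)
            (Bialgebra.comulAlgHom ℂ (Uq q) (Ki q))) := by
      rw [omega_Ki, comul_Ki, comul_K]; simp
    have h5 : Bialgebra.comulAlgHom ℂ (Uq q) (omega hq (F q))
        = Algebra.TensorProduct.map (omega hq) (omega hq)
          (Algebra.TensorProduct.comm ℂ (Uq q) (Uq q)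
            (Bialgebra.comulAlgHom ℂ (Uq q) (F q))) := by
      rw [omega_F, comul_F, comul_Ep]; simp [add_comm]
    apply hom_ext
    · exact h1
    · rw [Em_eq hq]
      simp only [map_smul, map_mul]
      congr 1
      exact congrArg₂ _ h5 h3
    · exact h3
    · exact h4
  exact DFunLike.congr_fun this g

end Uq

/-! ### Represented R-matrices: intertwining property -/

/-- A complete system of orthogonal idempotents `P m`, `-L ≤ m ≤ L`, that projects to the spaces of
weight `m` in a representation `σ` of `U_q so(3)`. -/
structure IsWeights {q : ℝ} {X : Type*} [Ring X] [Algebra ℂ X] (σ : Uq q →ₐ[ℂ] X) (P : ℤ → X)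
    (L : ℕ) : Prop where
  mul_self : ∀ m, P m * P m = P m
  mul_ne : ∀ m n, m ≠ n → P m * P n = 0
  sum : ∑ m ∈ Finset.Icc (-(L : ℤ)) L, P m = 1
  act_K : ∀ m, σ (Uq.K q) * P m = (q : ℂ) ^ m • P m
  act_Ep : ∀ m, σ (Uq.Ep q) * P m = P (m + 1) * σ (Uq.Ep q)
  act_F : ∀ m, σ (F q) * P m = P (m - 1) * σ (F q)

/-- The diagonal part of the universal R-matrix, with its first leg represented. -/
def cartanPart {X : Type*} [Ring X] [Algebra ℂ X] (q : ℝ) (P : ℤ → X) (L : ℕ) : X ⊗[ℂ] Uq q :=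
  ∑ m ∈ Finset.Icc (-(L : ℤ)) L, P m ⊗ₜ[ℂ] Kpow q m

/-- The unipotent part of the universal R-matrix, with its first leg represented, truncated. -/
def unipotentPart {q : ℝ} {X : Type*} [Ring X] [Algebra ℂ X] (σ : Uq q →ₐ[ℂ] X) (T : ℕ) :
    X ⊗[ℂ] Uq q :=
  ∑ n ∈ Finset.range T, rCoeff q n • ((σ (Uq.Ep q) ^ n) ⊗ₜ[ℂ] (F q ^ n))

/-- The universal R-matrix with its first leg represented by `σ`. -/
def representedR {q : ℝ} {X : Type*} [Ring X] [Algebra ℂ X] (σ : Uq q →ₐ[ℂ] X) (P : ℤ → X)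
    (L : ℕ) : X ⊗[ℂ] Uq q :=
  cartanPart q P L * unipotentPart σ (2 * L + 1)

lemma representedR_eq {q : ℝ} {X : Type*} [Ring X] [Algebra ℂ X] (σ : Uq q →ₐ[ℂ] X) (P : ℤ → X)
    (L : ℕ) : representedR σ P L = ∑ m ∈ Finset.Icc (-(L : ℤ)) L, ∑ n ∈ Finset.range (2 * L + 1),
      rCoeff q n • ((P m * σ (Uq.Ep q) ^ n) ⊗ₜ[ℂ] (Kpow q m * F q ^ n)) := by
  rw [representedR, cartanPart, unipotentPart, Finset.sum_mul_sum]
  simp only [mul_smul_comm, Algebra.TensorProduct.tmul_mul_tmul]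

namespace IsWeights

variable {q : ℝ} {X : Type*} [Ring X] [Algebra ℂ X] {σ : Uq q →ₐ[ℂ] X} {P : ℤ → X} {L : ℕ}

lemma eq_zero (h : IsWeights σ P L) {m : ℤ} (hm : m ∉ Finset.Icc (-(L : ℤ)) L) : P m = 0 := by
  rw [← mul_one (P m), ← h.sum, Finset.mul_sum]
  refine Finset.sum_eq_zero fun n hn => h.mul_ne m n ?_
  rintro rfl
  exact hm hn

lemma Ep_pow (h : IsWeights σ P L) (n : ℕ) (m : ℤ) :
    σ (Uq.Ep q) ^ n * P m = P (m + n) * σ (Uq.Ep q) ^ n := by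
  induction n generalizing m with
  | zero => simp
  | succ n ih =>
    rw [pow_succ, mul_assoc, h.act_Ep, ← mul_assoc, ih, mul_assoc]
    congr 2
    push_cast
    ring

lemma Ep_nilpotent (h : IsWeights σ P L) {n : ℕ} (hn : 2 * L < n) : σ (Uq.Ep q) ^ n = 0 := by
  rw [← mul_one (σ (Uq.Ep q) ^ n), ← h.sum, Finset.mul_sum]
  refine Finset.sum_eq_zero fun m hm => ?_
  rw [Finset.mem_Icc] at hm
  rw [h.Ep_pow, h.eq_zero, zero_mul]
  rw [Finset.mem_Icc]
  omega

/-- The truncation of the unipotent part does not matter beyond the nilpotency order. -/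
lemma unipotentPart_eq (h : IsWeights σ P L) {T : ℕ} (hT : 2 * L + 1 ≤ T) :
    unipotentPart σ T = unipotentPart σ (2 * L + 1) := by
  refine (Finset.sum_subset (Finset.range_mono hT) fun n _ hn => ?_).symm
  rw [Finset.mem_range] at hn
  rw [h.Ep_nilpotent (by omega), TensorProduct.zero_tmul, smul_zero]

lemma Ki_mul (hq : 0 < q) (h : IsWeights σ P L) (m : ℤ) :
    σ (Uq.Ki q) * P m = (q : ℂ)⁻¹ ^ m • P m := by
  have hq0 : (q : ℂ) ≠ 0 := by exact_mod_cast hq.ne'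
  have e : σ (Uq.Ki q) * (σ (Uq.K q) * P m) = P m := by
    rw [← mul_assoc, ← map_mul, Uq.Ki_K, map_one, one_mul]
  rw [h.act_K, mul_smul_comm] at e
  nth_rewrite 2 [← e]
  rw [smul_smul, inv_zpow, inv_mul_cancel₀ (zpow_ne_zero m hq0), one_smul]

/-- Two elements agree if they agree on all weight spaces. -/
lemma ext_weights (h : IsWeights σ P L) {z z' : X ⊗[ℂ] Uq q}
    (hz : ∀ m, z * (P m ⊗ₜ 1) = z' * (P m ⊗ₜ 1)) : z = z' := by
  have e : ∑ m ∈ Finset.Icc (-(L : ℤ)) L, P m ⊗ₜ[ℂ] (1 : Uq q) = 1 := by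
    rw [← TensorProduct.sum_tmul, h.sum, Algebra.TensorProduct.one_def]
  rw [← mul_one z, ← mul_one z', ← e, Finset.mul_sum, Finset.mul_sum]
  exact Finset.sum_congr rfl fun m _ => hz m

lemma cartan_mul_weight (h : IsWeights σ P L) (m : ℤ) :
    cartanPart q P L * (P m ⊗ₜ 1) = P m ⊗ₜ Kpow q m := by
  rw [cartanPart, Finset.sum_mul]
  by_cases hm : m ∈ Finset.Icc (-(L : ℤ)) L
  · rw [Finset.sum_eq_single m]
    · rw [Algebra.TensorProduct.tmul_mul_tmul, h.mul_self, mul_one]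
    · intro n _ hn
      rw [Algebra.TensorProduct.tmul_mul_tmul, h.mul_ne n m hn, TensorProduct.zero_tmul]
    · intro h'
      exact absurd hm h'
  · rw [h.eq_zero hm]
    simp

lemma cartan_Ep (h : IsWeights σ P L) :
    cartanPart q P L * (σ (Uq.Ep q) ⊗ₜ 1) = (σ (Uq.Ep q) ⊗ₜ Uq.K q) * cartanPart q P L := by
  refine h.ext_weights fun m => ?_
  rw [mul_assoc, mul_assoc, h.cartan_mul_weight, Algebra.TensorProduct.tmul_mul_tmul, h.act_Ep,
    Algebra.TensorProduct.tmul_mul_tmul, h.act_Ep, ← Uq.Kpow_one, ← Uq.Kpow_add, mul_one,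
    ← one_mul (1 : Uq q), ← Algebra.TensorProduct.tmul_mul_tmul, ← mul_assoc, h.cartan_mul_weight,
    Algebra.TensorProduct.tmul_mul_tmul, mul_one, add_comm m]

lemma cartan_F (h : IsWeights σ P L) :
    cartanPart q P L * (σ (F q) ⊗ₜ 1) = (σ (F q) ⊗ₜ Uq.Ki q) * cartanPart q P L := by
  refine h.ext_weights fun m => ?_
  rw [mul_assoc, mul_assoc, h.cartan_mul_weight, Algebra.TensorProduct.tmul_mul_tmul, h.act_F,
    Algebra.TensorProduct.tmul_mul_tmul, h.act_F, ← Uq.Kpow_neg_one, ← Uq.Kpow_add, mul_one,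
    ← one_mul (1 : Uq q), ← Algebra.TensorProduct.tmul_mul_tmul, ← mul_assoc, h.cartan_mul_weight,
    Algebra.TensorProduct.tmul_mul_tmul, mul_one, sub_eq_neg_add]

lemma cartan_right_Ep (hq : 0 < q) (h : IsWeights σ P L) :
    cartanPart q P L * (1 ⊗ₜ Uq.Ep q) = (σ (Uq.K q) ⊗ₜ Uq.Ep q) * cartanPart q P L := by
  refine h.ext_weights fun m => ?_
  rw [mul_assoc, mul_assoc, h.cartan_mul_weight, Algebra.TensorProduct.tmul_mul_tmul, one_mul,
    mul_one, ← mul_one (P m), ← one_mul (Uq.Ep q), ← Algebra.TensorProduct.tmul_mul_tmul,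
    ← mul_assoc,
    h.cartan_mul_weight, Algebra.TensorProduct.tmul_mul_tmul, one_mul, mul_one,
    Algebra.TensorProduct.tmul_mul_tmul, h.act_K, Uq.Kpow_mul_Ep hq, TensorProduct.tmul_smul,
    TensorProduct.smul_tmul']

lemma cartan_right_F (hq : 0 < q) (h : IsWeights σ P L) :
    cartanPart q P L * (1 ⊗ₜ F q) = (σ (Uq.Ki q) ⊗ₜ F q) * cartanPart q P L := by
  refine h.ext_weights fun m => ?_
  rw [mul_assoc, mul_assoc, h.cartan_mul_weight, Algebra.TensorProduct.tmul_mul_tmul, one_mul,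
    mul_one, ← mul_one (P m), ← one_mul (F q), ← Algebra.TensorProduct.tmul_mul_tmul, ← mul_assoc,
    h.cartan_mul_weight, Algebra.TensorProduct.tmul_mul_tmul, one_mul, mul_one,
    Algebra.TensorProduct.tmul_mul_tmul, h.Ki_mul hq, Uq.Kpow_mul_F hq, TensorProduct.tmul_smul,
    TensorProduct.smul_tmul']

lemma commute_K (h : IsWeights σ P L) (m : ℤ) : Commute (σ (Uq.K q)) (P m) := by
  have e : σ (Uq.K q) = ∑ n ∈ Finset.Icc (-(L : ℤ)) L, (q : ℂ) ^ n • P n := by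
    rw [← mul_one (σ (Uq.K q)), ← h.sum, Finset.mul_sum]
    exact Finset.sum_congr rfl fun n _ => h.act_K n
  rw [e]
  refine Commute.sum_left _ _ _ fun n _ => Commute.smul_left ?_ _
  by_cases hnm : n = m
  · rw [hnm]
  · rw [Commute, SemiconjBy, h.mul_ne n m hnm, h.mul_ne m n (Ne.symm hnm)]

lemma Kpow_commute_K (m : ℤ) : Commute (Uq.K q) (Kpow q m) := by
  rw [Commute, SemiconjBy, ← Uq.Kpow_one, ← Uq.Kpow_add, ← Uq.Kpow_add, add_comm]

lemma cartan_K (h : IsWeights σ P L) :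
    cartanPart q P L * (σ (Uq.K q) ⊗ₜ Uq.K q) = (σ (Uq.K q) ⊗ₜ Uq.K q) * cartanPart q P L := by
  rw [cartanPart, Finset.sum_mul, Finset.mul_sum]
  refine Finset.sum_congr rfl fun m _ => ?_
  rw [Algebra.TensorProduct.tmul_mul_tmul, Algebra.TensorProduct.tmul_mul_tmul, (h.commute_K m).eq,
    (Kpow_commute_K m).eq]

lemma cartan_left_K (h : IsWeights σ P L) :
    cartanPart q P L * (σ (Uq.K q) ⊗ₜ 1) = (σ (Uq.K q) ⊗ₜ 1) * cartanPart q P L := by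
  rw [cartanPart, Finset.sum_mul, Finset.mul_sum]
  refine Finset.sum_congr rfl fun m _ => ?_
  rw [Algebra.TensorProduct.tmul_mul_tmul, Algebra.TensorProduct.tmul_mul_tmul, (h.commute_K m).eq,
    one_mul, mul_one]

lemma cartan_right_Ki (P : ℤ → X) (L : ℕ) :
    cartanPart q P L * (1 ⊗ₜ Uq.Ki q) = (1 ⊗ₜ Uq.Ki q) * cartanPart q P L := by
  rw [cartanPart, Finset.sum_mul, Finset.mul_sum]
  refine Finset.sum_congr rfl fun m _ => ?_
  rw [Algebra.TensorProduct.tmul_mul_tmul, Algebra.TensorProduct.tmul_mul_tmul, one_mul, mul_one,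
    ← Uq.Kpow_neg_one, ← Uq.Kpow_add, ← Uq.Kpow_add, add_comm]

lemma cartan_Ep_Ki (h : IsWeights σ P L) :
    cartanPart q P L * (σ (Uq.Ep q) ⊗ₜ Uq.Ki q) = (σ (Uq.Ep q) ⊗ₜ 1) * cartanPart q P L := by
  have e : ∀ u : Uq q, σ (Uq.Ep q) ⊗ₜ[ℂ] (u * Uq.Ki q)
      = (σ (Uq.Ep q) ⊗ₜ u) * ((1 : X) ⊗ₜ Uq.Ki q) := fun u => by simp
  rw [← one_mul (Uq.Ki q), e, ← mul_assoc, h.cartan_Ep, mul_assoc, cartan_right_Ki, ← mul_assoc,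
    ← e,
    Uq.K_Ki]

lemma cartan_K_F (hq : 0 < q) (h : IsWeights σ P L) :
    cartanPart q P L * (σ (Uq.K q) ⊗ₜ F q) = (1 ⊗ₜ F q) * cartanPart q P L := by
  have e : σ (Uq.K q) ⊗ₜ[ℂ] F q = (σ (Uq.K q) ⊗ₜ 1) * ((1 : X) ⊗ₜ F q) := by simp
  rw [e, ← mul_assoc, h.cartan_left_K, mul_assoc, h.cartan_right_F hq, ← mul_assoc,
    Algebra.TensorProduct.tmul_mul_tmul, ← map_mul, Uq.K_Ki, map_one, one_mul]

lemma unipotent_K (hq : 0 < q) (T : ℕ) :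
    unipotentPart σ T * (σ (Uq.K q) ⊗ₜ Uq.K q) = (σ (Uq.K q) ⊗ₜ Uq.K q) * unipotentPart σ T := by
  have hq0 : (q : ℂ) ≠ 0 := by exact_mod_cast hq.ne'
  have e : (σ (Uq.Ep q) ⊗ₜ[ℂ] F q) * (σ (Uq.K q) ⊗ₜ Uq.K q)
      = (σ (Uq.K q) ⊗ₜ Uq.K q) * (σ (Uq.Ep q) ⊗ₜ[ℂ] F q) := by
    rw [Algebra.TensorProduct.tmul_mul_tmul, Algebra.TensorProduct.tmul_mul_tmul, ← map_mul,
      ← map_mul, Uq.Ep_K hq, Uq.K_F hq, map_smul, TensorProduct.tmul_smul, TensorProduct.smul_tmul']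
  rw [unipotentPart, Finset.sum_mul, Finset.mul_sum]
  refine Finset.sum_congr rfl fun n _ => ?_
  rw [← Algebra.TensorProduct.tmul_pow, smul_mul_assoc, mul_smul_comm]
  congr 1
  exact Commute.pow_left e n

lemma q_scalar (hq : 0 < q) (hq1 : q ≠ 1) :
    (qhalf q - (qhalf q)⁻¹) ^ 2 * (qhalf q)⁻¹ * (qhalf q - (qhalf q)⁻¹)⁻¹ = 1 - (q : ℂ)⁻¹ := by
  have hv := qhalf_ne_zero hq
  have hv1 := qhalf_sub_inv_ne_zero hq hq1
  rw [sq, mul_assoc, mul_assoc, mul_comm (qhalf q)⁻¹, ← mul_assoc _ _ (qhalf q)⁻¹,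
    mul_inv_cancel₀ hv1, one_mul, sub_mul, mul_inv_cancel₀ hv, ← qhalf_sq hq, sq, mul_inv]

lemma unipotent_Ep (hq : 0 < q) (hq1 : q ≠ 1) (h : IsWeights σ P L) :
    unipotentPart σ (2 * L + 1) * (σ (Uq.Ep q) ⊗ₜ Uq.K q + 1 ⊗ₜ Uq.Ep q)
      = (1 ⊗ₜ Uq.Ep q + σ (Uq.Ep q) ⊗ₜ Uq.Ki q) * unipotentPart σ (2 * L + 1) := by
  have hcomm := fun n => (isQExp_rCoeff hq hq1).commutator (q_scalar hq hq1) (Uq.K_F hq)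
    (Uq.F_Ki hq) (Uq.Ep_F hq) n
  set e := σ (Uq.Ep q) with he
  have key : ∑ n ∈ Finset.range (2 * L + 1 + 1),
      (e ^ n) ⊗ₜ[ℂ] (rCoeff q n • (Uq.Ep q * F q ^ n - F q ^ n * Uq.Ep q))
      = ∑ n ∈ Finset.range (2 * L + 1),
        (e ^ (n + 1)) ⊗ₜ[ℂ] (rCoeff q n • (F q ^ n * Uq.K q - Uq.Ki q * F q ^ n)) := by
    rw [Finset.sum_range_succ']
    simp only [hcomm]
    simp
  rw [Finset.sum_range_succ, he, h.Ep_nilpotent (by omega : 2 * L < 2 * L + 1), ← he,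
    TensorProduct.zero_tmul, add_zero] at key
  rw [unipotentPart, ← he]
  simp only [Finset.sum_mul, Finset.mul_sum, mul_add, add_mul, smul_mul_assoc, mul_smul_comm,
    Algebra.TensorProduct.tmul_mul_tmul, one_mul, mul_one, ← pow_succ, ← pow_succ', smul_add,
    Finset.sum_add_distrib]
  simp only [TensorProduct.tmul_smul, TensorProduct.tmul_sub, smul_sub, Finset.sum_sub_distrib]
    at key
  rw [sub_eq_sub_iff_add_eq_add] at key
  exact key.symm

lemma unipotent_F (hq : 0 < q) (hq1 : q ≠ 1) (h : IsWeights σ P L) :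
    unipotentPart σ (2 * L + 1) * (σ (F q) ⊗ₜ 1 + σ (Uq.Ki q) ⊗ₜ F q)
      = (σ (Uq.K q) ⊗ₜ F q + σ (F q) ⊗ₜ 1) * unipotentPart σ (2 * L + 1) := by
  have hcomm := fun n => (isQExp_rCoeff hq hq1).commutator (q_scalar hq hq1) (Uq.Ki_Ep hq)
    (Uq.Ep_K hq) (by rw [← neg_sub, Uq.Ep_F hq, ← smul_neg, neg_sub]) n
  have hσ := fun n => congrArg σ (hcomm n)
  simp only [map_smul, map_sub, map_mul, map_pow] at hσ
  set e := σ (Uq.Ep q) with he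
  set f := σ (F q) with hf
  have key : ∑ n ∈ Finset.range (2 * L + 1 + 1),
      (rCoeff q n • (f * e ^ n - e ^ n * f)) ⊗ₜ[ℂ] (F q ^ n)
      = ∑ n ∈ Finset.range (2 * L + 1),
        (rCoeff q n • (e ^ n * σ (Uq.Ki q) - σ (Uq.K q) * e ^ n)) ⊗ₜ[ℂ] (F q ^ (n + 1)) := by
    rw [Finset.sum_range_succ']
    simp only [hσ]
    simp
  rw [Finset.sum_range_succ, he, h.Ep_nilpotent (by omega : 2 * L < 2 * L + 1), ← he, mul_zero,
    zero_mul, sub_zero, smul_zero, TensorProduct.zero_tmul, add_zero] at key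
  rw [unipotentPart, ← he]
  simp only [Finset.sum_mul, Finset.mul_sum, mul_add, add_mul, smul_mul_assoc, mul_smul_comm,
    Algebra.TensorProduct.tmul_mul_tmul, one_mul, mul_one, ← pow_succ, ← pow_succ', smul_add,
    Finset.sum_add_distrib]
  simp only [← TensorProduct.smul_tmul', TensorProduct.sub_tmul, smul_sub, Finset.sum_sub_distrib]
    at key
  rw [sub_eq_sub_iff_add_eq_add] at key
  rw [add_comm, ← key]
  exact add_comm _ _

/-- The represented R-matrix intertwines the coproduct with the opposite coproduct. -/
lemma intertwine (hq : 0 < q) (hq1 : q ≠ 1) (h : IsWeights σ P L) (g : Uq q) :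
    representedR σ P L * Algebra.TensorProduct.map σ (AlgHom.id ℂ (Uq q))
        (Bialgebra.comulAlgHom ℂ (Uq q) g)
      = Algebra.TensorProduct.map σ (AlgHom.id ℂ (Uq q))
          (Algebra.TensorProduct.comm ℂ (Uq q) (Uq q) (Bialgebra.comulAlgHom ℂ (Uq q) g))
        * representedR σ P L := by
  let A : Uq q →ₐ[ℂ] X ⊗[ℂ] Uq q :=
    (Algebra.TensorProduct.map σ (AlgHom.id ℂ (Uq q))).comp (Bialgebra.comulAlgHom ℂ (Uq q))
  let B : Uq q →ₐ[ℂ] X ⊗[ℂ] Uq q :=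
    (Algebra.TensorProduct.map σ (AlgHom.id ℂ (Uq q))).comp
      ((Algebra.TensorProduct.comm ℂ (Uq q) (Uq q)).toAlgHom.comp (Bialgebra.comulAlgHom ℂ (Uq q)))
  change representedR σ P L * A g = B g * representedR σ P L
  have hmul : ∀ a b, representedR σ P L * A a = B a * representedR σ P L →
      representedR σ P L * A b = B b * representedR σ P L →
      representedR σ P L * A (a * b) = B (a * b) * representedR σ P L := fun a b ha hb => by
    rw [map_mul, ← mul_assoc, ha, mul_assoc, hb, ← mul_assoc, map_mul]
  have hK : representedR σ P L * A (Uq.K q) = B (Uq.K q) * representedR σ P L := by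
    have eA : A (Uq.K q) = σ (Uq.K q) ⊗ₜ Uq.K q := by
      simp only [A, AlgHom.comp_apply, Uq.comul_K]; rfl
    have eB : B (Uq.K q) = σ (Uq.K q) ⊗ₜ Uq.K q := by
      simp only [B, AlgHom.comp_apply, Uq.comul_K]; rfl
    rw [eA, eB, representedR, mul_assoc, unipotent_K hq, ← mul_assoc, h.cartan_K, mul_assoc]
  have hE : representedR σ P L * A (Uq.Ep q) = B (Uq.Ep q) * representedR σ P L := by
    have eA : A (Uq.Ep q) = σ (Uq.Ep q) ⊗ₜ Uq.K q + 1 ⊗ₜ Uq.Ep q := by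
      simp only [A, AlgHom.comp_apply, Uq.comul_Ep]; simp
    have eB : B (Uq.Ep q) = σ (Uq.K q) ⊗ₜ Uq.Ep q + σ (Uq.Ep q) ⊗ₜ 1 := by
      simp only [B, AlgHom.comp_apply, Uq.comul_Ep]; simp
    rw [eA, eB, representedR, mul_assoc, h.unipotent_Ep hq hq1, ← mul_assoc, mul_add,
      h.cartan_right_Ep hq, h.cartan_Ep_Ki, ← add_mul, mul_assoc]
  have hF : representedR σ P L * A (F q) = B (F q) * representedR σ P L := by
    have eA : A (F q) = σ (F q) ⊗ₜ 1 + σ (Uq.Ki q) ⊗ₜ F q := by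
      simp only [A, AlgHom.comp_apply, Uq.comul_F]; simp
    have eB : B (F q) = 1 ⊗ₜ F q + σ (F q) ⊗ₜ Uq.Ki q := by
      simp only [B, AlgHom.comp_apply, Uq.comul_F]; simp
    rw [eA, eB, representedR, mul_assoc, h.unipotent_F hq hq1, ← mul_assoc, mul_add,
      h.cartan_F, h.cartan_K_F hq, ← add_mul, mul_assoc]
  have hKi : representedR σ P L * A (Uq.Ki q) = B (Uq.Ki q) * representedR σ P L := by
    have a1 : A (Uq.K q) * A (Uq.Ki q) = 1 := by rw [← map_mul, Uq.K_Ki, map_one]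
    have b1 : B (Uq.Ki q) * B (Uq.K q) = 1 := by rw [← map_mul, Uq.Ki_K, map_one]
    calc representedR σ P L * A (Uq.Ki q)
        = B (Uq.Ki q) * (B (Uq.K q) * representedR σ P L) * A (Uq.Ki q) := by
          rw [← mul_assoc, b1, one_mul]
      _ = B (Uq.Ki q) * representedR σ P L * (A (Uq.K q) * A (Uq.Ki q)) := by
          rw [← hK]; simp only [mul_assoc]
      _ = _ := by rw [a1, mul_one]
  induction g using Uq.induction with
  | hs c => rw [AlgHom.commutes, AlgHom.commutes]; exact (Algebra.commutes c _).symm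
  | h1 => exact hE
  | h2 =>
    rw [Uq.Em_eq hq, map_smul, map_smul, mul_smul_comm, smul_mul_assoc, hmul _ _ hF hK]
  | h3 => exact hK
  | h4 => exact hKi
  | ha a b ha hb => rw [map_add, map_add, mul_add, add_mul, ha, hb]
  | hm a b ha hb => exact hmul a b ha hb

end IsWeights

/-! ### Represented R-matrices: coproduct and multiplicativity -/

namespace IsWeights

section coaction

variable {q : ℝ} {X : Type*} [Ring X] [Algebra ℂ X] {σ : Uq q →ₐ[ℂ] X} {P : ℤ → X} {L : ℕ}

lemma cartan_coaction (h : IsWeights σ P L) :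
    Algebra.TensorProduct.map (AlgHom.id ℂ X) (Bialgebra.comulAlgHom ℂ (Uq q)) (cartanPart q P L)
      = Algebra.TensorProduct.map (AlgHom.id ℂ X)
          (Algebra.TensorProduct.includeRight : Uq q →ₐ[ℂ] Uq q ⊗[ℂ] Uq q) (cartanPart q P L)
        * Algebra.TensorProduct.map (AlgHom.id ℂ X)
          (Algebra.TensorProduct.includeLeft : Uq q →ₐ[ℂ] Uq q ⊗[ℂ] Uq q) (cartanPart q P L) := by
  simp only [cartanPart, map_sum, Algebra.TensorProduct.map_tmul, AlgHom.id_apply, Uq.comul_Kpow,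
    Finset.sum_mul_sum, Algebra.TensorProduct.tmul_mul_tmul,
    Algebra.TensorProduct.includeRight_apply, Algebra.TensorProduct.includeLeft_apply, one_mul,
    mul_one]
  refine Finset.sum_congr rfl fun m hm => ?_
  rw [Finset.sum_eq_single m, h.mul_self]
  · intro n _ hn
    rw [h.mul_ne m n hn.symm, TensorProduct.zero_tmul]
  · exact fun h' => absurd hm h'

/-- The coproduct of the second leg of the represented R-matrix. -/
lemma coaction (hq : 0 < q) (hq1 : q ≠ 1) (h : IsWeights σ P L) :
    Algebra.TensorProduct.map (AlgHom.id ℂ X) (Bialgebra.comulAlgHom ℂ (Uq q))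
        (representedR σ P L)
      = Algebra.TensorProduct.map (AlgHom.id ℂ X)
          (Algebra.TensorProduct.includeRight : Uq q →ₐ[ℂ] Uq q ⊗[ℂ] Uq q) (representedR σ P L)
        * Algebra.TensorProduct.map (AlgHom.id ℂ X)
          (Algebra.TensorProduct.includeLeft : Uq q →ₐ[ℂ] Uq q ⊗[ℂ] Uq q)
          (representedR σ P L) := by
  set i12 := Algebra.TensorProduct.map (AlgHom.id ℂ X)
    (Algebra.TensorProduct.includeLeft : Uq q →ₐ[ℂ] Uq q ⊗[ℂ] Uq q) with h12
  set i13 := Algebra.TensorProduct.map (AlgHom.id ℂ X)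
    (Algebra.TensorProduct.includeRight : Uq q →ₐ[ℂ] Uq q ⊗[ℂ] Uq q) with h13
  have e12 : ∀ x u, i12 (x ⊗ₜ u) = x ⊗ₜ (u ⊗ₜ 1) := fun x u => rfl
  have e13 : ∀ x u, i13 (x ⊗ₜ u) = x ⊗ₜ (1 ⊗ₜ u) := fun x u => rfl
  set T := 2 * L + 1 with hT
  set e := σ (Uq.Ep q) with he
  -- `Θ'` is the unipotent part with `K⁻¹ ⊗ F` in place of `F`, as it arises from the coproduct of
  -- `F` and the addition theorem; the diagonal part removes the factor `K⁻¹`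
  let Y : Uq q ⊗[ℂ] Uq q := Uq.Ki q ⊗ₜ F q
  let Θ' : X ⊗[ℂ] (Uq q ⊗[ℂ] Uq q) := ∑ k ∈ Finset.range T, rCoeff q k • ((e ^ k) ⊗ₜ[ℂ] (Y ^ k))
  have hΘ : Algebra.TensorProduct.map (AlgHom.id ℂ X) (Bialgebra.comulAlgHom ℂ (Uq q))
      (unipotentPart σ T) = Θ' * i12 (unipotentPart σ T) := by
    have hYZ : (F q ⊗ₜ[ℂ] (1 : Uq q)) * Y = (q : ℂ)⁻¹ • (Y * (F q ⊗ₜ[ℂ] (1 : Uq q))) := by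
      simp only [Y, Algebra.TensorProduct.tmul_mul_tmul, Uq.F_Ki hq, one_mul, mul_one,
        TensorProduct.smul_tmul']
    have hadd := (isQExp_rCoeff hq hq1).add hYZ
    have hterm : ∀ n, Algebra.TensorProduct.map (AlgHom.id ℂ X) (Bialgebra.comulAlgHom ℂ (Uq q))
        (rCoeff q n • ((e ^ n) ⊗ₜ[ℂ] (F q ^ n)))
        = ∑ x ∈ Finset.HasAntidiagonal.antidiagonal n, (rCoeff q x.1 * rCoeff q x.2) •
          ((e ^ (x.1 + x.2)) ⊗ₜ[ℂ] (Y ^ x.1 * (F q ⊗ₜ[ℂ] (1 : Uq q)) ^ x.2)) := by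
      intro n
      rw [map_smul, Algebra.TensorProduct.map_tmul, map_pow (Bialgebra.comulAlgHom ℂ (Uq q)),
        Uq.comul_F,
        AlgHom.id_apply,
        ← TensorProduct.tmul_smul, add_comm, hadd, TensorProduct.tmul_sum]
      refine Finset.sum_congr rfl fun x hx => ?_
      rw [TensorProduct.tmul_smul, Finset.HasAntidiagonal.mem_antidiagonal.mp hx]
    rw [unipotentPart, map_sum, Finset.sum_congr rfl fun n _ => hterm n,
      sum_range_antidiagonal T fun k l => (rCoeff q k * rCoeff q l) •
          ((e ^ (k + l)) ⊗ₜ[ℂ] (Y ^ k * (F q ⊗ₜ[ℂ] (1 : Uq q)) ^ l))]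
    · rw [map_sum, Finset.sum_mul_sum]
      refine Finset.sum_congr rfl fun k _ => Finset.sum_congr rfl fun l _ => ?_
      have hl : (F q ⊗ₜ[ℂ] (1 : Uq q)) ^ l = (F q ^ l) ⊗ₜ 1 := by
        rw [Algebra.TensorProduct.tmul_pow, one_pow]
      rw [map_smul, e12, smul_mul_smul_comm, Algebra.TensorProduct.tmul_mul_tmul, pow_add, hl]
    · intro k l hkl
      rw [he, h.Ep_nilpotent (by omega), TensorProduct.zero_tmul, smul_zero]
  have hD : i12 (cartanPart q P L) * Θ' = i13 (unipotentPart σ T) * i12 (cartanPart q P L) := by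
    have hs : SemiconjBy (i12 (cartanPart q P L)) (e ⊗ₜ Y) (e ⊗ₜ ((1 : Uq q) ⊗ₜ[ℂ] F q)) := by
      have a1 : e ⊗ₜ[ℂ] Y = i12 (e ⊗ₜ Uq.Ki q) * i13 (1 ⊗ₜ F q) := by
        rw [e12, e13, Algebra.TensorProduct.tmul_mul_tmul, Algebra.TensorProduct.tmul_mul_tmul]
        simp [Y]
      have a2 : e ⊗ₜ[ℂ] ((1 : Uq q) ⊗ₜ[ℂ] F q) = i12 (e ⊗ₜ 1) * i13 (1 ⊗ₜ F q) := by
        rw [e12, e13, Algebra.TensorProduct.tmul_mul_tmul, Algebra.TensorProduct.tmul_mul_tmul]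
        simp
      have a3 : i12 (cartanPart q P L) * i13 (1 ⊗ₜ F q)
          = i13 (1 ⊗ₜ F q) * i12 (cartanPart q P L) := by
        rw [cartanPart, map_sum, Finset.sum_mul, Finset.mul_sum]
        refine Finset.sum_congr rfl fun m _ => ?_
        rw [e12, e13]
        simp only [Algebra.TensorProduct.tmul_mul_tmul, one_mul, mul_one]
      rw [SemiconjBy, a1, a2, ← mul_assoc, ← map_mul, h.cartan_Ep_Ki, map_mul, mul_assoc, a3,
        mul_assoc]
    rw [unipotentPart, map_sum, Finset.mul_sum, Finset.sum_mul]
    refine Finset.sum_congr rfl fun k _ => ?_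
    have := (hs.pow_right k).eq
    have t1 : (e ⊗ₜ[ℂ] Y) ^ k = (e ^ k) ⊗ₜ (Y ^ k) := Algebra.TensorProduct.tmul_pow ..
    have t2 : (e ⊗ₜ[ℂ] ((1 : Uq q) ⊗ₜ[ℂ] F q)) ^ k = (e ^ k) ⊗ₜ ((1 : Uq q) ⊗ₜ[ℂ] (F q ^ k)) := by
      rw [Algebra.TensorProduct.tmul_pow, Algebra.TensorProduct.tmul_pow, one_pow]
    rw [t1, t2] at this
    rw [mul_smul_comm, this, map_smul, e13, smul_mul_assoc]
  rw [representedR, map_mul, map_mul, map_mul, hΘ, h.cartan_coaction, ← h12, ← h13, mul_assoc,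
    ← mul_assoc (i12 _) Θ', hD]
  simp only [mul_assoc, hT]

lemma isUnit_cartanPart (h : IsWeights σ P L) : IsUnit (cartanPart q P L) := by
  have key : ∀ f g : ℤ → Uq q, (∀ m, f m * g m = 1) →
      (∑ m ∈ Finset.Icc (-(L : ℤ)) L, P m ⊗ₜ[ℂ] f m)
        * (∑ m ∈ Finset.Icc (-(L : ℤ)) L, P m ⊗ₜ[ℂ] g m) = 1 := by
    intro f g hfg
    rw [Finset.sum_mul_sum, Algebra.TensorProduct.one_def, ← h.sum, TensorProduct.sum_tmul]
    refine Finset.sum_congr rfl fun m hm => ?_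
    rw [Finset.sum_eq_single m, Algebra.TensorProduct.tmul_mul_tmul, h.mul_self, hfg]
    · intro n _ hn
      rw [Algebra.TensorProduct.tmul_mul_tmul, h.mul_ne m n hn.symm, TensorProduct.zero_tmul]
    · exact fun h' => absurd hm h'
  refine ⟨⟨_, ∑ m ∈ Finset.Icc (-(L : ℤ)) L, P m ⊗ₜ[ℂ] Kpow q (-m), ?_, ?_⟩, rfl⟩
  · exact key _ _ fun m => by rw [← Uq.Kpow_add, add_neg_cancel, Uq.Kpow_zero]
  · exact key _ _ fun m => by rw [← Uq.Kpow_add, neg_add_cancel, Uq.Kpow_zero]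

lemma isUnit_unipotentPart (h : IsWeights σ P L) : IsUnit (unipotentPart σ (2 * L + 1)) := by
  set x := σ (Uq.Ep q) ⊗ₜ[ℂ] F q with hx
  have e : unipotentPart σ (2 * L + 1)
      = 1 + x * ∑ n ∈ Finset.range (2 * L), rCoeff q (n + 1) • x ^ n := by
    rw [unipotentPart, Finset.sum_range_succ', Finset.mul_sum, add_comm]
    congr 1
    · simp [rCoeff, qfact, Algebra.TensorProduct.one_def]
    · refine Finset.sum_congr rfl fun n _ => ?_
      rw [mul_smul_comm, ← pow_succ', hx, Algebra.TensorProduct.tmul_pow]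
  rw [e]
  refine IsNilpotent.isUnit_one_add (Commute.isNilpotent_mul_right ?_ ⟨2 * L + 1, ?_⟩)
  · exact Commute.sum_right _ _ _ fun n _ => ((Commute.refl x).pow_right n).smul_right _
  · rw [hx, Algebra.TensorProduct.tmul_pow, h.Ep_nilpotent (by omega), TensorProduct.zero_tmul]

lemma isUnit_representedR (h : IsWeights σ P L) : IsUnit (representedR σ P L) :=
  h.isUnit_cartanPart.mul h.isUnit_unipotentPart

end coaction

section evalLeg

variable {q : ℝ} {A : Type*} [Ring A] [Algebra ℂ A] {σ : Uq q →ₐ[ℂ] Module.End ℂ A}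
  {P : ℤ → Module.End ℂ A} {L : ℕ}

lemma evalLeg_cartan (h : IsWeights σ P L) {m : ℤ} {a : A} (ha : P m a = a) :
    evalLeg a (cartanPart q P L) = a ⊗ₜ[ℂ] Kpow q m := by
  have := congrArg (evalLeg a) (h.cartan_mul_weight m)
  rw [← legAct_evalLeg, evalLeg_tmul, evalLeg_tmul, ha, legAct_tmul_one] at this
  exact this

/-- The value of the represented R-matrix on a vector; the range of summation can be any beyond the
nilpotency order. -/
lemma evalLeg_representedR (h : IsWeights σ P L) {T : ℕ} (hT : 2 * L + 1 ≤ T) (a : A) :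
    evalLeg a (representedR σ P L) = ∑ n ∈ Finset.range T, rCoeff q n •
      (evalLeg ((σ (Uq.Ep q) ^ n) a) (cartanPart q P L) * (1 ⊗ₜ (F q ^ n))) := by
  rw [representedR, ← h.unipotentPart_eq hT, ← legAct_evalLeg, unipotentPart, map_sum, map_sum]
  refine Finset.sum_congr rfl fun n _ => ?_
  rw [map_smul, map_smul, evalLeg_tmul, legAct_apply_tmul]

lemma evalLeg_one_representedR (h : IsWeights σ P L) {o : A} (hE : σ (Uq.Ep q) o = 0)
    (hP : P 0 o = o) : evalLeg o (representedR σ P L) = o ⊗ₜ 1 := by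
  rw [h.evalLeg_representedR le_rfl, Finset.sum_eq_single 0]
  · rw [pow_zero, pow_zero, Module.End.one_apply, h.evalLeg_cartan hP, Uq.Kpow_zero]
    simp [rCoeff, qfact]
  · intro n _ hn
    obtain ⟨k, rfl⟩ := Nat.exists_eq_succ_of_ne_zero hn
    rw [pow_succ, Module.End.mul_apply, hE]
    simp [evalLeg]
  · simp

/-- The action of a term of the q-exponential series of `E⁺` on a product. -/
lemma rCoeff_smul_pow_apply (hq : 0 < q) (hq1 : q ≠ 1) (μ : A →ₗ[ℂ] A →ₗ[ℂ] A)
    (hμE : ∀ a b, σ (Uq.Ep q) (μ a b)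
      = μ (σ (Uq.Ep q) a) (σ (Uq.K q) b) + μ a (σ (Uq.Ep q) b)) (n : ℕ) (a b : A) :
    rCoeff q n • (σ (Uq.Ep q) ^ n) (μ a b)
      = ∑ x ∈ Finset.HasAntidiagonal.antidiagonal n, (rCoeff q x.1 * rCoeff q x.2) •
        μ ((σ (Uq.Ep q) ^ x.1) a) ((σ (Uq.K q) ^ x.1) ((σ (Uq.Ep q) ^ x.2) b)) := by
  set e := σ (Uq.Ep q) with he
  set k := σ (Uq.K q) with hk
  let Y : Module.End ℂ (A ⊗[ℂ] A) := TensorProduct.map e k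
  let Z : Module.End ℂ (A ⊗[ℂ] A) := TensorProduct.map 1 e
  have hek : e * k = (q : ℂ)⁻¹ • (k * e) := by
    rw [he, hk, ← map_mul, Uq.Ep_K hq, map_smul, map_mul]
  have hZY : Z * Y = (q : ℂ)⁻¹ • (Y * Z) := by
    change TensorProduct.map 1 e * TensorProduct.map e k
      = (q : ℂ)⁻¹ • (TensorProduct.map e k * TensorProduct.map 1 e)
    rw [← TensorProduct.map_mul, ← TensorProduct.map_mul, hek, TensorProduct.map_smul_right,
      one_mul, mul_one]
  have hpow : ∀ n t, (e ^ n) (TensorProduct.lift μ t) = TensorProduct.lift μ (((Y + Z) ^ n) t) := by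
    intro n
    induction n with
    | zero => simp
    | succ n ih =>
      intro t
      have h1 : e (TensorProduct.lift μ t) = TensorProduct.lift μ ((Y + Z) t) := by
        induction t with
        | zero => simp
        | add x y hx hy => simp only [map_add, hx, hy]
        | tmul a b => simp [Y, Z, hμE]
      rw [pow_succ, Module.End.mul_apply, h1, ih, pow_succ, Module.End.mul_apply]
  have hadd := LinearMap.congr_fun ((isQExp_rCoeff hq hq1).add hZY n) (a ⊗ₜ b)
  have h2 := congrArg (TensorProduct.lift μ) hadd
  rw [LinearMap.smul_apply, map_smul, ← hpow, TensorProduct.lift.tmul] at h2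
  rw [h2, LinearMap.sum_apply, map_sum]
  refine Finset.sum_congr rfl fun x _ => ?_
  rw [LinearMap.smul_apply, map_smul, Module.End.mul_apply]
  simp only [Y, Z]
  rw [TensorProduct.map_pow, TensorProduct.map_pow, TensorProduct.map_tmul,
    TensorProduct.map_tmul, TensorProduct.lift.tmul, one_pow, Module.End.one_apply]

lemma K_pow_weight (h : IsWeights σ P L) (k : ℕ) (n : ℤ) (b : A) :
    (σ (Uq.K q) ^ k) (P n b) = ((q : ℂ) ^ n) ^ k • P n b := by
  induction k with
  | zero => simp
  | succ k ih =>
    have := LinearMap.congr_fun (h.act_K n) b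
    rw [Module.End.mul_apply, LinearMap.smul_apply] at this
    rw [pow_succ', Module.End.mul_apply, ih, map_smul, this, smul_smul, ← pow_succ]

lemma F_pow_Kpow (hq : 0 < q) (k : ℕ) (n : ℤ) :
    F q ^ k * Kpow q n = ((q : ℂ) ^ n) ^ k • (Kpow q n * F q ^ k) := by
  have hq0 : (q : ℂ) ≠ 0 := by exact_mod_cast hq.ne'
  have h1 : F q * Kpow q n = (q : ℂ) ^ n • (Kpow q n * F q) := by
    rw [Uq.Kpow_mul_F hq, smul_smul, inv_zpow, mul_inv_cancel₀ (zpow_ne_zero n hq0), one_smul]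
  induction k with
  | zero => simp
  | succ k ih =>
    rw [pow_succ, mul_assoc, h1, mul_smul_comm, ← mul_assoc, ih, smul_mul_assoc, smul_smul,
      mul_assoc, pow_succ']

/-- `a ↦ ∑ R⁽¹⁾ a ⊗ R⁽²⁾` is multiplicative for a bilinear product for which `E⁺` acts as a twisted
derivation and which is compatible with the weights. -/
lemma evalLeg_mul (hq : 0 < q) (hq1 : q ≠ 1) (h : IsWeights σ P L) (μ : A →ₗ[ℂ] A →ₗ[ℂ] A)
    (hμE : ∀ a b, σ (Uq.Ep q) (μ a b)
      = μ (σ (Uq.Ep q) a) (σ (Uq.K q) b) + μ a (σ (Uq.Ep q) b))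
    (hμP : ∀ m n a b, P (m + n) (μ (P m a) (P n b)) = μ (P m a) (P n b)) (a b : A) :
    evalLeg (μ a b) (representedR σ P L)
      = TensorProduct.map₂ μ (LinearMap.mul ℂ (Uq q)) (evalLeg a (representedR σ P L))
          (evalLeg b (representedR σ P L)) := by
  set e := σ (Uq.Ep q) with he
  set D := cartanPart q P L with hD
  have evD : ∀ u : A, evalLeg u D = ∑ m ∈ Finset.Icc (-(L : ℤ)) L, P m u ⊗ₜ[ℂ] Kpow q m := by
    intro u
    rw [hD, cartanPart, map_sum]
    rfl
  have dec : ∀ u : A, ∑ m ∈ Finset.Icc (-(L : ℤ)) L, P m u = u := fun u => by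
    have := LinearMap.congr_fun h.sum u
    rwa [LinearMap.sum_apply, Module.End.one_apply] at this
  have evadd : ∀ (s : Finset ℤ) (f : ℤ → A) (X : Module.End ℂ A ⊗[ℂ] Uq q),
      evalLeg (∑ i ∈ s, f i) X = ∑ i ∈ s, evalLeg (f i) X := by
    intro s f X
    simp only [← legAct_tmul_one, TensorProduct.sum_tmul, map_sum]
  have evsmul : ∀ (c : ℂ) (u : A) (X : Module.End ℂ A ⊗[ℂ] Uq q),
      evalLeg (c • u) X = c • evalLeg u X := by
    intro c u X
    simp only [← legAct_tmul_one, ← TensorProduct.smul_tmul', map_smul]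
  have hterm : ∀ (k l : ℕ) (u w : A),
      evalLeg (μ u ((σ (Uq.K q) ^ k) w)) D * (1 ⊗ₜ (F q ^ (k + l)))
        = TensorProduct.map₂ μ (LinearMap.mul ℂ (Uq q)) (evalLeg u D * (1 ⊗ₜ (F q ^ k)))
          (evalLeg w D * (1 ⊗ₜ (F q ^ l))) := by
    intro k l u w
    have e1 : μ u ((σ (Uq.K q) ^ k) w) = ∑ n ∈ Finset.Icc (-(L : ℤ)) L,
        ∑ m ∈ Finset.Icc (-(L : ℤ)) L, ((q : ℂ) ^ n) ^ k • μ (P m u) (P n w) := by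
      conv_lhs => rw [← dec u, ← dec w]
      simp only [map_sum, LinearMap.sum_apply, h.K_pow_weight, map_smul, Finset.smul_sum]
    rw [e1, evadd, evD u, evD w]
    simp only [evadd, evsmul, Finset.sum_mul, map_sum, LinearMap.sum_apply]
    refine Finset.sum_congr rfl fun n _ => Finset.sum_congr rfl fun m _ => ?_
    rw [hD, h.evalLeg_cartan (hμP m n u w), smul_mul_assoc]
    simp only [Algebra.TensorProduct.tmul_mul_tmul, mul_one, TensorProduct.map₂_apply_tmul,
      TensorProduct.map_tmul, LinearMap.mul_apply']
    rw [← mul_assoc, mul_assoc (Kpow q m), F_pow_Kpow hq, Uq.Kpow_add, pow_add]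
    simp only [mul_smul_comm, smul_mul_assoc, TensorProduct.tmul_smul, mul_assoc]
  -- this range contains all `k + l` with `k, l ≤ 2 * L`, so the double sum is not truncated
  set T := 2 * (2 * L + 1) with hT
  rw [h.evalLeg_representedR (T := T) (by omega), h.evalLeg_representedR (T := T) (by omega) a,
    h.evalLeg_representedR (T := T) (by omega) b, ← he, ← hD]
  have hn : ∀ n, rCoeff q n • (evalLeg ((e ^ n) (μ a b)) D * ((1 : A) ⊗ₜ[ℂ] (F q ^ n)))
      = ∑ x ∈ Finset.HasAntidiagonal.antidiagonal n, (rCoeff q x.1 * rCoeff q x.2) •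
        (evalLeg (μ ((e ^ x.1) a) ((σ (Uq.K q) ^ x.1) ((e ^ x.2) b))) D
          * ((1 : A) ⊗ₜ[ℂ] (F q ^ (x.1 + x.2)))) := by
    intro n
    rw [← smul_mul_assoc, ← evsmul, he, rCoeff_smul_pow_apply hq hq1 μ hμE, ← legAct_tmul_one,
      TensorProduct.sum_tmul, map_sum, Finset.sum_mul]
    refine Finset.sum_congr rfl fun x hx => ?_
    rw [legAct_tmul_one, evsmul, smul_mul_assoc, Finset.HasAntidiagonal.mem_antidiagonal.mp hx]
  rw [Finset.sum_congr rfl fun n _ => hn n, sum_range_antidiagonal T fun k l =>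
    (rCoeff q k * rCoeff q l) • (evalLeg (μ ((e ^ k) a) ((σ (Uq.K q) ^ k) ((e ^ l) b))) D
          * ((1 : A) ⊗ₜ[ℂ] (F q ^ (k + l))))]
  · simp only [map_sum, LinearMap.sum_apply, map_smul, LinearMap.smul_apply, Finset.smul_sum]
    rw [Finset.sum_comm]
    refine Finset.sum_congr rfl fun l _ => Finset.sum_congr rfl fun k _ => ?_
    rw [hterm, smul_smul, mul_comm]
  · intro k l hkl
    have hz : μ ((e ^ k) a) ((σ (Uq.K q) ^ k) ((e ^ l) b)) = 0 := by
      rcases (by omega : 2 * L < k ∨ 2 * L < l) with hk | hl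
      · rw [he, h.Ep_nilpotent hk, LinearMap.zero_apply, map_zero, LinearMap.zero_apply]
      · rw [he, h.Ep_nilpotent hl, LinearMap.zero_apply, map_zero, map_zero]
    rw [hz, ← legAct_tmul_one, TensorProduct.zero_tmul, map_zero, zero_mul, smul_zero]

end evalLeg

end IsWeights

/-! ### The action on the fuzzy sphere -/

section action

variable {q : ℝ} (hq : 0 < q) (N : ℕ)

@[simp] lemma spinRep_Ep : spinRep hq N (Uq.Ep q) = spinEp q N := by simp [spinRep]
@[simp] lemma spinRep_Em : spinRep hq N (Uq.Em q) = spinEm q N := by simp [spinRep]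
@[simp] lemma spinRep_K : spinRep hq N (Uq.K q) = spinK q N := by simp [spinRep]
@[simp] lemma spinRep_Ki : spinRep hq N (Uq.Ki q) = spinKi q N := by simp [spinRep]

lemma act_Ep (a : Fuzzy N) :
    act hq N (Uq.Ep q) a = (spinEp q N * a - a * spinEp q N) * spinKi q N := by
  simp [act, Uq.comul, Uq.antipodeOp, add_mul, mul_assoc, sub_eq_add_neg]

lemma act_Em (a : Fuzzy N) :
    act hq N (Uq.Em q) a = (spinEm q N * a - a * spinEm q N) * spinKi q N := by
  simp [act, Uq.comul, Uq.antipodeOp, add_mul, mul_assoc, sub_eq_add_neg]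

lemma act_Ki (a : Fuzzy N) : act hq N (Uq.Ki q) a = spinKi q N * a * spinK q N := by
  simp [act, Uq.comul, Uq.antipodeOp]

lemma spinKi_mul_cancel (hq : 0 < q) {N : ℕ} (a : Fuzzy N) : spinKi q N * (spinK q N * a) = a := by
  rw [← mul_assoc, spinKi_mul_spinK N hq, one_mul]

lemma spinK_mul_cancel (hq : 0 < q) {N : ℕ} (a : Fuzzy N) : spinK q N * (spinKi q N * a) = a := by
  rw [← mul_assoc, spinK_mul_spinKi N hq, one_mul]

lemma act_one (g : Uq q) : act hq N g 1 = algebraMap ℂ (Fuzzy N) (Uq.counit q g) := by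
  induction g using Uq.induction with
  | hs c => rw [AlgHom.commutes, AlgHom.commutes, Module.algebraMap_end_apply,
      Algebra.algebraMap_eq_smul_one, Algebra.algebraMap_self, RingHom.id_apply]
  | h1 => simp [act_Ep, Uq.counit]
  | h2 => simp [act_Em, Uq.counit]
  | h3 => simp [QFuzzy.act_K, Uq.counit, spinK_mul_spinKi N hq]
  | h4 => simp [act_Ki, Uq.counit, spinKi_mul_spinK N hq]
  | ha a b ha hb => rw [map_add, LinearMap.add_apply, ha, hb, map_add, map_add]
  | hm a b ha hb =>
    rw [map_mul, Module.End.mul_apply, hb, Algebra.algebraMap_eq_smul_one, map_smul, ha,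
      map_mul, map_mul, Algebra.smul_def, Algebra.commutes]

/-- An intertwining property of two representations along a linear map needs to be checked on the
generators only. -/
lemma apply_eq_of_generators {V V' : Type*} [AddCommGroup V] [Module ℂ V] [AddCommGroup V']
    [Module ℂ V'] (f : V →ₗ[ℂ] V') (J : Uq q →ₐ[ℂ] Module.End ℂ V) (J' : Uq q →ₐ[ℂ] Module.End ℂ V')
    (h1 : ∀ t, J' (Uq.Ep q) (f t) = f (J (Uq.Ep q) t))
    (h2 : ∀ t, J' (Uq.Em q) (f t) = f (J (Uq.Em q) t))
    (h3 : ∀ t, J' (Uq.K q) (f t) = f (J (Uq.K q) t))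
    (h4 : ∀ t, J' (Uq.Ki q) (f t) = f (J (Uq.Ki q) t)) (g : Uq q) (t : V) :
    J' g (f t) = f (J g t) := by
  induction g using Uq.induction generalizing t with
  | hs c => simp [Module.algebraMap_end_apply]
  | h1 => exact h1 t
  | h2 => exact h2 t
  | h3 => exact h3 t
  | h4 => exact h4 t
  | ha a b ha hb => simp only [map_add, LinearMap.add_apply, ha, hb]
  | hm a b ha hb => simp only [map_mul, Module.End.mul_apply, ha, hb]

/-- The representation of `U_q so(3)` on a tensor product of two representations. -/
def tensorRep {V V' : Type*} [AddCommGroup V] [Module ℂ V] [AddCommGroup V'] [Module ℂ V']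
    (σ : Uq q →ₐ[ℂ] Module.End ℂ V) (σ' : Uq q →ₐ[ℂ] Module.End ℂ V') :
    Uq q →ₐ[ℂ] Module.End ℂ (V ⊗[ℂ] V') :=
  Module.endTensorEndAlgHom.comp
    ((Algebra.TensorProduct.map σ σ').comp (Bialgebra.comulAlgHom ℂ (Uq q)))

section tensorRep

variable {V V' : Type*} [AddCommGroup V] [Module ℂ V] [AddCommGroup V'] [Module ℂ V']
  (σ : Uq q →ₐ[ℂ] Module.End ℂ V) (σ' : Uq q →ₐ[ℂ] Module.End ℂ V')

lemma tensorRep_tmul (g : Uq q) (v : V) (v' : V') : tensorRep σ σ' g (v ⊗ₜ v')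
    = TensorProduct.map (LinearMap.applyₗ v ∘ₗ σ.toLinearMap)
      (LinearMap.applyₗ v' ∘ₗ σ'.toLinearMap) (Bialgebra.comulAlgHom ℂ (Uq q) g) := by
  rw [tensorRep, AlgHom.comp_apply, AlgHom.comp_apply]
  induction Bialgebra.comulAlgHom ℂ (Uq q) g with
  | zero => simp
  | add x y hx hy => simp only [map_add, LinearMap.add_apply, hx, hy]
  | tmul a b => rfl

lemma tensorRep_Ep (v : V) (v' : V') : tensorRep σ σ' (Uq.Ep q) (v ⊗ₜ v')
    = σ (Uq.Ep q) v ⊗ₜ σ' (Uq.K q) v' + v ⊗ₜ σ' (Uq.Ep q) v' := by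
  rw [tensorRep_tmul, Uq.comul_Ep]; simp

lemma tensorRep_Em (v : V) (v' : V') : tensorRep σ σ' (Uq.Em q) (v ⊗ₜ v')
    = σ (Uq.Em q) v ⊗ₜ σ' (Uq.K q) v' + v ⊗ₜ σ' (Uq.Em q) v' := by
  rw [tensorRep_tmul, Uq.comul_Em]; simp

lemma tensorRep_K (v : V) (v' : V') : tensorRep σ σ' (Uq.K q) (v ⊗ₜ v')
    = σ (Uq.K q) v ⊗ₜ σ' (Uq.K q) v' := by
  rw [tensorRep_tmul, Uq.comul_K]; simp

lemma tensorRep_Ki (v : V) (v' : V') : tensorRep σ σ' (Uq.Ki q) (v ⊗ₜ v')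
    = σ (Uq.Ki q) v ⊗ₜ σ' (Uq.Ki q) v' := by
  rw [tensorRep_tmul, Uq.comul_Ki]; simp

/-- The same for a representation on a tensor product. -/
lemma apply_tensorRep_of_generators {V'' : Type*} [AddCommGroup V''] [Module ℂ V'']
    (f : V ⊗[ℂ] V' →ₗ[ℂ] V'') (J : Uq q →ₐ[ℂ] Module.End ℂ V'')
    (h1 : ∀ v v', J (Uq.Ep q) (f (v ⊗ₜ v'))
      = f (σ (Uq.Ep q) v ⊗ₜ σ' (Uq.K q) v') + f (v ⊗ₜ σ' (Uq.Ep q) v'))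
    (h2 : ∀ v v', J (Uq.Em q) (f (v ⊗ₜ v'))
      = f (σ (Uq.Em q) v ⊗ₜ σ' (Uq.K q) v') + f (v ⊗ₜ σ' (Uq.Em q) v'))
    (h3 : ∀ v v', J (Uq.K q) (f (v ⊗ₜ v')) = f (σ (Uq.K q) v ⊗ₜ σ' (Uq.K q) v'))
    (h4 : ∀ v v', J (Uq.Ki q) (f (v ⊗ₜ v')) = f (σ (Uq.Ki q) v ⊗ₜ σ' (Uq.Ki q) v'))
    (g : Uq q) (t : V ⊗[ℂ] V') : J g (f t) = f (tensorRep σ σ' g t) := by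
  have ext : ∀ g, (∀ v v', J g (f (v ⊗ₜ v')) = f (tensorRep σ σ' g (v ⊗ₜ v'))) →
      ∀ t, J g (f t) = f (tensorRep σ σ' g t) := fun g h t =>
    LinearMap.congr_fun (TensorProduct.ext' h : J g ∘ₗ f = f ∘ₗ tensorRep σ σ' g) t
  refine apply_eq_of_generators f _ _ (ext _ fun v v' => ?_) (ext _ fun v v' => ?_)
    (ext _ fun v v' => ?_) (ext _ fun v v' => ?_) g t
  · rw [h1, tensorRep_Ep, map_add]
  · rw [h2, tensorRep_Em, map_add]
  · rw [h3, tensorRep_K]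
  · rw [h4, tensorRep_Ki]

end tensorRep

/-- The fuzzy sphere is a module algebra. -/
lemma act_mul (g : Uq q) (a b : Fuzzy N) :
    act hq N g (a * b) = LinearMap.mul' ℂ (Fuzzy N)
      (TensorProduct.map (LinearMap.applyₗ a ∘ₗ (act hq N).toLinearMap)
        (LinearMap.applyₗ b ∘ₗ (act hq N).toLinearMap) (Bialgebra.comulAlgHom ℂ (Uq q) g)) := by
  have key := apply_tensorRep_of_generators (act hq N) (act hq N)
    (LinearMap.mul' ℂ (Fuzzy N)) (act hq N)
    (fun a b => by
      simp only [LinearMap.mul'_apply, act_Ep,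
        QFuzzy.act_K, sub_mul, mul_sub, mul_assoc, spinKi_mul_cancel hq]
      abel)
    (fun a b => by
      simp only [LinearMap.mul'_apply, act_Em,
        QFuzzy.act_K, sub_mul, mul_sub, mul_assoc, spinKi_mul_cancel hq]
      abel)
    (fun a b => by
      simp only [LinearMap.mul'_apply, QFuzzy.act_K, mul_assoc, spinKi_mul_cancel hq])
    (fun a b => by
      simp only [LinearMap.mul'_apply, act_Ki, mul_assoc, spinK_mul_cancel hq])
    g (a ⊗ₜ b)
  rwa [tensorRep_tmul, LinearMap.mul'_apply] at key

/-- The action on the fuzzy sphere is inner: `π(g) a = ∑ (g₍₁₎ ▹ a) π(g₍₂₎)`. -/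
lemma implements_spinRep : Implements (spinRep hq N) (act hq N) := by
  intro g a
  have key := apply_tensorRep_of_generators (act hq N)
    ((Algebra.lmul ℂ (Fuzzy N)).comp (spinRep hq N)) (LinearMap.mul' ℂ (Fuzzy N))
    ((Algebra.lmul ℂ (Fuzzy N)).comp (spinRep hq N))
    (fun a b => by
      simp only [LinearMap.mul'_apply, act_Ep,
        AlgHom.comp_apply, Algebra.coe_lmul_eq_mul, LinearMap.mul_apply', spinRep_Ep, spinRep_K,
        sub_mul, mul_assoc, spinKi_mul_cancel hq, sub_add_cancel])
    (fun a b => by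
      simp only [LinearMap.mul'_apply, act_Em,
        AlgHom.comp_apply, Algebra.coe_lmul_eq_mul, LinearMap.mul_apply', spinRep_Em, spinRep_K,
        sub_mul, mul_assoc, spinKi_mul_cancel hq, sub_add_cancel])
    (fun a b => by
      simp only [LinearMap.mul'_apply, QFuzzy.act_K,
        AlgHom.comp_apply, Algebra.coe_lmul_eq_mul, LinearMap.mul_apply', spinRep_K,
        mul_assoc, spinKi_mul_cancel hq])
    (fun a b => by
      simp only [LinearMap.mul'_apply, act_Ki,
        AlgHom.comp_apply, Algebra.coe_lmul_eq_mul, LinearMap.mul_apply', spinRep_Ki,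
        mul_assoc, spinK_mul_cancel hq])
    g (a ⊗ₜ 1)
  rw [tensorRep_tmul, LinearMap.mul'_apply, mul_one] at key
  refine key.trans ?_
  congr 3
  refine LinearMap.ext fun u => ?_
  simp

end action

section weights

variable {q : ℝ} (hq : 0 < q) (N : ℕ)

/-- Multiplication by a matrix concentrated on the `d`-th diagonal raises the weight by `d`. -/
lemma weightProj_mul_of_degree {b : Fuzzy N} {d : ℤ}
    (hb : ∀ i j : Fin (N + 1), ((j : ℕ) : ℤ) - (i : ℕ) ≠ d → b i j = 0) (m : ℤ) (a : Fuzzy N) :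
    b * weightProj N m a = weightProj N (m + d) (b * a) := by
  ext i j
  simp only [weightProj, LinearMap.coe_mk, AddHom.coe_mk, Matrix.mul_apply, Matrix.of_apply]
  split_ifs with h
  · refine Finset.sum_congr rfl fun k _ => ?_
    by_cases hk : ((k : ℕ) : ℤ) - (i : ℕ) = d
    · rw [if_pos (by omega)]
    · rw [hb i k hk, zero_mul, zero_mul]
  · refine Finset.sum_eq_zero fun k _ => ?_
    by_cases hk : ((k : ℕ) : ℤ) - (i : ℕ) = d
    · rw [if_neg (by omega), mul_zero]
    · rw [hb i k hk, zero_mul]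

lemma weightProj_of_degree_mul {b : Fuzzy N} {d : ℤ}
    (hb : ∀ i j : Fin (N + 1), ((j : ℕ) : ℤ) - (i : ℕ) ≠ d → b i j = 0) (m : ℤ) (a : Fuzzy N) :
    weightProj N m a * b = weightProj N (m + d) (a * b) := by
  ext i j
  simp only [weightProj, LinearMap.coe_mk, AddHom.coe_mk, Matrix.mul_apply, Matrix.of_apply]
  split_ifs with h
  · refine Finset.sum_congr rfl fun k _ => ?_
    by_cases hk : ((j : ℕ) : ℤ) - (k : ℕ) = d
    · rw [if_pos (by omega)]
    · rw [hb k j hk, mul_zero, mul_zero]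
  · refine Finset.sum_eq_zero fun k _ => ?_
    by_cases hk : ((j : ℕ) : ℤ) - (k : ℕ) = d
    · rw [if_neg (by omega), zero_mul]
    · rw [hb k j hk, mul_zero]

lemma spinEp_degree (i j : Fin (N + 1)) (h : ((j : ℕ) : ℤ) - (i : ℕ) ≠ 1) : spinEp q N i j = 0 := by
  rw [spinEp, Matrix.of_apply, if_neg (by omega)]

lemma spinEm_degree (i j : Fin (N + 1)) (h : ((j : ℕ) : ℤ) - (i : ℕ) ≠ -1) :
    spinEm q N i j = 0 := by
  rw [spinEm, Matrix.of_apply, if_neg (by omega)]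

lemma spinK_degree (i j : Fin (N + 1)) (h : ((j : ℕ) : ℤ) - (i : ℕ) ≠ 0) : spinK q N i j = 0 :=
  Matrix.diagonal_apply_ne _ fun e => h (by rw [e, sub_self])

lemma spinKi_degree (i j : Fin (N + 1)) (h : ((j : ℕ) : ℤ) - (i : ℕ) ≠ 0) : spinKi q N i j = 0 :=
  Matrix.diagonal_apply_ne _ fun e => h (by rw [e, sub_self])

lemma weightProj_weightProj (m n : ℤ) :
    weightProj N m * weightProj N n = if m = n then weightProj N m else 0 := by
  refine LinearMap.ext fun a => Matrix.ext fun i j => ?_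
  by_cases h : m = n
  · subst h
    by_cases h' : ((j : ℕ) : ℤ) - (i : ℕ) = m <;> simp [weightProj, h']
  · by_cases h' : ((j : ℕ) : ℤ) - (i : ℕ) = m
    · simp [weightProj, h, h']
    · simp [weightProj, h, h']

lemma weightProj_apply_degree (m : ℤ) (a : Fuzzy N) (i j : Fin (N + 1))
    (h : ((j : ℕ) : ℤ) - (i : ℕ) ≠ m) : weightProj N m a i j = 0 := by
  simp [weightProj, h]

lemma weightProj_add_mul (m n : ℤ) (a b : Fuzzy N) :
    weightProj N (m + n) (weightProj N m a * weightProj N n b)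
      = weightProj N m a * weightProj N n b := by
  have e : weightProj N m (weightProj N m a) = weightProj N m a := by
    rw [← Module.End.mul_apply, weightProj_weightProj, if_pos rfl]
  rw [← weightProj_of_degree_mul N (weightProj_apply_degree N n b), e]

lemma weightProj_zero_one : weightProj N 0 1 = 1 := by
  ext i j
  by_cases h : i = j
  · subst h; simp [weightProj]
  · simp [weightProj, h]

lemma act_Ep_weightProj (m : ℤ) :
    act hq N (Uq.Ep q) * weightProj N m = weightProj N (m + 1) * act hq N (Uq.Ep q) := by
  refine LinearMap.ext fun a => ?_
  rw [Module.End.mul_apply, Module.End.mul_apply, act_Ep, act_Ep,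
    weightProj_mul_of_degree N (spinEp_degree N), weightProj_of_degree_mul N (spinEp_degree N),
    ← map_sub, weightProj_of_degree_mul N (spinKi_degree N), add_zero]

lemma act_Em_weightProj (m : ℤ) :
    act hq N (Uq.Em q) * weightProj N m = weightProj N (m - 1) * act hq N (Uq.Em q) := by
  refine LinearMap.ext fun a => ?_
  rw [Module.End.mul_apply, Module.End.mul_apply, act_Em, act_Em,
    weightProj_mul_of_degree N (spinEm_degree N), weightProj_of_degree_mul N (spinEm_degree N),
    ← map_sub, weightProj_of_degree_mul N (spinKi_degree N), add_zero, sub_eq_add_neg m]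

lemma act_Ki_weightProj (m : ℤ) :
    act hq N (Uq.Ki q) * weightProj N m = weightProj N m * act hq N (Uq.Ki q) := by
  refine LinearMap.ext fun a => ?_
  rw [Module.End.mul_apply, Module.End.mul_apply, act_Ki, act_Ki,
    weightProj_mul_of_degree N (spinKi_degree N), weightProj_of_degree_mul N (spinK_degree N),
    add_zero, add_zero]

lemma act_F_weightProj (m : ℤ) :
    act hq N (F q) * weightProj N m = weightProj N (m - 1) * act hq N (F q) := by
  rw [F, map_smul, map_mul, smul_mul_assoc, mul_assoc, act_Ki_weightProj, ← mul_assoc,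
    act_Em_weightProj, mul_assoc, mul_smul_comm]

lemma sum_weightProj_eq_one : ∑ m ∈ Finset.Icc (-(N : ℤ)) N, weightProj N m = 1 :=
  LinearMap.ext fun a => by
    rw [LinearMap.sum_apply, sum_weightProj, Module.End.one_apply]

lemma isWeights_act : IsWeights (act hq N) (weightProj N) N where
  mul_self m := by rw [weightProj_weightProj, if_pos rfl]
  mul_ne m n h := by rw [weightProj_weightProj, if_neg h]
  sum := sum_weightProj_eq_one N
  act_K m := LinearMap.ext fun a => by
    rw [Module.End.mul_apply, act_K_weightProj, LinearMap.smul_apply]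
    push_cast
    rfl
  act_Ep := act_Ep_weightProj hq N
  act_F := act_F_weightProj hq N

/-- The weights for the action twisted by the automorphism that exchanges `E⁺` and `F`. -/
lemma isWeights_act_omega :
    IsWeights ((act hq N).comp (Uq.omega hq)) (fun m => weightProj N (-m)) N where
  mul_self m := by rw [weightProj_weightProj, if_pos rfl]
  mul_ne m n h := by rw [weightProj_weightProj, if_neg fun e => h (neg_injective e)]
  sum := by
    rw [← sum_weightProj_eq_one N]
    exact Finset.sum_nbij' (fun m => -m) (fun m => -m) (by simp; omega) (by simp; omega)
      (by simp) (by simp) (by simp)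
  act_K m := by
    have := (isWeights_act hq N).Ki_mul hq (-m)
    rw [AlgHom.comp_apply, Uq.omega_K, this, zpow_neg, inv_zpow, inv_inv]
  act_Ep m := by
    rw [AlgHom.comp_apply, Uq.omega_Ep, act_F_weightProj, neg_add, sub_eq_add_neg]
  act_F m := by
    rw [AlgHom.comp_apply, Uq.omega_F, act_Ep_weightProj]
    congr 2
    ring

end weights

/-! ### The R-matrix acting on the fuzzy sphere -/

section halfR

variable {q : ℝ} (hq : 0 < q) (N : ℕ)

lemma Rleft_eq : Rleft hq N = representedR (act hq N) (weightProj N) N := by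
  simp only [Rleft, representedR_eq, map_pow]

lemma isUnit_Rleft : IsUnit (Rleft hq N) := by
  rw [Rleft_eq]
  exact (isWeights_act hq N).isUnit_representedR

lemma map₂_mul_mul {A U : Type*} [Ring A] [Algebra ℂ A] [Ring U] [Algebra ℂ U] (X Y : A ⊗[ℂ] U) :
    TensorProduct.map₂ (LinearMap.mul ℂ A) (LinearMap.mul ℂ U) X Y = X * Y := by
  induction X with
  | zero => simp
  | add x y hx hy => simp only [map_add, LinearMap.add_apply, add_mul, hx, hy]
  | tmul a u =>
    induction Y with
    | zero => simp
    | add x y hx hy => simp only [map_add, mul_add, hx, hy]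
    | tmul b v => simp

lemma map₂_flip_flip {A U : Type*} [Ring A] [Algebra ℂ A] [Ring U] [Algebra ℂ U]
    (μ : A →ₗ[ℂ] A →ₗ[ℂ] A) (ν : U →ₗ[ℂ] U →ₗ[ℂ] U) (X Y : A ⊗[ℂ] U) :
    TensorProduct.map₂ μ.flip ν.flip X Y = TensorProduct.map₂ μ ν Y X := by
  induction X with
  | zero => simp
  | add x y hx hy => simp only [map_add, LinearMap.add_apply, hx, hy]
  | tmul a u =>
    induction Y with
    | zero => simp
    | add x y hx hy => simp only [map_add, LinearMap.add_apply, hx, hy]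
    | tmul b v => simp

lemma evalLeg_map {A U : Type*} [Ring A] [Algebra ℂ A] [Ring U] [Bialgebra ℂ U] (f : U →ₐ[ℂ] U)
    (a : A) (X : Module.End ℂ A ⊗[ℂ] U) :
    evalLeg a (Algebra.TensorProduct.map (AlgHom.id ℂ (Module.End ℂ A)) f X)
      = TensorProduct.map LinearMap.id f.toLinearMap (evalLeg a X) := by
  induction X with
  | zero => simp
  | add x y hx hy => simp only [map_add, hx, hy]
  | tmul w u => simp

lemma act_Ep_mul (a b : Fuzzy N) : act hq N (Uq.Ep q) (a * b)
    = act hq N (Uq.Ep q) a * act hq N (Uq.K q) b + a * act hq N (Uq.Ep q) b := by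
  rw [act_mul, Uq.comul_Ep]; simp

lemma act_F_mul (a b : Fuzzy N) : act hq N (F q) (a * b)
    = act hq N (F q) a * b + act hq N (Uq.Ki q) a * act hq N (F q) b := by
  rw [act_mul, Uq.comul_F]; simp

lemma act_Ep_one : act hq N (Uq.Ep q) 1 = 0 := by simp [act_Ep]

lemma act_F_one : act hq N (F q) 1 = 0 := by simp [F, act_Em, act_Ki, spinKi_mul_spinK N hq]

/-- The R-matrix with its first leg acting on the fuzzy sphere. -/
lemma isHalfR_Rleft (hq1 : q ≠ 1) :
    IsHalfR (act hq N) (Rleft hq N) (Ring.inverse (Rleft hq N)) := by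
  have h := isWeights_act hq N
  have hmul : ∀ a b : Fuzzy N, evalLeg ((LinearMap.mul ℂ (Fuzzy N)) a b) (Rleft hq N)
      = TensorProduct.map₂ (LinearMap.mul ℂ (Fuzzy N)) (LinearMap.mul ℂ (Uq q))
        (evalLeg a (Rleft hq N)) (evalLeg b (Rleft hq N)) := fun a b => by
    rw [Rleft_eq]
    exact h.evalLeg_mul hq hq1 (LinearMap.mul ℂ (Fuzzy N)) (act_Ep_mul hq N)
      (weightProj_add_mul N) a b
  have hinv : Rleft hq N * Ring.inverse (Rleft hq N) = 1 :=
    Ring.mul_inverse_cancel _ (isUnit_Rleft hq N)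
  have hinv' : Ring.inverse (Rleft hq N) * Rleft hq N = 1 :=
    Ring.inverse_mul_cancel _ (isUnit_Rleft hq N)
  refine ⟨hinv, hinv', fun g => ?_, ?_, ?_, fun a b => ?_, fun a b => ?_⟩
  · rw [Rleft_eq]
    exact h.intertwine hq hq1 g
  · rw [Rleft_eq]
    exact h.coaction hq hq1
  · rw [Rleft_eq]
    exact h.evalLeg_one_representedR (act_Ep_one hq N) (weightProj_zero_one N)
  · exact (hmul a b).trans (map₂_mul_mul _ _)
  · exact evalLeg_inv_mul (LinearMap.mul ℂ (Fuzzy N)) hinv hinv' hmul a b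

/-- The universal R-matrix with its second leg acting on the fuzzy sphere; that leg comes first. -/
def flipR : Module.End ℂ (Fuzzy N) ⊗[ℂ] Uq q :=
  TensorProduct.comm ℂ (Uq q) (Module.End ℂ (Fuzzy N)) (Rright hq N)

/-- The automorphism that exchanges `E⁺` and `F` and reverses the coproduct turns one of the two
represented R-matrices into the other. -/
lemma flipR_eq : flipR hq N = Algebra.TensorProduct.map (AlgHom.id ℂ (Module.End ℂ (Fuzzy N)))
    (Uq.omega hq)
    (representedR ((act hq N).comp (Uq.omega hq)) (fun m => weightProj N (-m)) N) := by
  rw [representedR_eq, flipR, Rright]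
  simp only [map_sum, map_smul, TensorProduct.comm_tmul, Algebra.TensorProduct.map_tmul,
    AlgHom.id_apply, map_mul, map_pow, Uq.omega_F, Uq.omega_Kpow, AlgHom.comp_apply, Uq.omega_Ep]
  exact Finset.sum_nbij' (fun m => -m) (fun m => -m) (by simp; omega) (by simp; omega)
    (by simp) (by simp) (by simp)

lemma isUnit_flipR : IsUnit (flipR hq N) := by
  rw [flipR_eq]
  exact (isWeights_act_omega hq N).isUnit_representedR.map _

lemma flipR_intertwine (hq1 : q ≠ 1) (g : Uq q) :
    flipR hq N * Algebra.TensorProduct.map (act hq N) (AlgHom.id ℂ (Uq q))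
        (Algebra.TensorProduct.comm ℂ (Uq q) (Uq q) (Bialgebra.comulAlgHom ℂ (Uq q) g))
      = Algebra.TensorProduct.map (act hq N) (AlgHom.id ℂ (Uq q))
          (Bialgebra.comulAlgHom ℂ (Uq q) g) * flipR hq N := by
  have h := congrArg (Algebra.TensorProduct.map (AlgHom.id ℂ (Module.End ℂ (Fuzzy N)))
    (Uq.omega hq)) ((isWeights_act_omega hq N).intertwine hq hq1 (Uq.omega hq g))
  have e : ∀ t : Uq q ⊗[ℂ] Uq q, Algebra.TensorProduct.map
      (AlgHom.id ℂ (Module.End ℂ (Fuzzy N))) (Uq.omega hq)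
        (Algebra.TensorProduct.map ((act hq N).comp (Uq.omega hq)) (AlgHom.id ℂ (Uq q))
          (Algebra.TensorProduct.map (Uq.omega hq) (Uq.omega hq) t))
      = Algebra.TensorProduct.map (act hq N) (AlgHom.id ℂ (Uq q)) t := by
    intro t
    induction t with
    | zero => simp
    | add x y hx hy => simp only [map_add, hx, hy]
    | tmul u v => simp [Uq.omega_omega]
  have e' : ∀ t : Uq q ⊗[ℂ] Uq q, Algebra.TensorProduct.comm ℂ (Uq q) (Uq q)
      (Algebra.TensorProduct.map (Uq.omega hq) (Uq.omega hq)
        (Algebra.TensorProduct.comm ℂ (Uq q) (Uq q) t))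
      = Algebra.TensorProduct.map (Uq.omega hq) (Uq.omega hq) t := by
    intro t
    induction t with
    | zero => simp
    | add x y hx hy => simp only [map_add, hx, hy]
    | tmul u v => simp
  rwa [map_mul, map_mul, ← flipR_eq, Uq.comul_omega, e, e', e] at h

lemma flipR_coaction (hq1 : q ≠ 1) :
    Algebra.TensorProduct.map (AlgHom.id ℂ (Module.End ℂ (Fuzzy N)))
        (Bialgebra.comulAlgHom ℂ (Uq q)) (flipR hq N)
      = Algebra.TensorProduct.map (AlgHom.id ℂ (Module.End ℂ (Fuzzy N)))
          (Algebra.TensorProduct.includeLeft : Uq q →ₐ[ℂ] Uq q ⊗[ℂ] Uq q) (flipR hq N)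
        * Algebra.TensorProduct.map (AlgHom.id ℂ (Module.End ℂ (Fuzzy N)))
          (Algebra.TensorProduct.includeRight : Uq q →ₐ[ℂ] Uq q ⊗[ℂ] Uq q) (flipR hq N) := by
  let J : Uq q ⊗[ℂ] Uq q →ₐ[ℂ] Uq q ⊗[ℂ] Uq q :=
    (Algebra.TensorProduct.map (Uq.omega hq) (Uq.omega hq)).comp
      (Algebra.TensorProduct.comm ℂ (Uq q) (Uq q)).toAlgHom
  have h := congrArg (Algebra.TensorProduct.map (AlgHom.id ℂ (Module.End ℂ (Fuzzy N))) J)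
    ((isWeights_act_omega hq N).coaction hq hq1)
  have e : ∀ (f g : Uq q →ₐ[ℂ] Uq q ⊗[ℂ] Uq q), (∀ u, J (f u) = g (Uq.omega hq u)) →
      ∀ X : Module.End ℂ (Fuzzy N) ⊗[ℂ] Uq q,
        Algebra.TensorProduct.map (AlgHom.id ℂ (Module.End ℂ (Fuzzy N))) J
          (Algebra.TensorProduct.map (AlgHom.id ℂ (Module.End ℂ (Fuzzy N))) f X)
        = Algebra.TensorProduct.map (AlgHom.id ℂ (Module.End ℂ (Fuzzy N))) g
          (Algebra.TensorProduct.map (AlgHom.id ℂ (Module.End ℂ (Fuzzy N))) (Uq.omega hq) X) := by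
    intro f g hfg X
    induction X with
    | zero => simp
    | add x y hx hy => simp only [map_add, hx, hy]
    | tmul w u => simp [hfg]
  rw [map_mul, e _ _ fun u => (Uq.comul_omega hq u).symm,
    e _ (Algebra.TensorProduct.includeLeft : Uq q →ₐ[ℂ] Uq q ⊗[ℂ] Uq q) fun u => by simp [J],
    e _ (Algebra.TensorProduct.includeRight : Uq q →ₐ[ℂ] Uq q ⊗[ℂ] Uq q) fun u => by simp [J],
    ← flipR_eq] at h
  exact h

/-- The automorphism turns `E⁺` into `F`, a derivation twisted on the other side, so that
multiplicativity holds for the opposite product of the fuzzy sphere. -/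
lemma evalLeg_flipR_mul (hq1 : q ≠ 1) (a b : Fuzzy N) :
    evalLeg ((LinearMap.mul ℂ (Fuzzy N)).flip a b) (flipR hq N)
      = TensorProduct.map₂ (LinearMap.mul ℂ (Fuzzy N)).flip (LinearMap.mul ℂ (Uq q))
        (evalLeg a (flipR hq N)) (evalLeg b (flipR hq N)) := by
  have h := (isWeights_act_omega hq N).evalLeg_mul hq hq1 (LinearMap.mul ℂ (Fuzzy N)).flip
    (fun a b => by
      simp only [LinearMap.flip_apply, LinearMap.mul_apply', AlgHom.comp_apply, Uq.omega_Ep,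
        Uq.omega_K, act_F_mul]
      exact add_comm _ _)
    (fun m n a b => by
      simp only [LinearMap.flip_apply, LinearMap.mul_apply', neg_add_rev, weightProj_add_mul]) a b
  have e : ∀ X Y : Fuzzy N ⊗[ℂ] Uq q,
      TensorProduct.map LinearMap.id (Uq.omega hq).toLinearMap (TensorProduct.map₂
        (LinearMap.mul ℂ (Fuzzy N)).flip (LinearMap.mul ℂ (Uq q)) X Y)
      = TensorProduct.map₂ (LinearMap.mul ℂ (Fuzzy N)).flip (LinearMap.mul ℂ (Uq q))
        (TensorProduct.map LinearMap.id (Uq.omega hq).toLinearMap X)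
        (TensorProduct.map LinearMap.id (Uq.omega hq).toLinearMap Y) := by
    intro X Y
    induction X with
    | zero => simp
    | add x y hx hy => simp only [map_add, LinearMap.add_apply, hx, hy]
    | tmul a u =>
      induction Y with
      | zero => simp
      | add x y hx hy => simp only [map_add, hx, hy]
      | tmul b v => simp
  rw [flipR_eq, evalLeg_map, evalLeg_map, evalLeg_map, h, e]

lemma evalLeg_one_flipR : evalLeg 1 (flipR hq N) = 1 ⊗ₜ 1 := by
  rw [flipR_eq, evalLeg_map, (isWeights_act_omega hq N).evalLeg_one_representedR]
  · simp
  · rw [AlgHom.comp_apply, Uq.omega_Ep, act_F_one]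
  · rw [neg_zero, weightProj_zero_one]

/-- The inverse of the R-matrix with its second leg acting on the fuzzy sphere also has the
properties of an R-matrix with its first leg acting. -/
lemma isHalfR_inverse_flipR (hq1 : q ≠ 1) :
    IsHalfR (act hq N) (Ring.inverse (flipR hq N)) (flipR hq N) := by
  have hinv : flipR hq N * Ring.inverse (flipR hq N) = 1 :=
    Ring.mul_inverse_cancel _ (isUnit_flipR hq N)
  have hinv' : Ring.inverse (flipR hq N) * flipR hq N = 1 :=
    Ring.inverse_mul_cancel _ (isUnit_flipR hq N)
  refine ⟨hinv', hinv, fun g => ?_, ?_, ?_, fun a b => ?_, fun a b => ?_⟩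
  · have h := flipR_intertwine hq N hq1 g
    set V := flipR hq N
    calc Ring.inverse V * Algebra.TensorProduct.map (act hq N) (AlgHom.id ℂ (Uq q))
          (Bialgebra.comulAlgHom ℂ (Uq q) g)
        = Ring.inverse V * (Algebra.TensorProduct.map (act hq N) (AlgHom.id ℂ (Uq q))
          (Bialgebra.comulAlgHom ℂ (Uq q) g) * V) * Ring.inverse V := by
          rw [mul_assoc, mul_assoc _ V, hinv, mul_one]
      _ = _ := by rw [← h, ← mul_assoc, hinv', one_mul]
  · exact map_inverse_eq_mul hinv hinv' _ _ _ (flipR_coaction hq N hq1)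
  · have := legAct_evalLeg (Ring.inverse (flipR hq N)) (flipR hq N) (1 : Fuzzy N)
    rwa [evalLeg_one_flipR, legAct_tmul_one, hinv'] at this
  · have := evalLeg_inv_mul (LinearMap.mul ℂ (Fuzzy N)).flip hinv hinv'
      (evalLeg_flipR_mul hq N hq1) b a
    rw [map₂_flip_flip, map₂_mul_mul] at this
    exact this
  · have := evalLeg_flipR_mul hq N hq1 b a
    rw [← LinearMap.flip_flip (LinearMap.mul ℂ (Uq q)), map₂_flip_flip] at this
    exact this

lemma act_Kpow_mul_weightProj (m n : ℤ) :
    act hq N (Kpow q m) * weightProj N n = ((q : ℂ) ^ n) ^ m • weightProj N n := by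
  have hpow : ∀ (x p : Module.End ℂ (Fuzzy N)) (c : ℂ), x * p = c • p →
      ∀ k : ℕ, x ^ k * p = c ^ k • p := fun x p c h k => by
    induction k with
    | zero => simp
    | succ k ih => rw [pow_succ, mul_assoc, h, mul_smul_comm, ih, smul_smul, pow_succ']
  obtain ⟨k, rfl | rfl⟩ := m.eq_nat_or_neg
  · have := hpow _ _ _ ((isWeights_act hq N).act_K n) k
    simpa [Kpow] using this
  · have := hpow _ _ _ ((isWeights_act hq N).Ki_mul hq n) k
    simpa [Kpow, zpow_neg] using this

lemma act_Kpow (m : ℤ) :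
    act hq N (Kpow q m) = ∑ n ∈ Finset.Icc (-(N : ℤ)) N, ((q : ℂ) ^ n) ^ m • weightProj N n := by
  rw [← mul_one (act hq N (Kpow q m)), ← sum_weightProj_eq_one, Finset.mul_sum]
  exact Finset.sum_congr rfl fun n _ => act_Kpow_mul_weightProj hq N m n

/-- Both represented R-matrices come from the same universal R-matrix. -/
lemma map_Rright_eq_map_Rleft :
    Algebra.TensorProduct.map (act hq N) (AlgHom.id ℂ (Module.End ℂ (Fuzzy N))) (Rright hq N)
      = Algebra.TensorProduct.map (AlgHom.id ℂ (Module.End ℂ (Fuzzy N))) (act hq N)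
        (Rleft hq N) := by
  have hD : ∑ m ∈ Finset.Icc (-(N : ℤ)) N, act hq N (Kpow q m) ⊗ₜ[ℂ] weightProj N m
      = ∑ m ∈ Finset.Icc (-(N : ℤ)) N, weightProj N m ⊗ₜ[ℂ] act hq N (Kpow q m) := by
    simp only [act_Kpow, TensorProduct.sum_tmul, TensorProduct.tmul_sum,
      ← TensorProduct.smul_tmul', TensorProduct.tmul_smul]
    rw [Finset.sum_comm]
    refine Finset.sum_congr rfl fun m _ => Finset.sum_congr rfl fun n _ => ?_
    rw [← zpow_mul, ← zpow_mul, mul_comm]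
  have hright : Algebra.TensorProduct.map (act hq N) (AlgHom.id ℂ (Module.End ℂ (Fuzzy N)))
        (Rright hq N)
      = (∑ m ∈ Finset.Icc (-(N : ℤ)) N, act hq N (Kpow q m) ⊗ₜ[ℂ] weightProj N m)
        * ∑ n ∈ Finset.range (2 * N + 1), rCoeff q n •
          (act hq N (Uq.Ep q ^ n) ⊗ₜ[ℂ] act hq N (F q ^ n)) := by
    simp only [Rright, map_sum, map_smul, Algebra.TensorProduct.map_tmul, AlgHom.id_apply,
      Finset.sum_mul_sum, mul_smul_comm, Algebra.TensorProduct.tmul_mul_tmul, map_mul]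
  have hleft : Algebra.TensorProduct.map (AlgHom.id ℂ (Module.End ℂ (Fuzzy N))) (act hq N)
        (Rleft hq N)
      = (∑ m ∈ Finset.Icc (-(N : ℤ)) N, weightProj N m ⊗ₜ[ℂ] act hq N (Kpow q m))
        * ∑ n ∈ Finset.range (2 * N + 1), rCoeff q n •
          (act hq N (Uq.Ep q ^ n) ⊗ₜ[ℂ] act hq N (F q ^ n)) := by
    simp only [Rleft, map_sum, map_smul, Algebra.TensorProduct.map_tmul, AlgHom.id_apply,
      Finset.sum_mul_sum, mul_smul_comm, Algebra.TensorProduct.tmul_mul_tmul, map_mul]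
  rw [hright, hleft, hD]

/-- The operator `a ⊗ b ↦ ∑ (u ▹ a) ⊗ w b`, for `∑ w ⊗ u`. -/
def onPairSwap : Module.End ℂ (Fuzzy N) ⊗[ℂ] Uq q →ₐ[ℂ] Module.End ℂ (Fuzzy N ⊗[ℂ] Fuzzy N) :=
  Module.endTensorEndAlgHom.comp
    ((Algebra.TensorProduct.map (act hq N) (AlgHom.id ℂ (Module.End ℂ (Fuzzy N)))).comp
      (Algebra.TensorProduct.comm ℂ (Module.End ℂ (Fuzzy N)) (Uq q)).toAlgHom)

lemma onPairSwap_apply (X : Module.End ℂ (Fuzzy N) ⊗[ℂ] Uq q) (a b : Fuzzy N) :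
    onPairSwap hq N X (a ⊗ₜ b) = crossForm (act hq N)
      (Algebra.TensorProduct.includeLeft : Fuzzy N →ₐ[ℂ] Fuzzy N ⊗[ℂ] Fuzzy N).toLinearMap
      (Algebra.TensorProduct.includeRight : Fuzzy N →ₐ[ℂ] Fuzzy N ⊗[ℂ] Fuzzy N).toLinearMap
      a b X := by
  induction X with
  | zero => simp
  | add x y hx hy => simp only [map_add, LinearMap.add_apply, hx, hy]
  | tmul w u => simp [onPairSwap]; rfl

lemma onPairSwap_flipR : onPairSwap hq N (flipR hq N) = onPair hq N (Rleft hq N) := by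
  have e : (Algebra.TensorProduct.comm ℂ (Module.End ℂ (Fuzzy N)) (Uq q)) (flipR hq N)
      = Rright hq N := (TensorProduct.comm ℂ (Uq q) (Module.End ℂ (Fuzzy N))).symm_apply_apply _
  change Module.endTensorEndAlgHom (Algebra.TensorProduct.map (act hq N)
    (AlgHom.id ℂ (Module.End ℂ (Fuzzy N)))
    ((Algebra.TensorProduct.comm ℂ (Module.End ℂ (Fuzzy N)) (Uq q)) (flipR hq N))) = _
  rw [e, map_Rright_eq_map_Rleft]
  rfl

lemma braid_plus : braid hq N .plus = onPairSwap hq N (Ring.inverse (flipR hq N)) := by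
  refine left_inv_eq_right_inv (a := onPair hq N (Rleft hq N)) ?_ ?_
  · change onPair hq N (Ring.inverse (Rleft hq N)) * _ = 1
    rw [← map_mul, Ring.inverse_mul_cancel _ (isUnit_Rleft hq N), map_one]
  · rw [← onPairSwap_flipR, ← map_mul, Ring.mul_inverse_cancel _ (isUnit_flipR hq N), map_one]

lemma braid_minus : braid hq N .minus = onPairSwap hq N (Rleft hq N) := by
  refine TensorProduct.ext' fun a b => ?_
  change (TensorProduct.comm ℂ _ _) (onPair hq N (Rleft hq N) (b ⊗ₜ a)) = _
  induction Rleft hq N with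
  | zero => simp
  | add x y hx hy => simp only [map_add, LinearMap.add_apply, hx, hy]
  | tmul w u => simp [onPairSwap, onPair]; rfl

@[simp] lemma phiU_apply (g : Uq q) : phiU hq N g = spinRep hq N g := by
  simp [phiU, phiHat]

lemma unbraid_plus : unbraid hq N .plus
    = TensorProduct.map LinearMap.id (spinRep hq N).toLinearMap ∘ₗ legMap (flipR hq N) := by
  refine LinearMap.ext fun a => ?_
  change TensorProduct.comm ℂ _ _ (TensorProduct.map (phiU hq N) (LinearMap.applyₗ a) (Rright hq N))
    = TensorProduct.map LinearMap.id (spinRep hq N).toLinearMap (evalLeg a (flipR hq N))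
  rw [flipR]
  induction Rright hq N with
  | zero => simp
  | add x y hx hy => simp only [map_add, hx, hy]
  | tmul u w => simp

lemma unbraid_minus : unbraid hq N .minus
    = TensorProduct.map LinearMap.id (spinRep hq N).toLinearMap
      ∘ₗ legMap (Ring.inverse (Rleft hq N)) := by
  refine LinearMap.ext fun a => ?_
  change TensorProduct.map (LinearMap.applyₗ a) (phiU hq N) (Ring.inverse (Rleft hq N))
    = TensorProduct.map LinearMap.id (spinRep hq N).toLinearMap
      (evalLeg a (Ring.inverse (Rleft hq N)))
  induction Ring.inverse (Rleft hq N) with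
  | zero => simp
  | add x y hx hy => simp only [map_add, hx, hy]
  | tmul u w => simp

end halfR

/-! ### q-numbers and relations of the spin representations -/

section scalars

variable {q : ℝ}

lemma qnum_pos (hq : 0 < q) (hq1 : q ≠ 1) {x : ℝ} (hx : 0 < x) : 0 < qnum q x := by
  unfold qnum
  rcases lt_or_gt_of_ne hq1 with h | h
  · apply div_pos_of_neg_of_neg <;> rw [sub_neg] <;>
      apply Real.rpow_lt_rpow_of_exponent_gt hq h <;> linarith
  · apply div_pos <;> rw [sub_pos] <;> apply Real.rpow_lt_rpow_of_exponent_lt h <;> linarith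

lemma rpow_half_pos (hq : 0 < q) : 0 < q ^ (1 / 2 : ℝ) := Real.rpow_pos_of_pos hq _

lemma rpow_neg_half (hq : 0 < q) : q ^ (-1 / 2 : ℝ) = (q ^ (1 / 2 : ℝ))⁻¹ := by
  rw [neg_div, Real.rpow_neg hq.le]

lemma rpow_half_sq (hq : 0 < q) : (q ^ (1 / 2 : ℝ)) ^ 2 = q := by
  rw [← Real.rpow_natCast, ← Real.rpow_mul hq.le]
  norm_num

lemma rpow_half_sub_inv_ne_zero (hq : 0 < q) (hq1 : q ≠ 1) :
    q ^ (1 / 2 : ℝ) - (q ^ (1 / 2 : ℝ))⁻¹ ≠ 0 := by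
  have hv := rpow_half_pos hq
  have h2 := rpow_half_sq hq
  intro h
  apply hq1
  rw [← h2]
  field_simp at h
  linarith

lemma qnum_two (hq : 0 < q) (hq1 : q ≠ 1) :
    qnum q 2 = q ^ (1 / 2 : ℝ) + (q ^ (1 / 2 : ℝ))⁻¹ := by
  have h := rpow_half_sub_inv_ne_zero hq hq1
  have hv := rpow_half_pos hq
  rw [qnum, rpow_neg_half hq, div_eq_iff h]
  have e1 : q ^ ((2 : ℝ) / 2) = (q ^ (1 / 2 : ℝ)) ^ 2 := by rw [rpow_half_sq hq]; norm_num
  have e2 : q ^ (-(2 : ℝ) / 2) = ((q ^ (1 / 2 : ℝ)) ^ 2)⁻¹ := by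
    rw [rpow_half_sq hq, ← Real.rpow_neg_one]; norm_num
  rw [e1, e2]
  field_simp
  ring

lemma qnum_pow_two (hq : 0 < q) (hq1 : q ≠ 1) (N : ℕ) : qnum (q ^ (N + 1)) 2
    = q ^ ((N : ℝ) / 2) * q ^ (1 / 2 : ℝ) + (q ^ ((N : ℝ) / 2) * q ^ (1 / 2 : ℝ))⁻¹ := by
  have h1 : q ^ (N + 1) ≠ 1 := fun h => hq1 ((pow_eq_one_iff_of_nonneg hq.le (by omega)).mp h)
  have e : (q ^ (N + 1)) ^ (1 / 2 : ℝ) = q ^ ((N : ℝ) / 2) * q ^ (1 / 2 : ℝ) := by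
    rw [← Real.rpow_add hq, ← Real.rpow_natCast, ← Real.rpow_mul hq.le]
    congr 1
    push_cast
    ring
  rw [qnum_two (pow_pos hq _) h1, e]

/-- The eigenvalues of the commutator of `E⁺` and `E⁻` and of the Casimir element on the weight
vector with index `x` of a spin representation. -/
lemma spin_commutator_scalar (hq : 0 < q) (hq1 : q ≠ 1) (N : ℕ) (x : ℝ) :
    qnum q (x + 1) * qnum q (N - x) * q ^ (((N : ℝ) - 2 * x - 1) / 2)
      - qnum q x * qnum q (N + 1 - x) * q ^ (((N : ℝ) - 2 * x + 1) / 2)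
      = (q ^ (1 / 2 : ℝ) - (q ^ (1 / 2 : ℝ))⁻¹)⁻¹ * (q ^ (((N : ℝ) - 2 * x) / 2) *
        (qnum q 2 * q ^ (((N : ℝ) - 2 * x) / 2) - qnum (q ^ (N + 1)) 2)) ∧
    qnum q 2 * (q ^ (1 / 2 : ℝ) *
        (qnum q (x + 1) * qnum q (N - x) * q ^ (((N : ℝ) - 2 * x - 1) / 2))
      + (q ^ (1 / 2 : ℝ))⁻¹ *
        (qnum q x * qnum q (N + 1 - x) * q ^ (((N : ℝ) - 2 * x + 1) / 2)))
      + (q ^ (1 / 2 : ℝ) - (q ^ (1 / 2 : ℝ))⁻¹)⁻¹ ^ 2 *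
        (qnum (q ^ (N + 1)) 2 - qnum q 2 * q ^ (((N : ℝ) - 2 * x) / 2)) ^ 2
      = qnum q N * qnum q (N + 2) := by
  have hneg : ∀ y : ℝ, q ^ (-y / 2) = (q ^ (y / 2))⁻¹ := fun y => by
    rw [neg_div, Real.rpow_neg hq.le]
  have h := rpow_half_sub_inv_ne_zero hq hq1
  rw [qnum_two hq hq1, qnum_pow_two hq hq1]
  unfold qnum
  simp only [hneg]
  generalize (N : ℝ) = n
  have e1 : q ^ ((x + 1) / 2) = q ^ (x / 2) * q ^ (1 / 2 : ℝ) := by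
    rw [← Real.rpow_add hq]; congr 1; ring
  have e2 : q ^ ((n - x) / 2) = q ^ (n / 2) * (q ^ (x / 2))⁻¹ := by
    rw [← Real.rpow_neg hq.le, ← Real.rpow_add hq]; congr 1; ring
  have e3 : q ^ ((n + 1 - x) / 2) = q ^ (n / 2) * (q ^ (x / 2))⁻¹ * q ^ (1 / 2 : ℝ) := by
    rw [← Real.rpow_neg hq.le, ← Real.rpow_add hq, ← Real.rpow_add hq]; congr 1; ring
  have e4 : q ^ ((n - 2 * x) / 2) = q ^ (n / 2) * (q ^ (x / 2))⁻¹ * (q ^ (x / 2))⁻¹ := by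
    rw [← Real.rpow_neg hq.le, ← Real.rpow_add hq, ← Real.rpow_add hq]; congr 1; ring
  have e5 : q ^ ((n - 2 * x - 1) / 2)
      = q ^ (n / 2) * (q ^ (x / 2))⁻¹ * (q ^ (x / 2))⁻¹ * (q ^ (1 / 2 : ℝ))⁻¹ := by
    rw [← e4, ← Real.rpow_neg hq.le, ← Real.rpow_add hq]; congr 1; ring
  have e6 : q ^ ((n - 2 * x + 1) / 2)
      = q ^ (n / 2) * (q ^ (x / 2))⁻¹ * (q ^ (x / 2))⁻¹ * q ^ (1 / 2 : ℝ) := by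
    rw [← e4, ← Real.rpow_add hq]; congr 1; ring
  have e7 : q ^ ((n + 2) / 2) = q ^ (n / 2) * q ^ (1 / 2 : ℝ) * q ^ (1 / 2 : ℝ) := by
    rw [← Real.rpow_add hq, ← Real.rpow_add hq]; congr 1; ring
  rw [e5, e6, e7, e1, e2, e3, e4]
  have hp : 0 < q ^ (1 / 2 : ℝ) := Real.rpow_pos_of_pos hq _
  have ha : 0 < q ^ (x / 2) := Real.rpow_pos_of_pos hq _
  have hb : 0 < q ^ (n / 2) := Real.rpow_pos_of_pos hq _
  generalize q ^ (1 / 2 : ℝ) = p at *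
  generalize q ^ (x / 2) = a at *
  generalize q ^ (n / 2) = b at *
  have h' : p ^ 2 - 1 ≠ 0 := by
    intro h0
    apply h
    field_simp
    linarith
  constructor
  · field_simp
    ring
  · field_simp
    ring

end scalars

section relations

variable {q : ℝ} (N : ℕ)

lemma spin_commutator (hq : 0 < q) (hq1 : q ≠ 1) :
    spinEp q N * spinEm q N - spinEm q N * spinEp q N
      = (qhalf q - (qhalf q)⁻¹)⁻¹ • (spinK q N * ((qnum q 2 : ℂ) • spinK q N
        - (qnum (q ^ (N + 1)) 2 : ℂ) • (1 : Fuzzy N))) := by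
  rw [spinEp_mul_spinEm N hq, spinEm_mul_spinEp N hq, spinK]
  ext i j
  rw [Matrix.sub_apply, Matrix.smul_apply, Matrix.diagonal_mul, Matrix.sub_apply, Matrix.smul_apply,
    Matrix.smul_apply]
  by_cases hij : i = j
  · subst hij
    have := congrArg (fun z : ℝ => (z : ℂ)) (spin_commutator_scalar hq hq1 N (i : ℕ)).1
    simp only [Matrix.diagonal_apply_eq, Matrix.one_apply_eq, smul_eq_mul, qhalf, mul_one]
    push_cast at this ⊢
    exact this
  · simp [hij]

lemma spin_casimir (hq : 0 < q) (hq1 : q ≠ 1) :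
    (qnum q 2 : ℂ) • (qhalf q • (spinEp q N * spinEm q N)
        + (qhalf q)⁻¹ • (spinEm q N * spinEp q N))
      + (qhalf q - (qhalf q)⁻¹)⁻¹ ^ 2 • ((qnum (q ^ (N + 1)) 2 : ℂ) • (1 : Fuzzy N)
        - (qnum q 2 : ℂ) • spinK q N) ^ 2
      = (qnum q N * qnum q (N + 2) : ℂ) • (1 : Fuzzy N) := by
  rw [spinEp_mul_spinEm N hq, spinEm_mul_spinEp N hq, spinK]
  have e : (qnum (q ^ (N + 1)) 2 : ℂ) • (1 : Fuzzy N) - (qnum q 2 : ℂ) •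
      Matrix.diagonal (fun i : Fin (N + 1) => ((q ^ (((N : ℝ) - 2 * (i : ℕ)) / 2) : ℝ) : ℂ))
      = Matrix.diagonal fun i : Fin (N + 1) => (qnum (q ^ (N + 1)) 2 : ℂ)
        - (qnum q 2 : ℂ) * ((q ^ (((N : ℝ) - 2 * (i : ℕ)) / 2) : ℝ) : ℂ) := by
    ext i j
    by_cases hij : i = j
    · subst hij
      simp
    · simp [hij]
  rw [e, Matrix.diagonal_pow]
  ext i j
  by_cases hij : i = j
  · subst hij
    have := congrArg (fun z : ℝ => (z : ℂ)) (spin_commutator_scalar hq hq1 N (i : ℕ)).2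
    simp only [Matrix.add_apply, Matrix.smul_apply, Matrix.diagonal_apply_eq, Matrix.one_apply_eq,
      smul_eq_mul, qhalf, mul_one, Pi.pow_apply]
    push_cast at this ⊢
    exact this
  · simp [hij]

end relations

section normalization

variable {q : ℝ} {N : ℕ}

lemma qnum_prod_pos (hq : 0 < q) (hq1 : q ≠ 1) (hN : 1 ≤ N) :
    0 < qnum q N * qnum q (N + 2) := by
  have : (0 : ℝ) < N := by exact_mod_cast hN
  exact mul_pos (qnum_pos hq hq1 this) (qnum_pos hq hq1 (by linarith))

lemma sqrt_qnum_prod_pos (hq : 0 < q) (hq1 : q ≠ 1) (hN : 1 ≤ N) :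
    0 < √(qnum q N * qnum q (N + 2)) := Real.sqrt_pos.mpr (qnum_prod_pos hq hq1 hN)

lemma sqrt_qnum_two_pos (hq : 0 < q) (hq1 : q ≠ 1) : 0 < √(qnum q 2) :=
  Real.sqrt_pos.mpr (qnum_pos hq hq1 two_pos)

lemma sqrt_norm_Ep (hq : 0 < q) (hq1 : q ≠ 1) (hN : 1 ≤ N) : √(q⁻¹ * qnum q 2 * cN q N)
    = √(qnum q N * qnum q (N + 2)) / (q ^ (1 / 2 : ℝ) * √(qnum q 2)) := by
  have h2 := qnum_pos hq hq1 two_pos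
  have hv := rpow_half_pos hq
  have hs := sqrt_qnum_two_pos hq hq1
  have hn := sqrt_qnum_prod_pos hq hq1 hN
  rw [Real.sqrt_eq_iff_mul_self_eq_of_pos (by positivity), cN, div_mul_div_comm,
    Real.mul_self_sqrt (qnum_prod_pos hq hq1 hN).le, mul_mul_mul_comm, Real.mul_self_sqrt h2.le,
    ← sq, rpow_half_sq hq]
  field_simp

lemma sqrt_norm_Em (hq : 0 < q) (hq1 : q ≠ 1) (hN : 1 ≤ N) : √(q * qnum q 2 * cN q N)
    = q ^ (1 / 2 : ℝ) * √(qnum q N * qnum q (N + 2)) / √(qnum q 2) := by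
  have h2 := qnum_pos hq hq1 two_pos
  have hv := rpow_half_pos hq
  have hs := sqrt_qnum_two_pos hq hq1
  have hn := sqrt_qnum_prod_pos hq hq1 hN
  rw [Real.sqrt_eq_iff_mul_self_eq_of_pos (by positivity), cN, div_mul_div_comm, mul_mul_mul_comm,
    Real.mul_self_sqrt (qnum_prod_pos hq hq1 hN).le, Real.mul_self_sqrt h2.le,
    ← sq, rpow_half_sq hq]
  field_simp

/-- The normalization of `x₁`, with all square roots reduced to those of `[2]_q` and of
`[N]_q [N + 2]_q`. -/
lemma gen_zero (hq : 0 < q) (hq1 : q ≠ 1) (hN : 1 ≤ N) (r : ℝ) : gen q r N 0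
    = ((r : ℂ) * qhalf q * (√(qnum q 2) : ℝ) / (√(qnum q N * qnum q (N + 2)) : ℝ))
      • spinEp q N := by
  change ((r / √(q⁻¹ * qnum q 2 * cN q N) : ℝ) : ℂ) • spinEp q N = _
  rw [sqrt_norm_Ep hq hq1 hN, div_div_eq_mul_div, qhalf]
  push_cast
  rw [mul_assoc]

lemma gen_one (q r : ℝ) (hq : 0 < q) (N : ℕ) : gen q r N 1
    = (((lambdaN q r N : ℝ) : ℂ) * (qhalf q - (qhalf q)⁻¹)⁻¹) •
      (1 - ((qnum q 2 : ℂ) / (qnum (q ^ (N + 1)) 2 : ℂ)) • spinK q N) := by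
  change ((lambdaN q r N / (q ^ (1 / 2 : ℝ) - q ^ (-1 / 2 : ℝ)) : ℝ) : ℂ) •
      (1 - ((qnum q 2 / qnum (q ^ (N + 1)) 2 : ℝ) : ℂ) • spinK q N) = _
  rw [rpow_neg_half hq, qhalf]
  push_cast
  rw [div_eq_mul_inv]

lemma gen_two (hq : 0 < q) (hq1 : q ≠ 1) (hN : 1 ≤ N) (r : ℝ) : gen q r N 2
    = -(((r : ℂ) * (qhalf q)⁻¹ * (√(qnum q 2) : ℝ) / (√(qnum q N * qnum q (N + 2)) : ℝ))
      • spinEm q N) := by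
  change -(((r / √(q * qnum q 2 * cN q N) : ℝ) : ℂ) • spinEm q N) = _
  rw [sqrt_norm_Em hq hq1 hN, div_div_eq_mul_div, qhalf]
  push_cast
  congr 2
  rw [mul_comm ((q ^ (1 / 2 : ℝ) : ℝ) : ℂ), div_mul_eq_div_div_swap]
  ring

lemma qnum_pow_two_pos (hq : 0 < q) (hq1 : q ≠ 1) (N : ℕ) : 0 < qnum (q ^ (N + 1)) 2 :=
  qnum_pos (pow_pos hq _) (fun h => hq1 ((pow_eq_one_iff_of_nonneg hq.le (by omega)).mp h)) two_pos

lemma lambdaN_pos (hq : 0 < q) (hq1 : q ≠ 1) (hN : 1 ≤ N) {r : ℝ} (hr : 0 < r) :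
    0 < lambdaN q r N :=
  mul_pos hr (div_pos (qnum_pow_two_pos hq hq1 N) (sqrt_qnum_prod_pos hq hq1 hN))

end normalization

/-! ### The generators of the fuzzy sphere -/

section generators

variable {q r : ℝ} {N : ℕ}

lemma qnum_two_complex (hq : 0 < q) (hq1 : q ≠ 1) :
    (qnum q 2 : ℂ) = qhalf q + (qhalf q)⁻¹ := by
  rw [qnum_two hq hq1, qhalf]
  push_cast
  rfl

/-- Scalars `v = q^{1/2}`, `s = √[2]_q`, `n = √([N]_q [N + 2]_q)`, `t = [2]_{q^{N+1}}` in which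
the generators are simple. -/
lemma exists_normal_form (hq : 0 < q) (hq1 : q ≠ 1) (hN : 1 ≤ N) (r : ℝ) :
    ∃ s n t : ℂ, s ≠ 0 ∧ n ≠ 0 ∧ t ≠ 0 ∧ s ^ 2 = qhalf q + (qhalf q)⁻¹ ∧
      s = (√(qnum q 2) : ℝ) ∧ n ^ 2 = qnum q N * qnum q (N + 2) ∧ t = qnum (q ^ (N + 1)) 2 ∧
      ((lambdaN q r N : ℝ) : ℂ) = r * t / n ∧
      gen q r N 0 = (r * qhalf q * s / n) • spinEp q N ∧
      gen q r N 1 = (r * t / n * (qhalf q - (qhalf q)⁻¹)⁻¹) •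
        (1 - (s ^ 2 / t) • spinK q N) ∧
      gen q r N 2 = -((r * (qhalf q)⁻¹ * s / n) • spinEm q N) := by
  have hs2 : ((√(qnum q 2) : ℝ) : ℂ) ^ 2 = (qnum q 2 : ℂ) := by
    rw [← Complex.ofReal_pow, Real.sq_sqrt (qnum_pos hq hq1 two_pos).le]
  have hl : ((lambdaN q r N : ℝ) : ℂ) = r * (qnum (q ^ (N + 1)) 2 : ℂ)
      / (√(qnum q N * qnum q (N + 2)) : ℝ) := by
    rw [lambdaN]
    push_cast
    rw [mul_div_assoc]
  refine ⟨(√(qnum q 2) : ℝ), (√(qnum q N * qnum q (N + 2)) : ℝ), qnum (q ^ (N + 1)) 2,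
    ?_, ?_, ?_, ?_, rfl, ?_, rfl, hl, gen_zero hq hq1 hN r, ?_, gen_two hq hq1 hN r⟩
  · exact_mod_cast (sqrt_qnum_two_pos hq hq1).ne'
  · exact_mod_cast (sqrt_qnum_prod_pos hq hq1 hN).ne'
  · exact_mod_cast (qnum_pow_two_pos hq hq1 N).ne'
  · rw [hs2, qnum_two_complex hq hq1]
  · rw [← Complex.ofReal_pow, Real.sq_sqrt (qnum_prod_pos hq hq1 hN).le]
    push_cast
    rfl
  · rw [gen_one q r hq, hl, hs2]

lemma spinEp_mul_spinEm_eq (hq : 0 < q) (hq1 : q ≠ 1) : spinEp q N * spinEm q N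
    = spinEm q N * spinEp q N + ((qhalf q - (qhalf q)⁻¹)⁻¹ * (qhalf q + (qhalf q)⁻¹)) •
        (spinK q N * spinK q N)
      - ((qhalf q - (qhalf q)⁻¹)⁻¹ * (qnum (q ^ (N + 1)) 2 : ℂ)) • spinK q N := by
  have h := spin_commutator N hq hq1
  rw [qnum_two_complex hq hq1, sub_eq_iff_eq_add] at h
  rw [h, mul_sub, mul_smul_comm, mul_smul_comm, mul_one]
  module

lemma eps_relations (hq : 0 < q) (hq1 : q ≠ 1) (hN : 1 ≤ N) (k : Fin 3) :
    ∑ i, ∑ j, eps q k i j • (gen q r N i * gen q r N j)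
      = ((lambdaN q r N : ℝ) : ℂ) • gen q r N k := by
  obtain ⟨s, n, t, hs, hn, ht, hs2, -, -, ht', hl, h0, h1, h2⟩ := exists_normal_form hq hq1 hN r
  have hv := qhalf_ne_zero hq
  have hw := qhalf_sub_inv_ne_zero hq hq1
  have hKE := spinK_mul_spinEp N hq
  have hEK := spinEm_mul_spinK N hq
  have hc := spinEp_mul_spinEm_eq (N := N) hq hq1
  rw [← ht'] at hc
  rw [hl]
  simp only [Fin.sum_univ_three]
  fin_cases k
  · simp only [eps, Fin.isValue, Fin.zero_eta, h0, h1, zero_smul, zero_add, add_zero]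
    simp only [smul_mul_assoc, mul_smul_comm, mul_sub, sub_mul, mul_one, one_mul, hKE]
    rw [hs2]
    set w := qhalf q - (qhalf q)⁻¹ with hwdef
    have : qhalf q = w + (qhalf q)⁻¹ := by rw [hwdef]; ring
    match_scalars
    · field_simp
      rw [hwdef]
      field_simp
      ring
    · field_simp
      ring
  · simp only [eps, Fin.isValue, Fin.mk_one, h0, h1, h2, zero_smul, zero_add, add_zero]
    simp only [smul_mul_assoc, mul_smul_comm, mul_sub, sub_mul, mul_one, one_mul, mul_neg, neg_mul,
      hc, ← hs2]
    match_scalars <;> field_simp <;> ring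
  · simp only [eps, Fin.isValue, Fin.reduceFinMk, h1, h2, zero_smul, zero_add, add_zero]
    simp only [smul_mul_assoc, mul_smul_comm, mul_sub, sub_mul, mul_one, one_mul, mul_neg, neg_mul,
      hEK]
    set w := qhalf q - (qhalf q)⁻¹ with hwdef
    match_scalars
    · field_simp
      rw [hwdef]
      field_simp
      ring
    · field_simp
      ring

lemma metric_relation (hq : 0 < q) (hq1 : q ≠ 1) (hN : 1 ≤ N) :
    ∑ i, ∑ j, metric q i j • (gen q r N i * gen q r N j)
      = algebraMap ℂ (Fuzzy N) ((r : ℂ) ^ 2) := by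
  obtain ⟨s, n, t, hs, hn, ht, hs2, -, hn2, ht', hl, h0, h1, h2⟩ := exists_normal_form hq hq1 hN r
  have hv := qhalf_ne_zero hq
  have hw := qhalf_sub_inv_ne_zero hq hq1
  have hc := spin_casimir N hq hq1
  rw [← ht', qnum_two_complex hq hq1, ← hs2, ← hn2] at hc
  have e : (r : ℂ) ^ 2 • (1 : Fuzzy N) = ((r : ℂ) ^ 2 / n ^ 2) • (n ^ 2 • (1 : Fuzzy N)) := by
    rw [smul_smul, div_mul_cancel₀ _ (pow_ne_zero 2 hn)]
  rw [Algebra.algebraMap_eq_smul_one, e, ← hc]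
  simp only [Fin.sum_univ_three, metric, Fin.isValue, h0, h1, h2, zero_smul, zero_add, add_zero,
    sq (_ - _ : Fuzzy N)]
  simp only [smul_mul_assoc, mul_smul_comm, mul_sub, sub_mul, mul_one, one_mul, mul_neg, neg_mul]
  match_scalars <;> field_simp

lemma star_spinEp (hq : 0 < q) : star (spinEp q N) = (qhalf q)⁻¹ • spinEm q N := by
  ext i j
  rw [Matrix.star_apply, Matrix.smul_apply, spinEp, spinEm, Matrix.of_apply, Matrix.of_apply]
  split_ifs with h
  · have e : q ^ (((N : ℝ) - 2 * (j : ℕ)) / 4)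
        = q ^ (1 / 2 : ℝ) * q ^ (((N : ℝ) - 2 * (i : ℕ)) / 4) := by
      rw [← Real.rpow_add hq, h]
      congr 1
      push_cast
      ring
    have hv := rpow_half_pos hq
    rw [e, Complex.star_def, Complex.conj_ofReal, smul_eq_mul, qhalf, ← Complex.ofReal_inv,
      ← Complex.ofReal_mul]
    congr 1
    field_simp
  · simp

lemma star_spinEm (hq : 0 < q) : star (spinEm q N) = qhalf q • spinEp q N := by
  have hv := qhalf_ne_zero hq
  have h := congrArg (fun a => qhalf q • star a) (star_spinEp (N := N) hq)
  simp only [star_star, star_smul, star_inv₀] at h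
  rw [h, smul_smul, Complex.star_def, Uq.conj_qhalf, mul_inv_cancel₀ hv, one_smul]

lemma star_spinK : star (spinK q N) = spinK q N := by
  rw [spinK, Matrix.star_eq_conjTranspose, Matrix.diagonal_conjTranspose]
  congr 1
  funext i
  exact Complex.conj_ofReal _

lemma star_spinKi : star (spinKi q N) = spinKi q N := by
  rw [spinKi, Matrix.star_eq_conjTranspose, Matrix.diagonal_conjTranspose]
  congr 1
  funext i
  exact Complex.conj_ofReal _

lemma star_gen (hq : 0 < q) (hq1 : q ≠ 1) (hN : 1 ≤ N) (i : Fin 3) :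
    star (gen q r N i) = ∑ j, metric q i j • gen q r N j := by
  have hv := qhalf_ne_zero hq
  have hreal : ∀ (c : ℝ), star (c : ℂ) = (c : ℂ) := fun c => Complex.conj_ofReal c
  simp only [Fin.sum_univ_three]
  have hvs : star (qhalf q) = qhalf q := Uq.conj_qhalf
  fin_cases i
  · simp only [metric, Fin.isValue, Fin.zero_eta, gen_zero hq hq1 hN, gen_two hq hq1 hN, zero_smul,
      zero_add, add_zero, star_smul, star_spinEp hq, star_div₀, star_mul', hreal, hvs]
    match_scalars
    field_simp
  · simp only [metric, Fin.isValue, Fin.mk_one, gen_one q r hq, zero_smul, zero_add, add_zero,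
      star_smul, star_sub, star_one, star_spinK, star_div₀, star_mul', star_inv₀, hreal, hvs,
      one_smul]
  · simp only [metric, Fin.isValue, Fin.reduceFinMk, gen_zero hq hq1 hN, gen_two hq hq1 hN,
      zero_smul, add_zero, star_smul, star_neg, star_spinEm hq, star_div₀, star_mul',
      star_inv₀, hreal, hvs]
    match_scalars
    field_simp

end generators

section vector

variable {q r : ℝ} {N : ℕ}

lemma qnum_one (hq : 0 < q) (hq1 : q ≠ 1) : qnum q 1 = 1 := by
  rw [qnum, div_self]
  rw [rpow_neg_half hq]
  exact rpow_half_sub_inv_ne_zero hq hq1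

lemma spinEp_two (hq : 0 < q) (hq1 : q ≠ 1) : spinEp q 2
    = !![0, ((√(qnum q 2) : ℝ) : ℂ), 0; 0, 0, (qhalf q)⁻¹ * ((√(qnum q 2) : ℝ) : ℂ); 0, 0, 0] := by
  have e : q ^ ((2 - 2 * 2 : ℝ) / 4) = (q ^ (1 / 2 : ℝ))⁻¹ := by
    rw [← rpow_neg_half hq]; norm_num
  have e1 : (2 + 1 - 1 : ℝ) = 2 := by norm_num
  have e2 : (2 + 1 - 2 : ℝ) = 1 := by norm_num
  ext i j
  fin_cases i <;> fin_cases j <;> simp [spinEp, qnum_one hq hq1, e, e1, e2, qhalf, mul_comm]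

lemma spinEm_two (hq : 0 < q) (hq1 : q ≠ 1) : spinEm q 2
    = !![0, 0, 0; qhalf q * ((√(qnum q 2) : ℝ) : ℂ), 0, 0; 0, ((√(qnum q 2) : ℝ) : ℂ), 0] := by
  have e : q ^ ((2 : ℝ) / 4) = q ^ (1 / 2 : ℝ) := by norm_num
  have e1 : (2 + 1 - 1 : ℝ) = 2 := by norm_num
  have e2 : (2 + 1 - 2 : ℝ) = 1 := by norm_num
  ext i j
  fin_cases i <;> fin_cases j <;> simp [spinEm, qnum_one hq hq1, e, e1, e2, qhalf, mul_comm]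

lemma spinK_two (hq : 0 < q) : spinK q 2
    = !![qhalf q ^ 2, 0, 0; 0, 1, 0; 0, 0, (qhalf q ^ 2)⁻¹] := by
  rw [qhalf_sq hq]
  have e : q ^ ((2 - 2 * 2 : ℝ) / 2) = q⁻¹ := by rw [← Real.rpow_neg_one]; norm_num
  ext i j
  fin_cases i <;> fin_cases j <;> simp [spinK, e]

lemma spinKi_two (hq : 0 < q) : spinKi q 2
    = !![(qhalf q ^ 2)⁻¹, 0, 0; 0, 1, 0; 0, 0, qhalf q ^ 2] := by
  rw [qhalf_sq hq]
  have e : q ^ (-((2 - 2 * 2 : ℝ) / 2)) = q := by norm_num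
  have e' : q ^ (-1 : ℝ) = q⁻¹ := Real.rpow_neg_one q
  ext i j
  fin_cases i <;> fin_cases j <;> simp [spinKi, e, e']

lemma spinEp_mul_spinK (hq : 0 < q) :
    spinEp q N * spinK q N = (qhalf q ^ 2)⁻¹ • (spinK q N * spinEp q N) := by
  rw [spinK_mul_spinEp N hq, smul_smul, inv_mul_cancel₀ (pow_ne_zero 2 (qhalf_ne_zero hq)),
    one_smul]

lemma spinK_mul_spinEm (hq : 0 < q) :
    spinK q N * spinEm q N = (qhalf q ^ 2)⁻¹ • (spinEm q N * spinK q N) := by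
  rw [spinEm_mul_spinK N hq, smul_smul, inv_mul_cancel₀ (pow_ne_zero 2 (qhalf_ne_zero hq)),
    one_smul]

/-- The generators of the fuzzy sphere carry the vector representation. -/
lemma act_gen (hq : 0 < q) (hq1 : q ≠ 1) (hN : 1 ≤ N) (g : Uq q) (i : Fin 3) :
    act hq N g (gen q r N i) = ∑ j, vecRep hq g j i • gen q r N j := by
  obtain ⟨s, n, t, hs, hn, ht, hs2, hs', -, ht', hl, h0, h1, h2⟩ := exists_normal_form hq hq1 hN r
  have hv := qhalf_ne_zero hq
  have hw := qhalf_sub_inv_ne_zero hq hq1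
  have hw' : qhalf q ^ 2 - 1 ≠ 0 := by
    intro h
    apply hw
    field_simp
    simpa using h
  have hKE := spinK_mul_spinEp N hq
  have hEK := spinEp_mul_spinK (N := N) hq
  have hEmK := spinEm_mul_spinK N hq
  have hKEm := spinK_mul_spinEm (N := N) hq
  have hKKi := spinK_mul_spinKi N hq
  have hKiK := spinKi_mul_spinK N hq
  have hKEKi : spinK q N * (spinEp q N * spinKi q N) = qhalf q ^ 2 • spinEp q N := by
    rw [← mul_assoc, hKE, smul_mul_assoc, mul_assoc, hKKi, mul_one]
  have hKEmKi : spinK q N * (spinEm q N * spinKi q N) = (qhalf q ^ 2)⁻¹ • spinEm q N := by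
    rw [← mul_assoc, hKEm, smul_mul_assoc, mul_assoc, hKKi, mul_one]
  have hKiEK : spinKi q N * (spinEp q N * spinK q N) = (qhalf q ^ 2)⁻¹ • spinEp q N := by
    rw [hEK, mul_smul_comm, ← mul_assoc, hKiK, one_mul]
  have hKiEmK : spinKi q N * (spinEm q N * spinK q N) = qhalf q ^ 2 • spinEm q N := by
    rw [hEmK, mul_smul_comm, ← mul_assoc, hKiK, one_mul]
  have hc : spinEp q N * (spinEm q N * spinKi q N) = spinEm q N * (spinEp q N * spinKi q N)
      + ((qhalf q - (qhalf q)⁻¹)⁻¹ * s ^ 2) • spinK q N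
      - ((qhalf q - (qhalf q)⁻¹)⁻¹ * t) • (1 : Fuzzy N) := by
    rw [← mul_assoc, spinEp_mul_spinEm_eq hq hq1, ← ht', ← hs2]
    simp only [sub_mul, add_mul, smul_mul_assoc, mul_assoc, hKKi, mul_one]
  induction g using Uq.induction generalizing i with
  | hs c =>
    rw [AlgHom.commutes, AlgHom.commutes, Module.algebraMap_end_apply, Finset.sum_eq_single i]
    · rw [Matrix.algebraMap_matrix_apply, if_pos rfl, Algebra.algebraMap_self, RingHom.id_apply]
    · intro j _ hj
      rw [Matrix.algebraMap_matrix_apply, if_neg hj, zero_smul]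
    · simp
  | h1 =>
    rw [act_Ep, vecRep, spinRep_Ep, spinEp_two hq hq1, ← hs', Fin.sum_univ_three]
    fin_cases i
    · simp [h0]
    · simp [h0, h1]
      simp only [mul_sub, sub_mul, mul_one, one_mul, smul_mul_assoc, mul_smul_comm,
        mul_assoc, hKEKi, hKKi]
      match_scalars <;> field_simp <;> ring
    · simp [h1, h2]
      simp only [add_mul, smul_mul_assoc, mul_assoc, neg_mul, hc]
      match_scalars <;> field_simp
      ring
  | h2 =>
    rw [act_Em, vecRep, spinRep_Em, spinEm_two hq hq1, ← hs', Fin.sum_univ_three]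
    fin_cases i
    · simp [h0, h1]
      simp only [sub_mul, smul_mul_assoc, mul_assoc, hc]
      match_scalars <;> field_simp
      ring
    · simp [h1, h2]
      simp only [mul_sub, sub_mul, mul_one, one_mul, smul_mul_assoc, mul_smul_comm,
        mul_assoc, hKEmKi, hKKi]
      match_scalars <;> field_simp <;> ring
    · simp [h2]
  | h3 =>
    rw [QFuzzy.act_K, vecRep, spinRep_K, spinK_two hq, Fin.sum_univ_three]
    fin_cases i
    · simp [h0]
      simp only [mul_assoc, hKEKi]
      match_scalars
      field_simp
    · simp [h1, mul_sub, sub_mul, mul_assoc, hKKi]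
    · simp [h2]
      simp only [mul_assoc, hKEmKi]
      match_scalars
      field_simp
  | h4 =>
    rw [act_Ki, vecRep, spinRep_Ki, spinKi_two hq, Fin.sum_univ_three]
    fin_cases i
    · simp [h0]
      simp only [mul_assoc, hKiEK]
      match_scalars
      field_simp
    · simp [h1, mul_sub, sub_mul, hKiK]
    · simp [h2]
      simp only [mul_assoc, hKiEmK]
      match_scalars
      field_simp
  | ha a b ha hb =>
    rw [map_add, LinearMap.add_apply, ha, hb, ← Finset.sum_add_distrib]
    simp only [map_add, Matrix.add_apply, add_smul]
  | hm a b ha hb =>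
    rw [map_mul, Module.End.mul_apply, hb, map_sum]
    simp only [map_smul, ha, Finset.smul_sum, map_mul, Matrix.mul_apply, Finset.sum_smul, smul_smul]
    rw [Finset.sum_comm]
    refine Finset.sum_congr rfl fun j _ => Finset.sum_congr rfl fun k _ => ?_
    rw [mul_comm]

end vector

/-! ### Generation and the realization of the cross product -/

section generation

variable {q r : ℝ} {N : ℕ}

/-- The matrix units are obtained from the idempotent polynomials in `K` and from `E⁺`, `E⁻`. -/
lemma subalgebra_eq_top (hq : 0 < q) (hq1 : q ≠ 1) (S : Subalgebra ℂ (Fuzzy N))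
    (hE : spinEp q N ∈ S) (hEm : spinEm q N ∈ S) (hK : spinK q N ∈ S) : S = ⊤ := by
  let k : Fin (N + 1) → ℂ := fun i => ((q ^ (((N : ℝ) - 2 * (i : ℕ)) / 2) : ℝ) : ℂ)
  have hk : Function.Injective k := by
    intro i j hij
    have h := (Real.rpow_right_inj hq hq1).mp (Complex.ofReal_injective hij)
    apply Fin.ext
    have : ((i : ℕ) : ℝ) = (j : ℕ) := by linarith
    exact_mod_cast this
  have hdiag : ∀ i, Matrix.single i i (1 : ℂ) ∈ S := by
    intro i
    have hp : Polynomial.aeval (spinK q N) (Lagrange.basis Finset.univ k i)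
        = Matrix.single i i (1 : ℂ) := by
      have e : spinK q N = Matrix.diagonalAlgHom ℂ k := rfl
      rw [e, Polynomial.aeval_algHom_apply, Polynomial.aeval_pi_apply, ← Matrix.diagonal_single]
      change Matrix.diagonal _ = Matrix.diagonal _
      congr 1
      funext j
      rw [Polynomial.coe_aeval_eq_eval]
      by_cases hij : i = j
      · subst hij
        rw [Lagrange.eval_basis_self hk.injOn (Finset.mem_univ i), Pi.single_eq_same]
      · rw [Lagrange.eval_basis_of_ne hij (Finset.mem_univ j), Pi.single_eq_of_ne (Ne.symm hij)]
    rw [← hp]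
    exact Polynomial.aeval_mem_adjoin_singleton ℂ _ |> fun h =>
      Algebra.adjoin_le (Set.singleton_subset_iff.mpr hK) h
  have hcorner : ∀ (a : Fuzzy N) i j, a ∈ S → a i j ≠ 0 → Matrix.single i j (1 : ℂ) ∈ S := by
    intro a i j ha h
    have e : Matrix.single i j (1 : ℂ)
        = (a i j)⁻¹ • (Matrix.single i i 1 * a * Matrix.single j j 1) := by
      rw [Matrix.single_mul_mul_single, Matrix.smul_single, one_mul, mul_one, smul_eq_mul,
        inv_mul_cancel₀ h]
    rw [e]
    exact S.smul_mem (S.mul_mem (S.mul_mem (hdiag i) ha) (hdiag j)) _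
  have hpos : ∀ i : Fin (N + 1), 0 < (i : ℕ) →
      0 < √(qnum q (i : ℕ) * qnum q (N + 1 - (i : ℕ))) := by
    intro i hi
    have h1 : (0 : ℝ) < (i : ℕ) := by exact_mod_cast hi
    have h2 : ((i : ℕ) : ℝ) < N + 1 := by exact_mod_cast i.2
    exact Real.sqrt_pos.mpr (mul_pos (qnum_pos hq hq1 h1) (qnum_pos hq hq1 (by linarith)))
  have hup : ∀ i j : Fin (N + 1), (j : ℕ) = i + 1 → Matrix.single i j (1 : ℂ) ∈ S := by
    intro i j hij
    refine hcorner _ i j hE ?_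
    rw [spinEp, Matrix.of_apply, if_pos hij]
    exact_mod_cast (mul_pos (hpos j (by omega)) (Real.rpow_pos_of_pos hq _)).ne'
  have hdown : ∀ i j : Fin (N + 1), (i : ℕ) = j + 1 → Matrix.single i j (1 : ℂ) ∈ S := by
    intro i j hij
    refine hcorner _ i j hEm ?_
    rw [spinEm, Matrix.of_apply, if_pos hij]
    exact_mod_cast (mul_pos (hpos i (by omega)) (Real.rpow_pos_of_pos hq _)).ne'
  have htrans : ∀ i j l : Fin (N + 1), Matrix.single i j (1 : ℂ) ∈ S →
      Matrix.single j l (1 : ℂ) ∈ S → Matrix.single i l (1 : ℂ) ∈ S := by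
    intro i j l h h'
    have := S.mul_mem h h'
    rwa [Matrix.single_mul_single_same, one_mul] at this
  have hzero : ∀ n (hn : n < N + 1), Matrix.single 0 (⟨n, hn⟩ : Fin (N + 1)) (1 : ℂ) ∈ S ∧
      Matrix.single (⟨n, hn⟩ : Fin (N + 1)) 0 (1 : ℂ) ∈ S := by
    intro n
    induction n with
    | zero => exact fun hn => ⟨hdiag 0, hdiag 0⟩
    | succ n ih =>
      intro hn
      have h := ih (by omega)
      exact ⟨htrans _ _ _ h.1 (hup _ _ rfl), htrans _ _ _ (hdown _ _ rfl) h.2⟩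
  refine eq_top_iff.mpr fun a _ => ?_
  rw [Matrix.matrix_eq_sum_single a]
  refine S.sum_mem fun i _ => S.sum_mem fun j _ => ?_
  rw [← mul_one (a i j), ← smul_eq_mul, ← Matrix.smul_single]
  exact S.smul_mem (htrans i 0 j (hzero i i.2).2 (hzero j j.2).1) _

lemma adjoin_gen (hq : 0 < q) (hq1 : q ≠ 1) (hN : 1 ≤ N) (hr : 0 < r) :
    Algebra.adjoin ℂ (Set.range (gen q r N)) = ⊤ := by
  obtain ⟨s, n, t, hs, hn, ht, hs2, -, -, ht', hl, h0, h1, h2⟩ := exists_normal_form hq hq1 hN r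
  have hv := qhalf_ne_zero hq
  have hw := qhalf_sub_inv_ne_zero hq hq1
  have hr' : (r : ℂ) ≠ 0 := by exact_mod_cast hr.ne'
  have hmem : ∀ i, gen q r N i ∈ Algebra.adjoin ℂ (Set.range (gen q r N)) := fun i =>
    Algebra.subset_adjoin ⟨i, rfl⟩
  have hscale : ∀ (c : ℂ) (a : Fuzzy N), c ≠ 0 →
      c • a ∈ Algebra.adjoin ℂ (Set.range (gen q r N)) →
      a ∈ Algebra.adjoin ℂ (Set.range (gen q r N)) := fun c a hc h => by
    have := Subalgebra.smul_mem _ h c⁻¹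
    rwa [smul_smul, inv_mul_cancel₀ hc, one_smul] at this
  refine subalgebra_eq_top hq hq1 _ ?_ ?_ ?_
  · refine hscale _ _ ?_ (h0 ▸ hmem 0)
    simp [hr', hv, hs, hn]
  · have h := neg_mem (h2 ▸ hmem 2)
    rw [neg_neg] at h
    refine hscale _ _ ?_ h
    simp [hr', hv, hs, hn]
  · have h := hscale _ _ (by simp [hr', ht, hn, hw]) (h1 ▸ hmem 1)
    have h' := sub_mem (one_mem (Algebra.adjoin ℂ (Set.range (gen q r N)))) h
    rw [sub_sub_cancel] at h'
    refine hscale _ _ ?_ h'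
    simp [hs, ht]

end generation

section realization

variable {q r : ℝ} (hq : 0 < q) (N : ℕ)

lemma phiHat_tmul (a : Fuzzy N) (g : Uq q) : phiHat hq N (a ⊗ₜ g) = a * spinRep hq N g := rfl

lemma crossMul_tmul (a b : Fuzzy N) (g h : Uq q) :
    crossMul hq N ((a ⊗ₜ g) ⊗ₜ (b ⊗ₜ h))
      = TensorProduct.map (LinearMap.mulLeft ℂ a ∘ₗ LinearMap.applyₗ b ∘ₗ (act hq N).toLinearMap)
        (LinearMap.mulRight ℂ h) (Bialgebra.comulAlgHom ℂ (Uq q) g) := by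
  have e : crossMul hq N ((a ⊗ₜ g) ⊗ₜ (b ⊗ₜ h))
      = TensorProduct.map (LinearMap.mul' ℂ (Fuzzy N)) (LinearMap.mul' ℂ (Uq q))
        ((TensorProduct.assoc ℂ _ _ _).symm (TensorProduct.map LinearMap.id
          ((TensorProduct.assoc ℂ _ _ _).toLinearMap) (a ⊗ₜ ((TensorProduct.map
            (LinearMap.applyₗ b ∘ₗ (act hq N).toLinearMap) LinearMap.id (Uq.comul q g)) ⊗ₜ h)))) :=
    rfl
  rw [e]
  change _ = TensorProduct.map _ _ (Uq.comul q g)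
  induction Uq.comul q g with
  | zero => simp
  | add x y hx hy =>
    simp only [map_add, TensorProduct.add_tmul, TensorProduct.tmul_add] at hx hy ⊢
    rw [hx, hy]
  | tmul u v => simp

lemma phiHat_crossMul (ξ η : Fuzzy N ⊗[ℂ] Uq q) :
    phiHat hq N (crossMul hq N (ξ ⊗ₜ η)) = phiHat hq N ξ * phiHat hq N η := by
  induction ξ with
  | zero => simp
  | add x y hx hy => simp only [map_add, TensorProduct.add_tmul, add_mul, hx, hy]
  | tmul a g =>
    induction η with
    | zero => simp
    | add x y hx hy => simp only [map_add, TensorProduct.tmul_add, mul_add, hx, hy]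
    | tmul b h =>
      rw [crossMul_tmul, phiHat_tmul, phiHat_tmul, mul_assoc a, ← mul_assoc _ b,
        implements_spinRep hq N g b]
      induction Bialgebra.comulAlgHom ℂ (Uq q) g with
      | zero => simp
      | add x y hx hy => simp only [map_add, add_mul, mul_add, hx, hy]
      | tmul u v => simp [phiHat_tmul, mul_assoc]

lemma isRealization_phiHat (hq1 : q ≠ 1) (hN : 1 ≤ N) (hr : 0 < r) :
    IsRealization hq N r (phiHat hq N) where
  map_one := by simp [phiHat_tmul]
  map_mul := phiHat_crossMul hq N
  map_fuzzy a := by simp [phiHat_tmul]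
  map_Ep := by
    have hX : √(q⁻¹ * qnum q 2 * cN q N) ≠ 0 := by
      rw [sqrt_norm_Ep hq hq1 hN]
      exact (div_pos (sqrt_qnum_prod_pos hq hq1 hN)
        (mul_pos (rpow_half_pos hq) (sqrt_qnum_two_pos hq hq1))).ne'
    change _ = _ • (((r / √(q⁻¹ * qnum q 2 * cN q N) : ℝ) : ℂ) • spinEp q N)
    rw [phiHat_tmul, spinRep_Ep, one_mul, smul_smul, ← Complex.ofReal_mul]
    generalize √(q⁻¹ * qnum q 2 * cN q N) = X at hX ⊢
    rw [show 1 / r * X * (r / X) = 1 by field_simp, Complex.ofReal_one, one_smul]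
  map_Em := by
    have hX : √(q * qnum q 2 * cN q N) ≠ 0 := by
      rw [sqrt_norm_Em hq hq1 hN]
      exact (div_pos (mul_pos (rpow_half_pos hq) (sqrt_qnum_prod_pos hq hq1 hN))
        (sqrt_qnum_two_pos hq hq1)).ne'
    change _ = -(_ • (-(((r / √(q * qnum q 2 * cN q N) : ℝ) : ℂ) • spinEm q N)))
    rw [phiHat_tmul, spinRep_Em, one_mul, smul_neg, neg_neg, smul_smul, ← Complex.ofReal_mul]
    generalize √(q * qnum q 2 * cN q N) = X at hX ⊢
    rw [show 1 / r * X * (r / X) = 1 by field_simp, Complex.ofReal_one, one_smul]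
  map_K := by
    have h1 := rpow_half_sub_inv_ne_zero hq hq1
    have h2 := (lambdaN_pos hq hq1 hN hr).ne'
    have h3 := (qnum_pow_two_pos hq hq1 N).ne'
    have h4 := (qnum_pos hq hq1 two_pos).ne'
    change _ = _ • (1 - _ • (((lambdaN q r N / (q ^ (1 / 2 : ℝ) - q ^ (-1 / 2 : ℝ)) : ℝ) : ℂ) •
      (1 - ((qnum q 2 / qnum (q ^ (N + 1)) 2 : ℝ) : ℂ) • spinK q N)))
    rw [rpow_neg_half hq, phiHat_tmul, spinRep_K, one_mul, smul_smul, ← Complex.ofReal_mul]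
    rw [show (q ^ (1 / 2 : ℝ) - (q ^ (1 / 2 : ℝ))⁻¹) / lambdaN q r N
        * (lambdaN q r N / (q ^ (1 / 2 : ℝ) - (q ^ (1 / 2 : ℝ))⁻¹)) = 1 by
      rw [div_mul_div_comm, mul_comm, div_self (mul_ne_zero h2 h1)]]
    rw [Complex.ofReal_one, one_smul, sub_sub_cancel, smul_smul, ← Complex.ofReal_mul]
    rw [show qnum (q ^ (N + 1)) 2 / qnum q 2 * (qnum q 2 / qnum (q ^ (N + 1)) 2) = 1 by
      field_simp, Complex.ofReal_one, one_smul]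

lemma crossMul_fuzzy_left (a : Fuzzy N) (g : Uq q) :
    crossMul hq N ((a ⊗ₜ 1) ⊗ₜ (1 ⊗ₜ g)) = a ⊗ₜ g := by
  rw [crossMul_tmul, map_one (Bialgebra.comulAlgHom ℂ (Uq q)), Algebra.TensorProduct.one_def]
  simp

lemma crossMul_one_one (g h : Uq q) :
    crossMul hq N ((1 ⊗ₜ g) ⊗ₜ (1 ⊗ₜ h)) = 1 ⊗ₜ (g * h) := by
  have e := congrArg (fun t : ℂ ⊗[ℂ] Uq q => TensorProduct.map
    (Algebra.linearMap ℂ (Fuzzy N)) (LinearMap.mulRight ℂ h) t) (Coalgebra.rTensor_counit_comul g)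
  simp only [TensorProduct.map_tmul] at e
  rw [crossMul_tmul]
  refine Eq.trans ?_ (e.trans (by simp))
  change _ = TensorProduct.map _ _ (LinearMap.rTensor (Uq q) CoalgebraStruct.counit
    (Bialgebra.comulAlgHom ℂ (Uq q) g))
  induction Bialgebra.comulAlgHom ℂ (Uq q) g with
  | zero => simp
  | add x y hx hy => simp only [map_add, hx, hy]
  | tmul u v =>
    simp only [TensorProduct.map_tmul, LinearMap.rTensor_tmul, LinearMap.comp_apply,
      AlgHom.toLinearMap_apply, LinearMap.applyₗ_apply_apply, act_one, LinearMap.mulLeft_apply,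
      one_mul]
    rfl

/-- A realization is determined by its values on the generators, as `a ⊗ g` is a product in the
cross product algebra. -/
lemma eq_phiHat (hq1 : q ≠ 1) (hN : 1 ≤ N) (hr : 0 < r) (Ψ : Fuzzy N ⊗[ℂ] Uq q →ₗ[ℂ] Fuzzy N)
    (hΨ : IsRealization hq N r Ψ) : Ψ = phiHat hq N := by
  have hφ := isRealization_phiHat hq N hq1 hN hr
  let G : Uq q →ₐ[ℂ] Fuzzy N := AlgHom.ofLinearMap (Ψ ∘ₗ TensorProduct.mk ℂ (Fuzzy N) (Uq q) 1)
    hΨ.map_one fun g h => by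
      have := hΨ.map_mul (1 ⊗ₜ g) (1 ⊗ₜ h)
      rwa [crossMul_one_one] at this
  have hG : ∀ g, G g = Ψ (1 ⊗ₜ g) := fun g => rfl
  have hφ1 : ∀ g, spinRep hq N g = phiHat hq N (1 ⊗ₜ g) := fun g => by
    rw [phiHat_tmul, one_mul]
  have hK : G (Uq.K q) = spinRep hq N (Uq.K q) := by rw [hG, hΨ.map_K, hφ1, hφ.map_K]
  have hGs : G = spinRep hq N := by
    refine Uq.hom_ext ?_ ?_ hK ?_
    · rw [hG, hΨ.map_Ep, hφ1, hφ.map_Ep]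
    · rw [hG, hΨ.map_Em, hφ1, hφ.map_Em]
    · refine left_inv_eq_right_inv (a := G (Uq.K q)) ?_ ?_
      · rw [← map_mul, Uq.Ki_K, map_one]
      · rw [hK, ← map_mul, Uq.K_Ki, map_one]
  refine TensorProduct.ext' fun a g => ?_
  rw [← crossMul_fuzzy_left hq N a g, hΨ.map_mul, hφ.map_mul, hΨ.map_fuzzy, hφ.map_fuzzy, ← hG, hGs,
    hφ1]

end realization

section star

variable {q : ℝ} (hq : 0 < q) (N : ℕ)

/-- The spin representations are `*`-representations. -/
lemma spinRep_conj (g : Uq q) : spinRep hq N (Uq.conj g) = star (spinRep hq N g) := by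
  have hcm : ∀ a b : Uq q, Uq.conj (a * b) = Uq.conj b * Uq.conj a := fun a b => by
    rw [Uq.conj, map_mul]
    rfl
  have hca : ∀ a b : Uq q, Uq.conj (a + b) = Uq.conj a + Uq.conj b := fun a b => by
    rw [Uq.conj, map_add, map_add]
    rfl
  induction g using Uq.induction with
  | hs c =>
    have e : Uq.conj (algebraMap ℂ (Uq q) c) = algebraMap ℂ (Uq q) (star c) := by
      rw [Uq.conj, AlgHom.commutes, Algebra.algebraMap_eq_smul_one, ← Uq.toConjOp_one,
        Uq.smul_toConjOp, AddEquiv.symm_apply_apply, Algebra.algebraMap_eq_smul_one]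
      rfl
    rw [e, AlgHom.commutes, AlgHom.commutes, Algebra.algebraMap_eq_smul_one,
      Algebra.algebraMap_eq_smul_one, star_smul, star_one]
  | h1 =>
    have e : Uq.conj (Uq.Ep q) = (qhalf q)⁻¹ • Uq.Em q := by simp [Uq.conj, Uq.starHom]
    rw [e, map_smul, spinRep_Em, spinRep_Ep, star_spinEp hq]
  | h2 =>
    have e : Uq.conj (Uq.Em q) = qhalf q • Uq.Ep q := by simp [Uq.conj, Uq.starHom]
    rw [e, map_smul, spinRep_Em, spinRep_Ep, star_spinEm hq]
  | h3 =>
    have e : Uq.conj (Uq.K q) = Uq.K q := by simp [Uq.conj, Uq.starHom]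
    rw [e, spinRep_K, star_spinK]
  | h4 =>
    have e : Uq.conj (Uq.Ki q) = Uq.Ki q := by simp [Uq.conj, Uq.starHom]
    rw [e, spinRep_Ki, star_spinKi]
  | ha a b ha hb => rw [hca, map_add, ha, hb, map_add, star_add]
  | hm a b ha hb => rw [hcm, map_mul, ha, hb, map_mul, star_mul]

lemma phiHat_star (a : Fuzzy N) (g : Uq q) :
    phiHat hq N (crossMul hq N ((1 ⊗ₜ Uq.conj g) ⊗ₜ (star a ⊗ₜ 1)))
      = star (phiHat hq N (a ⊗ₜ g)) := by
  rw [phiHat_crossMul, phiHat_tmul, phiHat_tmul, phiHat_tmul, one_mul, map_one, mul_one,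
    spinRep_conj, star_mul]

end star

end

end QFuzzy

theorem proposition5 (q r : ℝ) (hq : 0 < q) (hq1 : q ≠ 1) (hr : 0 < r) (N M : ℕ) (hN : 1 ≤ N)
    (hM : 1 ≤ M) :
    -- the fuzzy sphere: its generators, relations and star structure
    Algebra.adjoin ℂ (Set.range (gen q r N)) = ⊤ ∧
    (∀ k, ∑ i, ∑ j, eps q k i j • (gen q r N i * gen q r N j)
      = ((lambdaN q r N : ℝ) : ℂ) • gen q r N k) ∧
    (∑ i, ∑ j, metric q i j • (gen q r N i * gen q r N j)
      = algebraMap ℂ (Fuzzy N) ((r : ℂ) ^ 2)) ∧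
    (∀ i, star (gen q r N i) = ∑ j, metric q i j • gen q r N j) ∧
    -- it is a left module algebra whose generators carry the vector representation
    (∀ g i, act hq N g (gen q r N i) = ∑ j, vecRep hq g j i • gen q r N j) ∧
    (∀ (g : Uq q) (a b : Fuzzy N), act hq N g (a * b) = LinearMap.mul' ℂ (Fuzzy N)
      (TensorProduct.map (LinearMap.applyₗ a ∘ₗ (act hq N).toLinearMap)
        (LinearMap.applyₗ b ∘ₗ (act hq N).toLinearMap) (CoalgebraStruct.comul (R := ℂ) g))) ∧
    (∀ g : Uq q, act hq N g 1 = algebraMap ℂ (Fuzzy N) (CoalgebraStruct.counit (R := ℂ) g)) ∧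
    -- the explicit `*`-homomorphism from the cross product
    IsRealization hq N r (phiHat hq N) ∧
    (∀ Ψ, IsRealization hq N r Ψ → Ψ = phiHat hq N) ∧
    (∀ (a : Fuzzy N) (g : Uq q),
      phiHat hq N (crossMul hq N ((1 ⊗ₜ Uq.conj g) ⊗ₜ (star a ⊗ₜ 1)))
        = star (phiHat hq N (a ⊗ₜ g))) ∧
    -- the braided tensor products and their unbraiding
    IsUnit (Rleft hq N) ∧
    ∀ s : Sign,
      Function.Bijective (orderedMul hq N M s) ∧
      ∃ e : Fin M → (Fuzzy N →ₐ[ℂ] Braided hq N M s),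
        (∀ α a, e α a = unbraided hq N M s α a) ∧
        e ⟨0, hM⟩ = emb hq N M s ⟨0, hM⟩ ∧
        (∀ α, Function.Injective (e α)) ∧
        ∃ Φ : PiTensorProduct ℂ (fun α : Fin M => (e α).range) ≃ₐ[ℂ] Braided hq N M s,
          ∀ (α : Fin M) (a : (e α).range),
            Φ (PiTensorProduct.singleAlgHom α a) = (a : Braided hq N M s) := by
  refine ⟨adjoin_gen hq hq1 hN hr, eps_relations hq hq1 hN, metric_relation hq hq1 hN,
    star_gen hq hq1 hN, act_gen hq hq1 hN, act_mul hq N, act_one hq N,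
    isRealization_phiHat hq N hq1 hN hr, eq_phiHat hq N hq1 hN hr, phiHat_star hq N,
    isUnit_Rleft hq N, fun s => ?_⟩
  cases s with
  | plus =>
    exact braided_decomposition hM (isHalfR_inverse_flipR hq N hq1) (implements_spinRep hq N)
      (fun a b => by rw [braid_plus, onPairSwap_apply]) (unbraid_plus hq N)
  | minus =>
    exact braided_decomposition hM (isHalfR_Rleft hq N hq1) (implements_spinRep hq N)
      (fun a b => by rw [braid_minus, onPairSwap_apply]) (unbraid_minus hq N)
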